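/- **Setting.** Let $d\ge 1$, $T>0$, $a>0$, $\gamma>1$, let $\mathbb T^d=(\mathbb R/\mathbb Z)^d$, $Q=(0,T)\times\mathbb T^d$, $p(\varrho)=a\varrho^\gamma$, and $$E(\varrho,m)=\tfrac12\tfrac{|m|^2}{\varrho}+\tfrac{a}{\gamma-1}\varrho^\gamma\ \text{if }\varrho>0,\qquad E(0,0)=0,\qquad E=\infty\ \text{otherwise}.$$ Fix a constant $\kappa$ with $0<\kappa\le\min\{\tfrac12,\tfrac1{d(\gamma-1)}\}$. Let $(\varrho_0,m_0)$ be integrable on $\mathbb T^d$ with $\int_{\mathbb T^d}E(\varrho_0,m_0)\,dx<\infty$. A *Reynolds stress* is an element $\mathfrak R\in L^\infty_{\text{weak-}(*)}(0,T;\mathcal M^+(\mathbb T^d;\mathbb R^{d\times d}_{\rm sym}))$, where $\mathcal M^+$ denotes the positive semi-definite matrix-valued measures. For measurable $\varrho:Q\to\mathbb R$, $m:Q\to\mathbb R^d$, initial data $(r_0,\mu_0)$, a Reynolds stress $\mathfrak R$, and $\varphi\in C_c^\infty([0,T)\times\mathbb T^d)$, $\boldsymbol\varphi\in C_c^\infty([0,T)\times\mathbb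 T^d;\mathbb R^d)$, put $$e^1[\varphi]=\int_Q(\varrho\,\partial_t\varphi+m\cdot\nabla_x\varphi)\,dx\,dt+\int_{\mathbb T^d}r_0\,\varphi(0,\cdot)\,dx,$$ $$e^2[\boldsymbol\varphi]=\int_Q\Big(m\cdot\partial_t\boldsymbol\varphi+1_{\varrho>0}\tfrac{m\otimes m}{\varrho}:\nabla_x\boldsymbol\varphi+p(\varrho)\,{\rm div}_x\boldsymbol\varphi\Big)dx\,dt+\int_0^T\!\!\int_{\mathbb T^d}\nabla_x\boldsymbol\varphi:d\mathfrak R(t,\cdot)\,dt+\int_{\mathbb T^d}\mu_0\cdot\boldsymbol\varphi(0,\cdot)\,dx .$$ *Dissipative solution* with data $(\varrho_0,m_0)$: a measurable pair $(\varrho,m)$ for which there is a Reynolds stress $\mathfrak R$ such that $e^1[\varphi]=0$ and $e^2[\boldsymbol\varphi]=0$ for all test functions (with $r_0=\varrho_0$, $\mu_0=m_0$), and for a.e. $t\in(0,T)$ $$\int_{\mathbb T^d}E(\varrho,m)(t,\cdot)\,dx+\kappa\int_{\mathbb T^d}d\,{\rm tr}[\mathfrak R](t,\cdot)\le\int_{\mathbb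 T^d}E(\varrho_0,m_0)\,dx .$$ *Consistent approximation*: a sequence of measurable pairs $(\varrho_n,m_n)_{n\ge1}$ for which there are Reynolds stresses $\mathfrak R_n$, integrable data $(\varrho_{0,n},m_{0,n})$ and numbers $E_n\in[0,\infty)$ such that the corresponding $e^1_n[\varphi]$ and $e^2_n[\boldsymbol\varphi]$ tend to $0$ as $n\to\infty$ for each fixed test function; $\int_{\mathbb T^d}E(\varrho_n,m_n)(t,\cdot)\,dx+\kappa\int_{\mathbb T^d}d\,{\rm tr}[\mathfrak R_n](t,\cdot)\le E_n$ for a.e. $t\in(0,T)$; $\varrho_{0,n}\to\varrho_0$ and $m_{0,n}\to m_0$ weakly in $L^1(\mathbb T^d)$; and $\limsup_n E_n\le\int_{\mathbb T^d}E(\varrho_0,m_0)\,dx$. Write $U_n=(\varrho_n,m_n):Q\to\mathbb R^{d+1}$ and $c_b(n,m)=\int_Q b(U_n)b(U_m)\,dy$. Let $W$ be the set of $w\in C^1[0,1]$ with $w\ge0$, $\int_0^1w=1$, and let $w_N=\sum_{n=1}^Nw(n/N)$. *Weakly (S)-convergent*: for every $b\in C_c(\mathbb R^{d+1})$ the limit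 $\ell_m=\lim_N\frac1N\sum_{n=1}^Nc_b(n,m)$ exists for each $m$, and the limits $\lim_N\frac1{N^2}\sum_{n,m=1}^Nc_b(n,m)$ and $\lim_M\frac1M\sum_{m=1}^M\ell_m$ exist and are equal. *Strongly (S)-convergent*: for every $b\in C_c(\mathbb R^{d+1})$ and every $w\in W$ the limit $\ell_m=\lim_N\frac1{w_N}\sum_{n=1}^Nw(\tfrac nN)c_b(n,m)$ exists for each $m$ and is independent of $w$, and the limits $\lim_N\frac1{w_N^2}\sum_{n,m=1}^Nw(\tfrac nN)w(\tfrac mN)c_b(n,m)$ and $\lim_M\frac1{w_M}\sum_{m=1}^Mw(\tfrac mM)\ell_m$ exist and are equal. For a parametrized probability measure $\mathcal V=(\mathcal V_y)_{y\in Q}$ on $\mathbb R^{d+1}$, $U_n\stackrel{(S)}{\to}\mathcal V$ means that $(U_n)$ is weakly (S)-convergent and $\frac1N\sum_{n=1}^Nb(U_n)\to\langle\mathcal V;b\rangle$ weakly-(*) in $L^\infty(Q)$ for all $b\in C_c(\mathbb R^{d+1})$. For $s\ge1$, $d_{W_s}$ is the Wasserstein distance of order $s$ on probability measures on $\mathbb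 R^{d+1}$. **Statement.** Let $(\varrho_n,m_n)_{n\ge1}$ be a consistent approximation with data $(\varrho_0,m_0)$ that is weakly (S)-convergent. Then there are a dissipative solution $(\varrho,m)$ with data $(\varrho_0,m_0)$ and a parametrized probability measure $(\mathcal V_{t,x})_{(t,x)\in Q}$ on $\mathbb R^{d+1}$ such that: 1. $\frac1N\sum_{n=1}^N\varrho_n\to\varrho$ in $L^q(Q)$ for all $1\le q<\gamma$, and $\frac1N\sum_{n=1}^Nm_n\to m$ in $L^q(Q;\mathbb R^d)$ for all $1\le q<\frac{2\gamma}{\gamma+1}$; 2. $(\varrho_n,m_n)\stackrel{(S)}{\to}\mathcal V$; $\mathcal V$ is, up to a null set of $Q$, the only parametrized probability measure with this property; and $$\int_0^T\!\!\int_{\mathbb T^d}d_{W_s}\Big[\tfrac1N\sum_{n=1}^N\delta_{(\varrho_n,m_n)(t,x)};\mathcal V_{t,x}\Big]^s\,dx\,dt\to0\quad\text{for all }1\le s<\tfrac{2\gamma}{\gamma+1};$$ 3. if, in addition, $(\varrho_n,m_n)$ is strongly (S)-convergent, then for every $w\in W$ the limits in 1 and 2 remain valid, with the same $\varrho$, $m$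 and $\mathcal V$, when $\frac1N\sum_{n=1}^N(\cdot)$ is replaced by $\frac1{w_N}\sum_{n=1}^Nw(\tfrac nN)(\cdot)$ (in the (S)-limit this means that $\frac1{w_N}\sum_{n=1}^Nw(\tfrac nN)b(U_n)\to\langle\mathcal V;b\rangle$ weakly-(*) in $L^\infty(Q)$ for all $b\in C_c(\mathbb R^{d+1})$). -/

import Mathlib

open MeasureTheory ProbabilityTheory Filter Topology Set
open scoped ENNReal NNReal ContDiff CompactlySupported

namespace EulerS

noncomputable section

/-! ### Averages, weights and Wasserstein distance

A sequence `U₁, U₂, …` is indexed by `ℕ`, the term `U n` standing for `U_{n+1}`; hence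
`∑ n ∈ Finset.range N` is the sum over the first `N` terms, and the term with index `n` carries
the weight `w ((n + 1) / N)`. -/

/-- The set `W`: non-negative `C¹` functions on `[0,1]` with integral one. -/
def Weights : Set (ℝ → ℝ) :=
  {w | ContDiffOn ℝ 1 w (Icc 0 1) ∧ (∀ z ∈ Icc (0 : ℝ) 1, 0 ≤ w z) ∧ ∫ z in (0 : ℝ)..1, w z = 1}

/-- `w_N = ∑_{n=1}^N w(n/N)`. -/
def weightSum (w : ℝ → ℝ) (N : ℕ) : ℝ :=
  ∑ n ∈ Finset.range N, w (((n : ℝ) + 1) / N)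

/-- `(1/w_N) ∑_{n=1}^N w(n/N) x_n`; for `w = 1` this is the Cesàro average `(1/N) ∑_{n=1}^N x_n`. -/
def weightedMean {E : Type*} [AddCommMonoid E] [Module ℝ E] (w : ℝ → ℝ) (N : ℕ) (x : ℕ → E) : E :=
  (weightSum w N)⁻¹ • ∑ n ∈ Finset.range N, w (((n : ℝ) + 1) / N) • x n

/-- The empirical measure `(1/w_N) ∑_{n=1}^N w(n/N) δ_{x_n}`. -/
def weightedEmpirical {E : Type*} [MeasurableSpace E] (w : ℝ → ℝ) (N : ℕ) (x : ℕ → E) :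
    Measure E :=
  ∑ n ∈ Finset.range N,
    ENNReal.ofReal ((weightSum w N)⁻¹ * w (((n : ℝ) + 1) / N)) • Measure.dirac (x n)

/-- The Wasserstein distance of order `s`: the infimum is over all couplings of `μ` and `ν`. -/
def wassersteinDist {E : Type*} [PseudoEMetricSpace E] [MeasurableSpace E] (s : ℝ)
    (μ ν : Measure E) : ℝ≥0∞ :=
  (⨅ (π : Measure (E × E)) (_ : π.map Prod.fst = μ) (_ : π.map Prod.snd = ν),
    ∫⁻ z, edist z.1 z.2 ^ s ∂π) ^ (1 / s)

/-! ### (S)-convergence -/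

section SConvergence

variable {Y E : Type*} [MeasurableSpace Y] [TopologicalSpace E]

/-- The correlation `∫_Q b(U_n) b(U_m) dy`. -/
def correlation (Q : Measure Y) (U : ℕ → Y → E) (b : E → ℝ) (n m : ℕ) : ℝ :=
  ∫ y, b (U n y) * b (U m y) ∂Q

/-- Weak (S)-convergence: the weak correlation limits `ℓ m` exist, and the two limits in the weak
correlation disintegration exist and agree. -/
def WeaklySConvergent (Q : Measure Y) (U : ℕ → Y → E) : Prop :=
  ∀ b : C_c(E, ℝ), ∃ ℓ : ℕ → ℝ,
    (∀ m, Tendsto (fun N : ℕ => (N : ℝ)⁻¹ * ∑ n ∈ Finset.range N, correlation Q U b n m)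
      atTop (𝓝 (ℓ m))) ∧
    ∃ L : ℝ,
      Tendsto (fun N : ℕ => ((N : ℝ) ^ 2)⁻¹ *
        ∑ n ∈ Finset.range N, ∑ m ∈ Finset.range N, correlation Q U b n m) atTop (𝓝 L) ∧
      Tendsto (fun M : ℕ => (M : ℝ)⁻¹ * ∑ m ∈ Finset.range M, ℓ m) atTop (𝓝 L)

/-- Strong (S)-convergence: the strong correlation limits `ℓ m` exist and do not depend on the
weight `w`, and the strong correlation disintegration holds for every weight. -/
def StronglySConvergent (Q : Measure Y) (U : ℕ → Y → E) : Prop :=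
  ∀ b : C_c(E, ℝ), ∃ ℓ : ℕ → ℝ,
    (∀ w ∈ Weights, ∀ m,
      Tendsto (fun N : ℕ => weightedMean w N (fun n => correlation Q U b n m))
        atTop (𝓝 (ℓ m))) ∧
    ∀ w ∈ Weights, ∃ L : ℝ,
      Tendsto (fun N : ℕ => ((weightSum w N) ^ 2)⁻¹ *
        ∑ n ∈ Finset.range N, ∑ m ∈ Finset.range N,
          w (((n : ℝ) + 1) / N) * w (((m : ℝ) + 1) / N) * correlation Q U b n m)
        atTop (𝓝 L) ∧
      Tendsto (fun M : ℕ => weightedMean w M ℓ) atTop (𝓝 L)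

variable [MeasurableSpace E]

/-- For each `b ∈ C_c`, the averages `(1/w_N) ∑_{n=1}^N w(n/N) b(U_n)` converge weakly-(*) in
`L^∞(Q)` to the function `y ↦ ⟨𝒱_y; b⟩`. -/
def HasSLimit (Q : Measure Y) (w : ℝ → ℝ) (U : ℕ → Y → E) (V : Kernel Y E) : Prop :=
  ∀ b : C_c(E, ℝ), ∀ φ : Y → ℝ, Integrable φ Q →
    Tendsto (fun N : ℕ => ∫ y, φ y * weightedMean w N (fun n => b (U n y)) ∂Q) atTop
      (𝓝 (∫ y, φ y * (∫ u, b u ∂(V y)) ∂Q))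

/-- `U_n` (S)-converges to `𝒱`: the sequence is weakly (S)-convergent and `𝒱` is its (S)-limit. -/
def SConvergesTo (Q : Measure Y) (U : ℕ → Y → E) (V : Kernel Y E) : Prop :=
  WeaklySConvergent Q U ∧ HasSLimit Q 1 U V

end SConvergence

/-! ### The isentropic Euler system on the torus -/

/-- The flat torus `𝕋^d = (ℝ/ℤ)^d`. -/
abbrev Torus (d : ℕ) := UnitAddTorus (Fin d)

/-- Values of the momentum. -/
abbrev Vec (d : ℕ) := EuclideanSpace ℝ (Fin d)

/-- Values of the pair (density, momentum): `ℝ^{1+d}` with its Euclidean norm. -/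
abbrev State (d : ℕ) := WithLp 2 (ℝ × Vec d)

/-- Lebesgue measure on the space-time domain `(0,T) × 𝕋^d`. -/
def spaceTime (d : ℕ) (T : ℝ) : Measure (ℝ × Torus d) :=
  (volume.restrict (Ioo 0 T)).prod volume

/-- The pair `(ϱ, m)` as one function with values in the state space. -/
def toState {d : ℕ} (ρ : ℝ × Torus d → ℝ) (m : ℝ × Torus d → Vec d) (y : ℝ × Torus d) : State d :=
  WithLp.toLp 2 (ρ y, m y)

/-- The isentropic pressure `p(ϱ) = a ϱ^γ`. -/
def pressure (a γ r : ℝ) : ℝ := a * r ^ γ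

/-- The energy `E(ϱ, m)`, with pressure potential `P(ϱ) = a/(γ-1) ϱ^γ`. -/
def energy {d : ℕ} (a γ r : ℝ) (v : Vec d) : ℝ≥0∞ :=
  open Classical in
  if 0 < r then ENNReal.ofReal (1 / 2 * (‖v‖ ^ 2 / r) + a / (γ - 1) * r ^ γ)
  else if r = 0 ∧ v = 0 then 0 else ⊤

/-- The entry `1_{ϱ>0} m_i m_j / ϱ` of the convective term. -/
def convective {d : ℕ} (r : ℝ) (v : Vec d) (i j : Fin d) : ℝ :=
  if 0 < r then v i * v j / r else 0

/-- Test functions of class `C_c^∞([0,T) × 𝕋^d)`, given as restrictions to `[0,T)` of smooth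
functions of `t ∈ ℝ` and `x ∈ 𝕋^d` that vanish for `t` close to `T`. Smoothness is that of the
lift to `ℝ × ℝ^d`. -/
def IsTestFunction {d : ℕ} (T : ℝ) (φ : ℝ × Torus d → ℝ) : Prop :=
  ContDiff ℝ ∞ (fun z : ℝ × (Fin d → ℝ) => φ (z.1, fun i => (z.2 i : UnitAddCircle))) ∧
    ∃ τ < T, ∀ t x, τ ≤ t → φ (t, x) = 0

/-- The time derivative `∂_t φ`. -/
def dt {d : ℕ} (φ : ℝ × Torus d → ℝ) (y : ℝ × Torus d) : ℝ :=
  deriv (fun t : ℝ => φ (t, y.2)) y.1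

/-- The space derivative `∂_{x_j} φ`. -/
def dx {d : ℕ} (j : Fin d) (φ : ℝ × Torus d → ℝ) (y : ℝ × Torus d) : ℝ :=
  deriv (fun h : ℝ => φ (y.1, y.2 + Pi.single j (h : UnitAddCircle))) 0

/-- A family of matrices of signed measures on the torus, parametrized by time. -/
abbrev StressField (d : ℕ) := ℝ → Fin d → Fin d → SignedMeasure (Torus d)

/-- The total mass of the trace, `∫_{𝕋^d} d tr[ℜ](t, ·)`. -/
def traceMass {d : ℕ} (R : StressField d) (t : ℝ) : ℝ := ∑ i, R t i i univ

/-- `ℜ ∈ L^∞(0,T; 𝓜⁺(𝕋^d; ℝ^{d×d}_sym))`: for a.e. time a symmetric and positive semi-definite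
matrix-valued measure, weakly-(*) measurable and essentially bounded in time. (For positive
semi-definite matrix measures the trace controls the total variation.) -/
structure IsReynoldsStress {d : ℕ} (T : ℝ) (R : StressField d) : Prop where
  symm : ∀ᵐ t ∂(volume.restrict (Ioo 0 T)), ∀ i j, R t i j = R t j i
  posSemidef : ∀ᵐ t ∂(volume.restrict (Ioo 0 T)), ∀ (ξ : Fin d → ℝ) (A : Set (Torus d)),
    MeasurableSet A → 0 ≤ ∑ i, ∑ j, ξ i * ξ j * R t i j A
  measurable : ∀ i j, ∀ f : C(Torus d, ℝ),
    AEStronglyMeasurable (fun t => ∫ᵛ x, f x ∂•(R t i j)) (volume.restrict (Ioo 0 T))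
  bounded : ∃ C : ℝ, ∀ᵐ t ∂(volume.restrict (Ioo 0 T)), traceMass R t ≤ C

/-- The residual of the weak form of the continuity equation with initial density `ρ₀`. -/
def continuityResidual {d : ℕ} (T : ℝ) (ρ₀ : Torus d → ℝ) (ρ : ℝ × Torus d → ℝ)
    (m : ℝ × Torus d → Vec d) (φ : ℝ × Torus d → ℝ) : ℝ :=
  (∫ y, (ρ y * dt φ y + ∑ i, m y i * dx i φ y) ∂(spaceTime d T)) + ∫ x, ρ₀ x * φ (0, x)

/-- The residual of the weak form of the momentum equation with Reynolds stress `R` and initial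
momentum `m₀`; the test function is the vector field `(φ i)_i`. -/
def momentumResidual {d : ℕ} (a γ T : ℝ) (m₀ : Torus d → Vec d) (ρ : ℝ × Torus d → ℝ)
    (m : ℝ × Torus d → Vec d) (R : StressField d) (φ : Fin d → ℝ × Torus d → ℝ) : ℝ :=
  (∫ y, (∑ i, m y i * dt (φ i) y
      + ∑ i, ∑ j, convective (ρ y) (m y) i j * dx j (φ i) y
      + pressure a γ (ρ y) * ∑ i, dx i (φ i) y) ∂(spaceTime d T))
    + (∫ t in Ioo 0 T, ∑ i, ∑ j, ∫ᵛ x, dx j (φ i) (t, x) ∂•(R t i j))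
    + ∫ x, ∑ i, m₀ x i * φ i (0, x)

/-- The total energy of the state `(ρ, m)` of the fluid. -/
def totalEnergy {d : ℕ} (a γ : ℝ) (ρ : Torus d → ℝ) (m : Torus d → Vec d) : ℝ≥0∞ :=
  ∫⁻ x, energy a γ (ρ x) (m x)

/-- `(ρ, m)` is a dissipative solution of the Euler system with initial data `(ρ₀, m₀)`.
The equations are tested by `C_c^∞([0,T) × 𝕋^d)`, so they contain the initial conditions.
`κ` is the constant in front of the trace of the Reynolds stress in the energy balance. -/
structure IsDissipativeSolution {d : ℕ} (a γ κ T : ℝ) (ρ₀ : Torus d → ℝ) (m₀ : Torus d → Vec d)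
    (ρ : ℝ × Torus d → ℝ) (m : ℝ × Torus d → Vec d) : Prop where
  measurable_density : AEMeasurable ρ (spaceTime d T)
  measurable_momentum : AEMeasurable m (spaceTime d T)
  finite_initial_energy : totalEnergy a γ ρ₀ m₀ < ⊤
  equations : ∃ R : StressField d, IsReynoldsStress T R ∧
    (∀ φ, IsTestFunction T φ → continuityResidual T ρ₀ ρ m φ = 0) ∧
    (∀ φ : Fin d → ℝ × Torus d → ℝ, (∀ i, IsTestFunction T (φ i)) →
      momentumResidual a γ T m₀ ρ m R φ = 0) ∧
    ∀ᵐ t ∂(volume.restrict (Ioo 0 T)),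
      totalEnergy a γ (fun x => ρ (t, x)) (fun x => m (t, x))
        + ENNReal.ofReal (κ * traceMass R t) ≤ totalEnergy a γ ρ₀ m₀

/-- Weak convergence in `L¹(𝕋^d)`. -/
def TendstoWeaklyL1 {d : ℕ} (f : ℕ → Torus d → ℝ) (g : Torus d → ℝ) : Prop :=
  ∀ ψ : Torus d → ℝ, Measurable ψ → (∃ C, ∀ x, |ψ x| ≤ C) →
    Tendsto (fun n => ∫ x, f n x * ψ x) atTop (𝓝 (∫ x, g x * ψ x))

/-- `(ρ n, m n)` is a consistent approximation of the Euler system with initial data `(ρ₀, m₀)`.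
The consistency errors `e¹_n`, `e²_n` are the residuals of the weak formulations. -/
structure IsConsistentApproximation {d : ℕ} (a γ κ T : ℝ) (ρ₀ : Torus d → ℝ)
    (m₀ : Torus d → Vec d) (ρ : ℕ → ℝ × Torus d → ℝ) (m : ℕ → ℝ × Torus d → Vec d) : Prop where
  measurable_density : ∀ n, AEMeasurable (ρ n) (spaceTime d T)
  measurable_momentum : ∀ n, AEMeasurable (m n) (spaceTime d T)
  integrable_initial_density : Integrable ρ₀
  integrable_initial_momentum : Integrable m₀
  finite_initial_energy : totalEnergy a γ ρ₀ m₀ < ⊤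
  equations : ∃ (R : ℕ → StressField d) (ρ₀' : ℕ → Torus d → ℝ) (m₀' : ℕ → Torus d → Vec d)
      (En : ℕ → ℝ≥0),
    (∀ n, IsReynoldsStress T (R n)) ∧
    (∀ n, Integrable (ρ₀' n)) ∧
    (∀ n, Integrable (m₀' n)) ∧
    (∀ φ, IsTestFunction T φ →
      Tendsto (fun n => continuityResidual T (ρ₀' n) (ρ n) (m n) φ) atTop (𝓝 0)) ∧
    (∀ φ : Fin d → ℝ × Torus d → ℝ, (∀ i, IsTestFunction T (φ i)) →
      Tendsto (fun n => momentumResidual a γ T (m₀' n) (ρ n) (m n) (R n) φ) atTop (𝓝 0)) ∧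
    (∀ n, ∀ᵐ t ∂(volume.restrict (Ioo 0 T)),
      totalEnergy a γ (fun x => ρ n (t, x)) (fun x => m n (t, x))
        + ENNReal.ofReal (κ * traceMass (R n) t) ≤ (En n : ℝ≥0∞)) ∧
    TendstoWeaklyL1 ρ₀' ρ₀ ∧
    (∀ i, TendstoWeaklyL1 (fun n x => m₀' n x i) (fun x => m₀ x i)) ∧
    limsup (fun n => (En n : ℝ≥0∞)) atTop ≤ totalEnergy a γ ρ₀ m₀

/-- Convergence of the `w`-weighted averages of `(ρn, mn)`: strong convergence of the averages of
the density and of the momentum to `ρ` and `m`, convergence to `V` in the sense of (S)-limits, and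
convergence of the empirical measures to `V` in Wasserstein distance. -/
structure AveragesConverge {d : ℕ} (γ T : ℝ) (w : ℝ → ℝ) (ρn : ℕ → ℝ × Torus d → ℝ)
    (mn : ℕ → ℝ × Torus d → Vec d) (ρ : ℝ × Torus d → ℝ) (m : ℝ × Torus d → Vec d)
    (V : Kernel (ℝ × Torus d) (State d)) : Prop where
  density : ∀ q : ℝ, 1 ≤ q → q < γ →
    MemLp ρ (ENNReal.ofReal q) (spaceTime d T) ∧
    Tendsto (fun N : ℕ => eLpNorm (fun y => weightedMean w N (fun n => ρn n y) - ρ y)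
      (ENNReal.ofReal q) (spaceTime d T)) atTop (𝓝 0)
  momentum : ∀ q : ℝ, 1 ≤ q → q < 2 * γ / (γ + 1) →
    MemLp m (ENNReal.ofReal q) (spaceTime d T) ∧
    Tendsto (fun N : ℕ => eLpNorm (fun y => weightedMean w N (fun n => mn n y) - m y)
      (ENNReal.ofReal q) (spaceTime d T)) atTop (𝓝 0)
  slimit : HasSLimit (spaceTime d T) w (fun n => toState (ρn n) (mn n)) V
  wasserstein : ∀ s : ℝ, 1 ≤ s → s < 2 * γ / (γ + 1) →
    Tendsto (fun N : ℕ => ∫⁻ y,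
      wassersteinDist s (weightedEmpirical w N (fun n => toState (ρn n) (mn n) y)) (V y) ^ s
        ∂(spaceTime d T)) atTop (𝓝 0)

end

end EulerS

set_option linter.unusedSectionVars false

namespace EulerS

/-! ### Weighted means -/

/-! The argument has a soft part about (S)-convergence and a part specific to the Euler system.

Soft part. For `b ∈ C_c` the functions `b(U_n)` are vectors of `L²(Q)` with Gram matrix `c_b(n,m)`.
Let `x_N` be their means. As `N → ∞`, `‖x_N - x_M‖²` tends to `L - 2·(mean of ℓ up to M) + ‖x_M‖²`,
and weak (S)-convergence says precisely that this vanishes as `M → ∞`. Hence `(x_N)` is Cauchy in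
`L²` (`exists_tendsto_weightedMean_of_correlation`). Under strong (S)-convergence the limits for all
weights have the same inner products `ℓ_m` with every `b(U_m)` and lie in their closed span, so they
coincide (`eq_of_tendsto_weightedMean`). The averaged laws of `(y, U_n(y))` have, along an
ultrafilter, a limit measure on `Q × ℝ^{d+1}`; the energy bound makes the laws tight, so its first
marginal is Lebesgue measure, and its disintegration is the Young measure `𝒱`
(`exists_kernel_of_means`). Truncation extends the convergence from `C_c` to functions that grow
more slowly than the energy permits (`MeansTendsto.tendsto_eLpNorm`), and an explicit coupling
subordinate to a fine partition of unity gives the Wasserstein statement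
(`wassersteinDist_rpow_le_partition`, `MeansTendsto.tendsto_wassersteinDist`). None of these limit
passages depends on the weight, so once the `C_c` means are known to converge, part 3 is the same
proof as parts 1 and 2.

Euler part. The energy controls `|ϱ|^γ + |m|^{2γ/(γ+1)}`, which fixes the admissible exponents. Let
`ϱ` and `m` be the barycentres of `𝒱`, that is, the strong limits of the averages. The weak
formulations are linear in `m`, `ϱ` and the total stress `1_{ϱ>0} m⊗m/ϱ + p(ϱ) I + ℜ`, so they can
be averaged over `n`. The averaged total stress has an ultrafilter limit `Λ`, and the new Reynolds
stress is the defect between `Λ` and the stress of `(ϱ, m)`. In each direction `ξ` the quadratic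
form of the stress density is convex in `(ϱ, m)`, so Jensen's inequality followed by Fatou's lemma
shows that the defect is positive semi-definite. A Riesz representation with densities bounded in
time turns it into an actual Reynolds stress (`exists_timeKernel`, `exists_reynoldsStress`,
`exists_limit_stress`).

For the energy, write `E = (remainder) + κ tr(stress density)`. The bounds on `κ` are exactly what
makes the remainder a non-negative combination of the convex functions `|m|²/ϱ` and `ϱ^γ`
(`isFluidDensity_energyRemainder`). The trace term passes to the limit exactly, since the defect was
defined that way, while the remainder is lower semicontinuous along averages. As the bounds `E_n`
may be taken to converge to the initial energy, so do their Cesàro means, and the energy inequality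
follows. -/

/-- The weights `w (n / N)` are non-negative and their sum is eventually positive. -/
structure IsAveraging (w : ℝ → ℝ) : Prop where
  nonneg : ∀ z ∈ Icc (0 : ℝ) 1, 0 ≤ w z
  eventually_pos : ∀ᶠ N in atTop, 0 < weightSum w N

theorem weightSum_one (N : ℕ) : weightSum 1 N = N := by
  simp [weightSum]

theorem isAveraging_one : IsAveraging 1 where
  nonneg _ _ := zero_le_one
  eventually_pos := by
    filter_upwards [eventually_gt_atTop 0] with N hN
    rw [weightSum_one]; exact_mod_cast hN

theorem one_mem_weights : (1 : ℝ → ℝ) ∈ Weights :=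
  ⟨contDiffOn_const, fun _ _ => zero_le_one, by simp⟩

theorem node_mem {n N : ℕ} (h : n < N) : ((n : ℝ) + 1) / N ∈ Icc (0 : ℝ) 1 := by
  have hN : (0 : ℝ) < N := by exact_mod_cast (Nat.zero_le n).trans_lt h
  refine ⟨by positivity, ?_⟩
  rw [div_le_one hN]; exact_mod_cast h

/-- A continuous weight of integral one is positive at an interior point, hence near it, and for
large `N` some node `(n+1)/N` lands in that neighbourhood. -/
theorem isAveraging_of_mem {w : ℝ → ℝ} (hw : w ∈ Weights) : IsAveraging w := by
  obtain ⟨hc, h0, h1⟩ := hw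
  refine ⟨h0, ?_⟩
  have hcont : ContinuousOn w (Icc 0 1) := hc.continuousOn
  obtain ⟨z, hz, hwz⟩ : ∃ z ∈ Ioo (0 : ℝ) 1, 0 < w z := by
    by_contra! hcon
    have : ∫ z in (0 : ℝ)..1, w z = ∫ z in (0 : ℝ)..1, (0 : ℝ) := by
      rw [intervalIntegral.integral_of_le zero_le_one, intervalIntegral.integral_of_le zero_le_one,
        integral_Ioc_eq_integral_Ioo, integral_Ioc_eq_integral_Ioo]
      exact setIntegral_congr_fun measurableSet_Ioo fun z hz =>
        le_antisymm (hcon z hz) (h0 z (Ioo_subset_Icc_self hz))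
    simp [h1] at this
  have hnhds : ∀ᶠ u in 𝓝 z, 0 < w u :=
    (hcont.continuousAt (Icc_mem_nhds hz.1 hz.2)).eventually (lt_mem_nhds hwz)
  obtain ⟨δ, hδ, hball⟩ := Metric.eventually_nhds_iff.1 hnhds
  have hN1 : ∀ᶠ N : ℕ in atTop, (1 : ℝ) / N < δ :=
    (tendsto_one_div_atTop_nhds_zero_nat (𝕜 := ℝ)).eventually (gt_mem_nhds hδ)
  filter_upwards [hN1, eventually_gt_atTop 0] with N hN hNpos
  have hN0 : (0 : ℝ) < N := by exact_mod_cast hNpos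
  -- The node `(n+1)/N` is the first one strictly to the right of `z`, so it is within `1/N` of `z`;
  -- `z < 1` guarantees `n < N`.
  set n := ⌊z * N⌋₊ with hn
  have hzN : 0 ≤ z * N := mul_nonneg hz.1.le hN0.le
  have hlt : n < N := by
    have : (n : ℝ) ≤ z * N := Nat.floor_le hzN
    have h2 : z * N < N := by nlinarith [hz.2]
    exact_mod_cast this.trans_lt h2
  refine lt_of_lt_of_le ?_ (Finset.single_le_sum
    (f := fun n : ℕ => w (((n : ℝ) + 1) / N)) (fun i hi =>
      h0 _ (node_mem (Finset.mem_range.1 hi))) (Finset.mem_range.2 hlt))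
  refine hball ?_
  have h3 : (n : ℝ) ≤ z * N := Nat.floor_le hzN
  have h4 : z * N < n + 1 := Nat.lt_floor_add_one _
  rw [Real.dist_eq, abs_of_nonneg]
  · have : ((n : ℝ) + 1) / N - z ≤ 1 / N := by
      rw [sub_le_iff_le_add, div_le_iff₀ hN0, add_mul, div_mul_cancel₀ _ hN0.ne']
      linarith
    linarith
  · rw [sub_nonneg, le_div_iff₀ hN0]; exact h4.le

/-- The normalized weight of the term with index `n` in the `N`-th mean. -/
noncomputable def coeff (w : ℝ → ℝ) (N n : ℕ) : ℝ := (weightSum w N)⁻¹ * w (((n : ℝ) + 1) / N)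

section Means

variable {w : ℝ → ℝ}

theorem weightedMean_eq_sum {G : Type*} [AddCommMonoid G] [Module ℝ G] (w : ℝ → ℝ) (N : ℕ)
    (x : ℕ → G) : weightedMean w N x = ∑ n ∈ Finset.range N, coeff w N n • x n := by
  simp [weightedMean, coeff, Finset.smul_sum, mul_smul]

theorem weightedMean_eq_sum_mul (w : ℝ → ℝ) (N : ℕ)
    (x : ℕ → ℝ) : weightedMean w N x = ∑ n ∈ Finset.range N, coeff w N n * x n := by
  simp [weightedMean_eq_sum]

theorem weightSum_nonneg (hw : IsAveraging w) (N : ℕ) : 0 ≤ weightSum w N :=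
  Finset.sum_nonneg fun _ hn => hw.nonneg _ (node_mem (Finset.mem_range.1 hn))

theorem coeff_nonneg (hw : IsAveraging w) {N n : ℕ} (h : n ∈ Finset.range N) : 0 ≤ coeff w N n :=
  mul_nonneg (inv_nonneg.2 (weightSum_nonneg hw N)) (hw.nonneg _ (node_mem (Finset.mem_range.1 h)))

theorem sum_coeff {N : ℕ} (h : 0 < weightSum w N) : ∑ n ∈ Finset.range N, coeff w N n = 1 := by
  simp only [coeff, ← Finset.mul_sum]
  exact inv_mul_cancel₀ h.ne'

/-- When the weights sum to zero the inverse is zero and so are all coefficients. Stating `≤ 1`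
instead of `= 1` lets upper bounds hold for every `N`, without waiting for positivity. -/
theorem sum_coeff_le_one (hw : IsAveraging w) (N : ℕ) : ∑ n ∈ Finset.range N, coeff w N n ≤ 1 := by
  rcases (weightSum_nonneg hw N).eq_or_lt with h | h
  · simp [coeff, ← h]
  · exact (sum_coeff h).le

theorem weightedMean_one (N : ℕ) (x : ℕ → ℝ) :
    weightedMean 1 N x = (N : ℝ)⁻¹ * ∑ n ∈ Finset.range N, x n := by
  simp [weightedMean, weightSum_one]

theorem weightedMean_mono (hw : IsAveraging w) {N : ℕ} {x x' : ℕ → ℝ} (h : ∀ n, x n ≤ x' n) :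
    weightedMean w N x ≤ weightedMean w N x' := by
  rw [weightedMean_eq_sum_mul, weightedMean_eq_sum_mul]
  exact Finset.sum_le_sum fun n hn => mul_le_mul_of_nonneg_left (h n) (coeff_nonneg hw hn)

theorem weightedMean_nonneg (hw : IsAveraging w) {N : ℕ} {x : ℕ → ℝ} (h : ∀ n, 0 ≤ x n) :
    0 ≤ weightedMean w N x := by
  rw [weightedMean_eq_sum_mul]
  exact Finset.sum_nonneg fun n hn => mul_nonneg (coeff_nonneg hw hn) (h n)

theorem norm_weightedMean_le (hw : IsAveraging w) {G : Type*} [NormedAddCommGroup G]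
    [NormedSpace ℝ G] (N : ℕ) (x : ℕ → G) :
    ‖weightedMean w N x‖ ≤ weightedMean w N (fun n => ‖x n‖) := by
  rw [weightedMean_eq_sum, weightedMean_eq_sum_mul]
  refine (norm_sum_le _ _).trans (Finset.sum_le_sum fun n hn => ?_)
  rw [norm_smul, Real.norm_of_nonneg (coeff_nonneg hw hn)]

theorem weightedMean_le_of_le (hw : IsAveraging w) {N : ℕ} {x : ℕ → ℝ} {C : ℝ} (hC : 0 ≤ C)
    (h : ∀ n, x n ≤ C) : weightedMean w N x ≤ C := by
  rw [weightedMean_eq_sum_mul]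
  calc _ ≤ ∑ n ∈ Finset.range N, coeff w N n * C :=
        Finset.sum_le_sum fun n hn => mul_le_mul_of_nonneg_left (h n) (coeff_nonneg hw hn)
    _ = (∑ n ∈ Finset.range N, coeff w N n) * C := by rw [Finset.sum_mul]
    _ ≤ 1 * C := mul_le_mul_of_nonneg_right (sum_coeff_le_one hw N) hC
    _ = C := one_mul C

theorem norm_weightedMean_le_of_le (hw : IsAveraging w) {G : Type*} [NormedAddCommGroup G]
    [NormedSpace ℝ G] {N : ℕ} {x : ℕ → G} {C : ℝ} (hC : 0 ≤ C)
    (h : ∀ n, ‖x n‖ ≤ C) : ‖weightedMean w N x‖ ≤ C :=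
  (norm_weightedMean_le hw N x).trans (weightedMean_le_of_le hw hC h)

theorem weightedMean_const {N : ℕ} (h : 0 < weightSum w N) (c : ℝ) :
    weightedMean w N (fun _ => c) = c := by
  rw [weightedMean_eq_sum_mul, ← Finset.sum_mul, sum_coeff h, one_mul]

theorem weightedMean_add {G : Type*} [AddCommGroup G] [Module ℝ G] (N : ℕ) (x x' : ℕ → G) :
    weightedMean w N (fun n => x n + x' n) = weightedMean w N x + weightedMean w N x' := by
  simp [weightedMean_eq_sum, Finset.sum_add_distrib]

theorem weightedMean_sub {G : Type*} [AddCommGroup G] [Module ℝ G] (N : ℕ) (x x' : ℕ → G) :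
    weightedMean w N (fun n => x n - x' n) = weightedMean w N x - weightedMean w N x' := by
  simp [weightedMean_eq_sum, smul_sub]

theorem weightedMean_const_mul (N : ℕ) (c : ℝ) (x : ℕ → ℝ) :
    weightedMean w N (fun n => c * x n) = c * weightedMean w N x := by
  simp only [weightedMean_eq_sum_mul, Finset.mul_sum]
  exact Finset.sum_congr rfl fun _ _ => by ring

theorem weightedMean_sum {ι : Type*} (s : Finset ι) (N : ℕ) (x : ι → ℕ → ℝ) :
    weightedMean w N (fun n => ∑ i ∈ s, x i n) = ∑ i ∈ s, weightedMean w N (x i) := by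
  simp only [weightedMean_eq_sum_mul, Finset.mul_sum]
  exact Finset.sum_comm

theorem integral_weightedMean {α : Type*} [MeasurableSpace α] {μ : Measure α} (N : ℕ)
    {f : ℕ → α → ℝ} (hf : ∀ n, Integrable (f n) μ) :
    ∫ x, weightedMean w N (fun n => f n x) ∂μ = weightedMean w N (fun n => ∫ x, f n x ∂μ) := by
  simp only [weightedMean_eq_sum_mul]
  rw [integral_finsetSum _ fun n _ => (hf n).const_mul _]
  simp [integral_const_mul]

theorem integrable_weightedMean {α : Type*} [MeasurableSpace α] {μ : Measure α} (N : ℕ)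
    {G : Type*} [NormedAddCommGroup G] [NormedSpace ℝ G]
    {f : ℕ → α → G} (hf : ∀ n, Integrable (f n) μ) :
    Integrable (fun x => weightedMean w N (fun n => f n x)) μ := by
  simp only [weightedMean_eq_sum]
  exact integrable_finsetSum _ fun n _ => (hf n).smul _

theorem aestronglyMeasurable_weightedMean {α : Type*} [MeasurableSpace α] {μ : Measure α} (N : ℕ)
    {G : Type*} [NormedAddCommGroup G] [NormedSpace ℝ G]
    {f : ℕ → α → G} (hf : ∀ n, AEStronglyMeasurable (f n) μ) :
    AEStronglyMeasurable (fun x => weightedMean w N (fun n => f n x)) μ := by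
  simp only [weightedMean_eq_sum]
  exact Finset.aestronglyMeasurable_fun_sum _ fun n _ => (hf n).const_smul _

/-- Cesàro means of a convergent sequence. -/
theorem tendsto_weightedMean_one {x : ℕ → ℝ} {l : ℝ} (h : Tendsto x atTop (𝓝 l)) :
    Tendsto (fun N => weightedMean 1 N x) atTop (𝓝 l) := by
  simp only [weightedMean_one]
  exact h.cesaro

end Means

/-! ### Convergence of means in Hilbert spaces -/

section Hilbert

variable {H : Type*} [NormedAddCommGroup H] [InnerProductSpace ℝ H]

/-- Expanding `‖x_N - x_M‖²` and letting `N → ∞` with `M` fixed leaves `L - 2·mean_M(ℓ) + ‖x_M‖²`,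
which tends to `L - 2L + L = 0`. The order of the two limits is what the disintegration condition
encodes. -/
theorem exists_tendsto_weightedMean_of_correlation [CompleteSpace H] (h : ℕ → H) (w : ℝ → ℝ)
    (ℓ : ℕ → ℝ) (L : ℝ)
    (h1 : ∀ m, Tendsto (fun N => weightedMean w N fun n => inner ℝ (h n) (h m)) atTop (𝓝 (ℓ m)))
    (h2 : Tendsto (fun N => inner ℝ (weightedMean w N h) (weightedMean w N h)) atTop (𝓝 L))
    (h3 : Tendsto (fun M => weightedMean w M ℓ) atTop (𝓝 L)) :
    ∃ z, Tendsto (fun N => weightedMean w N h) atTop (𝓝 z) ∧ ∀ m, inner ℝ z (h m) = ℓ m := by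
  set x := fun N => weightedMean w N h with hx
  have hin : ∀ m N, inner ℝ (x N) (h m) = weightedMean w N fun n => inner ℝ (h n) (h m) := by
    intro m N
    simp [hx, weightedMean_eq_sum, sum_inner, inner_smul_left]
  have h1' : ∀ m, Tendsto (fun N => inner ℝ (x N) (h m)) atTop (𝓝 (ℓ m)) := by
    intro m; simpa only [hin] using h1 m
  have hM : ∀ M, Tendsto (fun N => inner ℝ (x N) (x M)) atTop (𝓝 (weightedMean w M ℓ)) := by
    intro M
    have : ∀ N, inner ℝ (x N) (x M)
        = ∑ n ∈ Finset.range M, coeff w M n * inner ℝ (x N) (h n) := by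
      intro N
      simp [hx, weightedMean_eq_sum (x := h) (N := M), inner_sum, inner_smul_right]
    simp only [this, weightedMean_eq_sum_mul]
    exact tendsto_finsetSum _ fun n _ => (h1' n).const_mul _
  have hdist : ∀ M, Tendsto (fun N => ‖x N - x M‖ ^ 2) atTop
      (𝓝 (L - 2 * weightedMean w M ℓ + inner ℝ (x M) (x M))) := by
    intro M
    have : ∀ N, ‖x N - x M‖ ^ 2
        = inner ℝ (x N) (x N) - 2 * inner ℝ (x N) (x M) + inner ℝ (x M) (x M) := by
      intro N
      rw [norm_sub_sq_real, real_inner_self_eq_norm_sq, real_inner_self_eq_norm_sq]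
    simp only [this]
    exact (h2.sub ((hM M).const_mul 2)).add_const _
  have hlim : Tendsto (fun M => L - 2 * weightedMean w M ℓ + inner ℝ (x M) (x M)) atTop (𝓝 0) := by
    have := (tendsto_const_nhds (x := L)).sub (h3.const_mul 2) |>.add h2
    convert this using 2
    ring
  -- One good index `M` serves as a pivot: all late means are within `ε/2` of `x_M`.
  have hcauchy : CauchySeq x := by
    rw [Metric.cauchySeq_iff']
    intro ε hε
    have hε2 : 0 < (ε / 2) ^ 2 := by positivity
    obtain ⟨M, hMlt⟩ := (hlim.eventually (gt_mem_nhds hε2)).exists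
    obtain ⟨N₀, hN₀⟩ := eventually_atTop.1 ((hdist M).eventually (gt_mem_nhds hMlt))
    have hlt : ∀ N ≥ N₀, ‖x N - x M‖ < ε / 2 := fun N hN =>
      lt_of_pow_lt_pow_left₀ 2 (by positivity) (hN₀ N hN)
    refine ⟨N₀, fun N hN => ?_⟩
    calc dist (x N) (x N₀) ≤ dist (x N) (x M) + dist (x N₀) (x M) := dist_triangle_right _ _ _
      _ < ε / 2 + ε / 2 := by
        rw [dist_eq_norm, dist_eq_norm]
        exact add_lt_add (hlt N hN) (hlt N₀ le_rfl)
      _ = ε := by ring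
  obtain ⟨z, hz⟩ := cauchySeq_tendsto_of_complete hcauchy
  exact ⟨z, hz, fun m => tendsto_nhds_unique (hz.inner tendsto_const_nhds) (h1' m)⟩

/-- The difference `z - z'` is orthogonal to every `h m`, hence to all means, hence to the limit of
their differences, which is `z - z'` itself. -/
theorem eq_of_tendsto_weightedMean (h : ℕ → H) {w w' : ℝ → ℝ} {z z' : H}
    (hz : Tendsto (fun N => weightedMean w N h) atTop (𝓝 z))
    (hz' : Tendsto (fun N => weightedMean w' N h) atTop (𝓝 z'))
    (heq : ∀ m, inner ℝ z (h m) = inner ℝ z' (h m)) : z = z' := by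
  have horth : ∀ (w : ℝ → ℝ) N, inner ℝ (z - z') (weightedMean w N h) = 0 := by
    intro w N
    simp [weightedMean_eq_sum, inner_sum, inner_smul_right, inner_sub_left, heq]
  have h1 : Tendsto (fun N => inner ℝ (z - z') (weightedMean w N h - weightedMean w' N h)) atTop
      (𝓝 (inner ℝ (z - z') (z - z'))) := tendsto_const_nhds.inner (hz.sub hz')
  simp only [inner_sub_right _ (weightedMean w _ h), horth, sub_zero] at h1
  have := tendsto_nhds_unique h1 tendsto_const_nhds
  exact sub_eq_zero.1 (inner_self_eq_zero.1 this)

end Hilbert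

end EulerS

namespace EulerS

/-! ### Strong convergence of the means of an (S)-convergent sequence -/

theorem correlation_comm {Y E : Type*} [MeasurableSpace Y] [TopologicalSpace E] (Q : Measure Y)
    (U : ℕ → Y → E) (b : E → ℝ) (n m : ℕ) : correlation Q U b n m = correlation Q U b m n := by
  simp only [correlation, mul_comm]

section MeansConverge

variable {Y E : Type*} [MeasurableSpace Y] [TopologicalSpace E]

theorem exists_bound_of_compactlySupported (b : C_c(E, ℝ)) : ∃ K : ℝ, 0 ≤ K ∧ ∀ u, |b u| ≤ K := by
  obtain ⟨K, hK⟩ := b.hasCompactSupport.exists_bound_of_continuous b.continuous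
  exact ⟨max K 0, le_max_right _ _, fun u => (hK u).trans (le_max_left _ _)⟩

variable [MeasurableSpace E] [OpensMeasurableSpace E] {Q : Measure Y} {U : ℕ → Y → E}

theorem aestronglyMeasurable_comp_state (hU : ∀ n, AEMeasurable (U n) Q) {b : E → ℝ}
    (hb : Continuous b) (n : ℕ) : AEStronglyMeasurable (fun y => b (U n y)) Q :=
  (hb.measurable.comp_aemeasurable (hU n)).aestronglyMeasurable

variable [IsFiniteMeasure Q]

theorem memLp_comp_state (hU : ∀ n, AEMeasurable (U n) Q) (b : C_c(E, ℝ)) (p : ℝ≥0∞) (n : ℕ) :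
    MemLp (fun y => b (U n y)) p Q := by
  obtain ⟨K, -, hK⟩ := exists_bound_of_compactlySupported b
  exact MemLp.of_bound (aestronglyMeasurable_comp_state hU b.continuous n) K
    (Eventually.of_forall fun y => hK _)

theorem integrable_comp_state (hU : ∀ n, AEMeasurable (U n) Q) (b : C_c(E, ℝ)) (n : ℕ) :
    Integrable (fun y => b (U n y)) Q :=
  memLp_one_iff_integrable.1 (memLp_comp_state hU b 1 n)

/-- The functions `b (U n)` as elements of `L²`. -/
noncomputable def observable (hU : ∀ n, AEMeasurable (U n) Q) (b : C_c(E, ℝ)) (n : ℕ) : Lp ℝ 2 Q :=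
  (memLp_comp_state hU b 2 n).toLp _

theorem inner_observable (hU : ∀ n, AEMeasurable (U n) Q) (b : C_c(E, ℝ)) (n m : ℕ) :
    inner ℝ (observable hU b n) (observable hU b m) = correlation Q U b n m := by
  rw [L2.inner_def, correlation]
  refine integral_congr_ae ?_
  filter_upwards [(memLp_comp_state hU b 2 n).coeFn_toLp, (memLp_comp_state hU b 2 m).coeFn_toLp]
    with y h1 h2
  simp only [observable, h1, h2]
  simp [mul_comm]

theorem coeFn_weightedMean_observable (hU : ∀ n, AEMeasurable (U n) Q) (b : C_c(E, ℝ))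
    (w : ℝ → ℝ) (N : ℕ) :
    ((weightedMean w N (observable hU b) : Lp ℝ 2 Q) : Y → ℝ) =ᵐ[Q] fun y => weightedMean w N fun n => b (U n y) := by
  simp only [weightedMean_eq_sum]
  have h1 : ∀ n ∈ Finset.range N, (coeff w N n • observable hU b n : Lp ℝ 2 Q) =ᵐ[Q]
      fun y => coeff w N n • b (U n y) := by
    intro n _
    filter_upwards [Lp.coeFn_smul (coeff w N n) (observable hU b n),
      (memLp_comp_state hU b 2 n).coeFn_toLp] with y h1 h2
    rw [h1, Pi.smul_apply, observable, h2]
  have h2 : ∀ᵐ y ∂Q, ∀ n ∈ Finset.range N, (coeff w N n • observable hU b n : Lp ℝ 2 Q) y =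
      coeff w N n • b (U n y) := by
    rw [eventually_all_finset]; exact h1
  filter_upwards [h2, Lp.coeFn_finsetSum (Finset.range N)
    (fun n => (coeff w N n • observable hU b n : Lp ℝ 2 Q))] with y hy hy'
  rw [hy', Finset.sum_apply]
  exact Finset.sum_congr rfl hy

theorem tendsto_integral_abs_of_tendsto_observable (hU : ∀ n, AEMeasurable (U n) Q)
    (b : C_c(E, ℝ)) (w : ℝ → ℝ) {z : Lp ℝ 2 Q}
    (hz : Tendsto (fun N => weightedMean w N (observable hU b)) atTop (𝓝 z)) :
    Tendsto (fun N => ∫ y, |weightedMean w N (fun n => b (U n y)) - z y| ∂Q) atTop (𝓝 0) := by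
  have hz' : Tendsto (fun N => eLpNorm (fun y => weightedMean w N (fun n => b (U n y)) - z y) 1 Q)
      atTop (𝓝 0) := by
    have h2 : Tendsto (fun N => eLpNorm (fun y => weightedMean w N (fun n => b (U n y)) - z y) 2 Q)
        atTop (𝓝 0) := by
      have := (Lp.tendsto_Lp_iff_tendsto_eLpNorm' _ _).1 hz
      refine this.congr fun N => eLpNorm_congr_ae ?_
      filter_upwards [coeFn_weightedMean_observable hU b w N] with y hy
      rw [Pi.sub_apply, hy]
    have hc : Tendsto (fun N => eLpNorm (fun y => weightedMean w N (fun n => b (U n y)) - z y) 2 Q *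
        Q univ ^ (1 / (1 : ℝ≥0∞).toReal - 1 / (2 : ℝ≥0∞).toReal)) atTop (𝓝 0) := by
      have := ENNReal.Tendsto.mul_const (b := Q univ ^ (1 / (1 : ℝ≥0∞).toReal - 1 / (2 : ℝ≥0∞).toReal))
        h2 (Or.inr (ENNReal.rpow_ne_top_of_nonneg (by norm_num) (measure_ne_top _ _)))
      simpa using this
    refine tendsto_of_tendsto_of_tendsto_of_le_of_le tendsto_const_nhds hc (fun _ => bot_le)
      fun N => eLpNorm_le_eLpNorm_mul_rpow_measure_univ (by norm_num) ?_
    exact (aestronglyMeasurable_weightedMean N fun n =>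
      aestronglyMeasurable_comp_state hU b.continuous n).sub (Lp.aestronglyMeasurable z)
  have h3 := (ENNReal.tendsto_toReal ENNReal.zero_ne_top).comp hz'
  refine h3.congr fun N => ?_
  rw [Function.comp_apply, eLpNorm_one_eq_lintegral_enorm, ← integral_norm_eq_lintegral_enorm]
  · rfl
  · exact (aestronglyMeasurable_weightedMean N fun n =>
      aestronglyMeasurable_comp_state hU b.continuous n).sub (Lp.aestronglyMeasurable z)

/-- The correlations are the `L²` inner products of the `b(U_n)`, so the Hilbert space criterion
applies with the Cesàro weight; on a finite measure space `L²` convergence gives `L¹` convergence.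
-/
theorem WeaklySConvergent.exists_limit (hU : ∀ n, AEMeasurable (U n) Q)
    (hS : WeaklySConvergent Q U) (b : C_c(E, ℝ)) : ∃ h : Y → ℝ, Integrable h Q ∧
      Tendsto (fun N => ∫ y, |weightedMean 1 N (fun n => b (U n y)) - h y| ∂Q) atTop (𝓝 0) := by
  obtain ⟨ℓ, h1, L, h2, h3⟩ := hS b
  obtain ⟨z, hz, -⟩ := exists_tendsto_weightedMean_of_correlation (observable hU b) 1 ℓ L
    (by simpa only [weightedMean_one, inner_observable] using h1)
    (by
      refine h2.congr fun N => ?_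
      simp only [weightedMean_eq_sum, sum_inner, inner_sum, inner_smul_left, inner_smul_right,
        inner_observable, coeff, weightSum_one, Finset.mul_sum]
      refine Finset.sum_congr rfl fun n _ => Finset.sum_congr rfl fun m _ => ?_
      rw [correlation_comm Q U b m n]
      simp
      ring)
    (by simpa only [weightedMean_one] using h3)
  exact ⟨z, (Lp.memLp z).integrable (by norm_num),
    tendsto_integral_abs_of_tendsto_observable hU b 1 hz⟩

theorem integrable_weightedMean_comp (hU : ∀ n, AEMeasurable (U n) Q) (b : C_c(E, ℝ)) (w : ℝ → ℝ)
    (N : ℕ) : Integrable (fun y => weightedMean w N (fun n => b (U n y))) Q :=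
  integrable_weightedMean N (integrable_comp_state hU b)

theorem ae_eq_of_tendsto_integral_abs {α : Type*} [MeasurableSpace α] {μ : Measure α}
    {x : ℕ → α → ℝ} {f g : α → ℝ} (hx : ∀ N, Integrable (x N) μ)
    (hf : Integrable f μ) (hg : Integrable g μ)
    (h1 : Tendsto (fun N => ∫ y, |x N y - f y| ∂μ) atTop (𝓝 0))
    (h2 : Tendsto (fun N => ∫ y, |x N y - g y| ∂μ) atTop (𝓝 0)) : f =ᵐ[μ] g := by
  have h0 : ∫ y, |f y - g y| ∂μ ≤ 0 := by
    have h3 := h1.add h2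
    rw [add_zero] at h3
    refine ge_of_tendsto' h3 fun N => ?_
    have hadd := integral_add ((hx N).sub hf).abs ((hx N).sub hg).abs
    simp only [Pi.sub_apply] at hadd
    rw [← hadd]
    refine integral_mono (hf.sub hg).abs (((hx N).sub hf).abs.add ((hx N).sub hg).abs) fun y => ?_
    change |f y - g y| ≤ |x N y - f y| + |x N y - g y|
    rw [abs_sub_comm (x N y) (f y)]
    exact abs_sub_le _ _ _
  have h4 := (integral_eq_zero_iff_of_nonneg (fun y => abs_nonneg (f y - g y)) (hf.sub hg).abs).1
    (le_antisymm h0 (integral_nonneg fun y => abs_nonneg _))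
  filter_upwards [h4] with y hy
  exact sub_eq_zero.1 (abs_eq_zero.1 hy)

/-- The constant weight belongs to `Weights`, and the `ℓ m` do not depend on the weight, so the
`w`-limit and the Cesàro limit in `L²` are the same vector; the latter is `h` almost everywhere. -/
theorem StronglySConvergent.tendsto (hU : ∀ n, AEMeasurable (U n) Q)
    (hS : StronglySConvergent Q U) (b : C_c(E, ℝ)) {h : Y → ℝ} (hh : Integrable h Q)
    (h1 : Tendsto (fun N => ∫ y, |weightedMean 1 N (fun n => b (U n y)) - h y| ∂Q) atTop (𝓝 0))
    {w : ℝ → ℝ} (hw : w ∈ Weights) :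
    Tendsto (fun N => ∫ y, |weightedMean w N (fun n => b (U n y)) - h y| ∂Q) atTop (𝓝 0) := by
  obtain ⟨ℓ, hℓ, hL⟩ := hS b
  have key : ∀ w ∈ Weights, ∃ z, Tendsto (fun N => weightedMean w N (observable hU b)) atTop (𝓝 z) ∧
      ∀ m, inner ℝ z (observable hU b m) = ℓ m := by
    intro w hw
    obtain ⟨L, h2, h3⟩ := hL w hw
    refine exists_tendsto_weightedMean_of_correlation (observable hU b) w ℓ L
      (by simpa only [inner_observable] using hℓ w hw) ?_ h3
    refine h2.congr fun N => ?_
    simp only [weightedMean_eq_sum, sum_inner, inner_sum, inner_smul_left, inner_smul_right,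
      inner_observable, coeff, Finset.mul_sum]
    refine Finset.sum_congr rfl fun n _ => Finset.sum_congr rfl fun m _ => ?_
    rw [correlation_comm Q U b m n]
    simp
    ring
  obtain ⟨z, hz, hzℓ⟩ := key w hw
  obtain ⟨z', hz', hzℓ'⟩ := key 1 one_mem_weights
  obtain rfl : z = z' := eq_of_tendsto_weightedMean _ hz hz' fun m => by rw [hzℓ, hzℓ']
  have h2 := tendsto_integral_abs_of_tendsto_observable hU b 1 hz'
  have hae : h =ᵐ[Q] z := ae_eq_of_tendsto_integral_abs (integrable_weightedMean_comp hU b 1) hh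
    ((Lp.memLp z).integrable (by norm_num)) h1 h2
  refine (tendsto_integral_abs_of_tendsto_observable hU b w hz).congr fun N => ?_
  refine integral_congr_ae ?_
  filter_upwards [hae] with y hy
  rw [hy]

end MeansConverge

end EulerS

namespace EulerS

/-! ### Limits of functionals and the Riesz representation -/

/-- A sequence of pointwise bounded linear functionals converges along an ultrafilter. -/
theorem exists_ultralimit {V : Type*} [AddCommGroup V] [Module ℝ V] (a : ℕ → V →ₗ[ℝ] ℝ)
    (ha : ∀ v, ∃ C, ∀ N, |a N v| ≤ C) :
    ∃ Λ : V →ₗ[ℝ] ℝ, ∀ v, Tendsto (fun N => a N v) (hyperfilter ℕ) (𝓝 (Λ v)) := by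
  have h : ∀ v, ∃ l, Tendsto (fun N => a N v) (hyperfilter ℕ) (𝓝 l) := by
    intro v
    obtain ⟨C, hC⟩ := ha v
    obtain ⟨l, -, hl⟩ := isCompact_Icc.ultrafilter_le_nhds (s := Icc (-C) C)
      ((hyperfilter ℕ).map fun N => a N v) (by
        rw [le_principal_iff]
        exact Ultrafilter.mem_map.2 (univ_mem' fun N => abs_le.1 (hC N)))
    exact ⟨l, hl⟩
  choose l hl using h
  -- Limits along an ultrafilter exist for all vectors at once and are unique, so the chosen values
  -- are automatically linear. No separability or diagonal sequence is involved.
  exact ⟨{  toFun := l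
            map_add' := fun v v' => tendsto_nhds_unique (hl (v + v')) (by
              simpa only [map_add] using (hl v).add (hl v'))
            map_smul' := fun c v => tendsto_nhds_unique (hl (c • v)) (by
              simpa only [map_smul] using! (hl v).const_smul c) }, hl⟩

section Riesz

variable {X : Type*} [TopologicalSpace X] [T2Space X] [LocallyCompactSpace X] [MeasurableSpace X]
  [BorelSpace X]

theorem exists_measure_of_nonneg (Λ : C_c(X, ℝ) →ₗ[ℝ] ℝ)
    (hΛ : ∀ f : C_c(X, ℝ), (∀ x, 0 ≤ f x) → 0 ≤ Λ f) :
    ∃ μ : Measure X, μ.Regular ∧ ∀ f : C_c(X, ℝ), ∫ x, f x ∂μ = Λ f :=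
  ⟨RealRMK.rieszMeasure (PositiveLinearMap.mk₀ Λ fun f hf => hΛ f hf), inferInstance,
    fun f => RealRMK.integral_rieszMeasure _ f⟩

theorem exists_compactlySupported_between {K V : Set X} (hK : IsCompact K) (hV : IsOpen V)
    (hKV : K ⊆ V) : ∃ f : C_c(X, ℝ), (∀ x ∈ K, f x = 1) ∧ (∀ x ∉ V, f x = 0) ∧
      ∀ x, 0 ≤ f x ∧ f x ≤ 1 := by
  obtain ⟨f, hf1, hf2, hf3⟩ := exists_continuousMap_one_of_isCompact_subset_isOpen hK hV hKV
  exact ⟨⟨f, hasCompactSupport_def.mpr hf2⟩, fun x hx => hf1 hx,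
    fun x hx => image_eq_zero_of_notMem_tsupport fun h => hx (hf3.1 h), hf3.2⟩

theorem measure_le_integral_of_eq_one {μ : Measure X} [IsFiniteMeasureOnCompacts μ] {K : Set X}
    (hK : IsCompact K) {f : C_c(X, ℝ)} (h0 : ∀ x, 0 ≤ f x) (h1 : ∀ x ∈ K, f x = 1) :
    μ K ≤ ENNReal.ofReal (∫ x, f x ∂μ) := by
  rw [ofReal_integral_eq_lintegral_ofReal f.integrable (Eventually.of_forall h0)]
  calc μ K = ∫⁻ x, K.indicator 1 x ∂μ := (lintegral_indicator_one hK.measurableSet).symm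
    _ ≤ _ := lintegral_mono fun x => by
      by_cases hx : x ∈ K
      · simp [hx, h1 x hx]
      · simp [hx]

theorem measure_univ_le_of_integral_le {μ : Measure X} [μ.Regular] {c : ℝ}
    (h : ∀ f : C_c(X, ℝ), (∀ x, 0 ≤ f x ∧ f x ≤ 1) → ∫ x, f x ∂μ ≤ c) :
    μ univ ≤ ENNReal.ofReal c := by
  rw [isOpen_univ.measure_eq_iSup_isCompact]
  refine iSup₂_le fun K _ => iSup_le fun hK => ?_
  obtain ⟨f, hf1, -, hf⟩ := exists_compactlySupported_between hK isOpen_univ (subset_univ K)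
  exact (measure_le_integral_of_eq_one hK (fun x => (hf x).1) hf1).trans
    (ENNReal.ofReal_le_ofReal (h f hf))

/-- A bump between a compact `K` and an open `V ⊇ K` gives `μ K ≤ ν V`; inner regularity of `μ` and
outer regularity of `ν` conclude. -/
theorem measure_le_of_integral_le {μ ν : Measure X} [IsFiniteMeasure μ] [IsFiniteMeasure ν]
    [μ.Regular] [ν.Regular]
    (h : ∀ f : C_c(X, ℝ), (∀ x, 0 ≤ f x) → ∫ x, f x ∂μ ≤ ∫ x, f x ∂ν) : μ ≤ ν := by
  refine Measure.le_iff.2 fun s hs => ?_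
  rw [hs.measure_eq_iSup_isCompact_of_ne_top (measure_ne_top μ s)]
  refine iSup₂_le fun K hKs => iSup_le fun hK => ?_
  refine le_trans ?_ (measure_mono hKs)
  rw [K.measure_eq_iInf_isOpen ν]
  simp only [le_iInf_iff]
  intro V hKV hV
  obtain ⟨f, hf1, hf0, hf⟩ := exists_compactlySupported_between hK hV hKV
  refine (measure_le_integral_of_eq_one hK (fun x => (hf x).1) hf1).trans
    ((ENNReal.ofReal_le_ofReal (h f fun x => (hf x).1)).trans ?_)
  rw [ofReal_integral_eq_lintegral_ofReal f.integrable (Eventually.of_forall fun x => (hf x).1),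
    ← lintegral_indicator_one hV.measurableSet]
  refine lintegral_mono fun x => ?_
  by_cases hx : x ∈ V
  · simpa [hx] using (hf x).2
  · simp [hx, hf0 x hx]

theorem integrable_mul_compactlySupported {μ : Measure X} {D : X → ℝ}
    (hD : Integrable D μ) (f : C_c(X, ℝ)) : Integrable (fun x => f x * D x) μ := by
  obtain ⟨K, -, hK⟩ := exists_bound_of_compactlySupported f
  exact hD.bdd_mul f.continuous.measurable.aestronglyMeasurable (Eventually.of_forall hK)

/-- The measures with densities `D⁺` and `D⁻` are finite and agree on `C_c`, hence are equal; then
`D⁺ = D⁻` almost everywhere, which forces `D = 0`. -/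
theorem ae_eq_zero_of_integral_mul_compactlySupported [SecondCountableTopology X] {μ : Measure X}
    [IsFiniteMeasure μ] {D : X → ℝ} (hD : Integrable D μ)
    (h : ∀ f : C_c(X, ℝ), ∫ x, f x * D x ∂μ = 0) : D =ᵐ[μ] 0 := by
  have hfin : ∀ g : X → ℝ, Integrable g μ →
      IsFiniteMeasure (μ.withDensity fun x => ENNReal.ofReal (g x)) := fun g hg =>
    isFiniteMeasure_withDensity_ofReal hg.2
  have hint : ∀ g : X → ℝ, Integrable g μ → ∀ f : C_c(X, ℝ),
      ∫ x, f x ∂(μ.withDensity fun x => ENNReal.ofReal (g x)) = ∫ x, f x * max (g x) 0 ∂μ := by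
    intro g hg f
    rw [integral_withDensity_eq_integral_toReal_smul₀ hg.1.aemeasurable.ennreal_ofReal
      (Eventually.of_forall fun x => ENNReal.ofReal_lt_top)]
    refine integral_congr_ae (Eventually.of_forall fun x => ?_)
    simp [ENNReal.toReal_ofReal', mul_comm]
  have := hfin D hD
  have := hfin (-D) hD.neg
  have heq : (μ.withDensity fun x => ENNReal.ofReal (D x))
      = μ.withDensity fun x => ENNReal.ofReal ((-D) x) := by
    refine Measure.ext_of_integral_eq_on_compactlySupported fun f => ?_
    rw [hint D hD, hint (-D) hD.neg, ← sub_eq_zero,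
      ← integral_sub (integrable_mul_compactlySupported hD.pos_part f)
        (integrable_mul_compactlySupported hD.neg.pos_part f)]
    refine Eq.trans ?_ (h f)
    refine integral_congr_ae (Eventually.of_forall fun x => ?_)
    simp only [Pi.neg_apply, ← mul_sub]
    congr 1
    rcases le_total (D x) 0 with hx | hx
    · rw [max_eq_right hx, max_eq_left (by linarith)]; ring
    · rw [max_eq_left hx, max_eq_right (by linarith)]; ring
  have hae := (withDensity_eq_iff hD.1.aemeasurable.ennreal_ofReal
    hD.neg.1.aemeasurable.ennreal_ofReal hD.lintegral_lt_top.ne).1 heq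
  filter_upwards [hae] with x hx
  have h1 := congrArg ENNReal.toReal hx
  simp only [ENNReal.toReal_ofReal', Pi.neg_apply] at h1
  rcases le_total (D x) 0 with h0 | h0
  · rw [max_eq_right h0, max_eq_left (by linarith)] at h1
    simp only [Pi.zero_apply]; linarith
  · rw [max_eq_left h0, max_eq_right (by linarith)] at h1
    simpa using h1

end Riesz

/-! ### Cutoffs -/

section Cutoff

variable {E : Type*} [TopologicalSpace E]

/-- A growth function: continuous, non-negative and tending to infinity at infinity. -/
structure IsGrowth (Ψ : E → ℝ) : Prop where
  continuous : Continuous Ψ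
  nonneg : ∀ u, 0 ≤ Ψ u
  tendsto : Tendsto Ψ (cocompact E) atTop

/-- The cutoff function that is `1` where `Ψ ≤ R` and vanishes where `Ψ ≥ R + 1`. -/
noncomputable def cutoffFun (Ψ : E → ℝ) (R : ℝ) (u : E) : ℝ := max 0 (min 1 (R + 1 - Ψ u))

variable {Ψ : E → ℝ}

theorem cutoffFun_nonneg (R : ℝ) (u : E) : 0 ≤ cutoffFun Ψ R u := le_max_left _ _

theorem cutoffFun_le_one (R : ℝ) (u : E) : cutoffFun Ψ R u ≤ 1 :=
  max_le zero_le_one (min_le_left _ _)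

theorem cutoffFun_eq_one {R : ℝ} {u : E} (h : Ψ u ≤ R) : cutoffFun Ψ R u = 1 := by
  rw [cutoffFun, min_eq_left (by linarith), max_eq_right zero_le_one]

theorem cutoffFun_eq_zero {R : ℝ} {u : E} (h : R + 1 ≤ Ψ u) : cutoffFun Ψ R u = 0 := by
  rw [cutoffFun, max_eq_left]; exact (min_le_right _ _).trans (by linarith)

theorem tendsto_cutoffFun (u : E) : Tendsto (fun R : ℕ => cutoffFun Ψ R u) atTop (𝓝 1) := by
  refine tendsto_const_nhds.congr' ?_
  obtain ⟨R, hR⟩ := exists_nat_ge (Ψ u)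
  filter_upwards [eventually_ge_atTop R] with S hS
  exact (cutoffFun_eq_one (hR.trans (by exact_mod_cast hS))).symm

/-- Chebyshev's inequality in pointwise form: the cutoff can differ from one only where `Ψ ≥ R`.
Integrated, it is the tightness estimate. -/
theorem one_sub_cutoffFun_le (hΨ : IsGrowth Ψ) {R : ℝ} (hR : 0 < R) (u : E) :
    1 - cutoffFun Ψ R u ≤ R⁻¹ * Ψ u := by
  rcases le_total (Ψ u) R with h | h
  · rw [cutoffFun_eq_one h, sub_self]
    exact mul_nonneg (inv_nonneg.2 hR.le) (hΨ.nonneg u)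
  · have h1 : 1 ≤ R⁻¹ * Ψ u := by rw [inv_mul_eq_div, one_le_div hR]; exact h
    linarith [cutoffFun_nonneg (Ψ := Ψ) R u]

theorem IsGrowth.continuous_cutoffFun (hΨ : IsGrowth Ψ) (R : ℝ) : Continuous (cutoffFun Ψ R) := by
  have := hΨ.continuous
  unfold cutoffFun
  fun_prop

theorem IsGrowth.exists_isCompact [T2Space E] (hΨ : IsGrowth Ψ) (R : ℝ) :
    IsCompact {u | Ψ u ≤ R} := by
  obtain ⟨K, hK, hKR⟩ := mem_cocompact.1 (hΨ.tendsto.eventually (eventually_gt_atTop R))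
  refine hK.of_isClosed_subset (isClosed_le hΨ.continuous continuous_const) fun u hu => ?_
  by_contra hcon
  exact absurd (show R < Ψ u from hKR hcon) (not_lt.2 hu)

/-- The product of a continuous function and a cutoff function. -/
noncomputable def truncate [T2Space E] (hΨ : IsGrowth Ψ) (R : ℝ) (F : E → ℝ) (hF : Continuous F) :
    C_c(E, ℝ) where
  toFun u := F u * cutoffFun Ψ R u
  continuous_toFun := hF.mul (hΨ.continuous_cutoffFun R)
  hasCompactSupport' := HasCompactSupport.intro (hΨ.exists_isCompact (R + 1)) fun u hu => by
    rw [cutoffFun_eq_zero (not_le.1 hu).le, mul_zero]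

@[simp] theorem truncate_apply [T2Space E] (hΨ : IsGrowth Ψ) (R : ℝ) (F : E → ℝ)
    (hF : Continuous F) (u : E) : truncate hΨ R F hF u = F u * cutoffFun Ψ R u := rfl

end Cutoff

end EulerS

namespace EulerS

/-! ### Young measures generated by means -/

section Young

variable {Y E : Type*} [TopologicalSpace Y] [PolishSpace Y] [LocallyCompactSpace Y]
  [MeasurableSpace Y] [BorelSpace Y] [TopologicalSpace E] [PolishSpace E] [LocallyCompactSpace E]
  [MeasurableSpace E] [BorelSpace E]
  {Q : Measure Y} [IsFiniteMeasure Q] {U : ℕ → Y → E} {Ψ : E → ℝ} {C : ℝ≥0}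

/-- The means of `b (U n)` converge in `L¹` to the expectation of `b` under `V`. -/
def MeansTendsto (Q : Measure Y) (w : ℝ → ℝ) (U : ℕ → Y → E) (V : Kernel Y E) : Prop :=
  ∀ b : C_c(E, ℝ), Tendsto (fun N => ∫ y, |weightedMean w N (fun n => b (U n y))
    - ∫ u, b u ∂V y| ∂Q) atTop (𝓝 0)

theorem integrable_joint (hU : ∀ n, AEMeasurable (U n) Q) (Φ : C_c(Y × E, ℝ)) (n : ℕ) :
    Integrable (fun y => Φ (y, U n y)) Q := by
  obtain ⟨K, -, hK⟩ := exists_bound_of_compactlySupported Φ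
  exact Integrable.of_bound (Φ.continuous.measurable.comp_aemeasurable
    (aemeasurable_id.prodMk (hU n))).aestronglyMeasurable K (Eventually.of_forall fun y => hK _)

/-- The mean of the laws of `y ↦ (y, U n y)`, as a functional. -/
noncomputable def jointMean (hU : ∀ n, AEMeasurable (U n) Q) (N : ℕ) : C_c(Y × E, ℝ) →ₗ[ℝ] ℝ where
  toFun Φ := weightedMean 1 N fun n => ∫ y, Φ (y, U n y) ∂Q
  map_add' Φ Φ' := by
    rw [← weightedMean_add]
    congr 1
    ext n
    exact integral_add (integrable_joint hU Φ n) (integrable_joint hU Φ' n)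
  map_smul' c Φ := by
    simp only [RingHom.id_apply, smul_eq_mul]
    rw [← weightedMean_const_mul]
    congr 1
    ext n
    exact integral_const_mul c _

theorem jointMean_apply (hU : ∀ n, AEMeasurable (U n) Q) (N : ℕ) (Φ : C_c(Y × E, ℝ)) :
    jointMean hU N Φ = ∫ y, weightedMean 1 N (fun n => Φ (y, U n y)) ∂Q :=
  (integral_weightedMean N (integrable_joint hU Φ)).symm

/-- The tensor product of two compactly supported functions. -/
noncomputable def tensor (φ : C_c(Y, ℝ)) (b : C_c(E, ℝ)) : C_c(Y × E, ℝ) where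
  toFun z := φ z.1 * b z.2
  continuous_toFun := (φ.continuous.comp continuous_fst).mul (b.continuous.comp continuous_snd)
  hasCompactSupport' := HasCompactSupport.intro
    (φ.hasCompactSupport.isCompact.prod b.hasCompactSupport.isCompact) fun z hz => by
      by_cases h1 : z.1 ∈ tsupport φ
      · have h2 : z.2 ∉ tsupport b := fun h2 => hz ⟨h1, h2⟩
        rw [image_eq_zero_of_notMem_tsupport h2, mul_zero]
      · rw [image_eq_zero_of_notMem_tsupport h1, zero_mul]

@[simp] theorem tensor_apply (φ : C_c(Y, ℝ)) (b : C_c(E, ℝ)) (z : Y × E) :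
    tensor φ b z = φ z.1 * b z.2 := rfl

theorem integrable_growth (hU : ∀ n, AEMeasurable (U n) Q) (hΨ : IsGrowth Ψ)
    (hC : ∀ n, ∫⁻ y, ENNReal.ofReal (Ψ (U n y)) ∂Q ≤ C) (n : ℕ) :
    Integrable (fun y => Ψ (U n y)) Q ∧ ∫ y, Ψ (U n y) ∂Q ≤ C := by
  have hm := aestronglyMeasurable_comp_state hU hΨ.continuous n
  have h0 : 0 ≤ᵐ[Q] fun y => Ψ (U n y) := Eventually.of_forall fun y => hΨ.nonneg _
  refine ⟨⟨hm, ?_⟩, ?_⟩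
  · rw [hasFiniteIntegral_iff_ofReal h0]
    exact (hC n).trans_lt ENNReal.coe_lt_top
  · rw [integral_eq_lintegral_of_nonneg_ae h0 hm]
    exact ENNReal.toReal_le_of_le_ofReal C.2 (by simpa using hC n)

/-- Cutting off the state variable at level `R` loses mass at most `C / R`, uniformly in `N`. Hence
no mass escapes to infinity in the limit of the laws. -/
theorem abs_jointMean_sub_le (hU : ∀ n, AEMeasurable (U n) Q) (hΨ : IsGrowth Ψ)
    (hC : ∀ n, ∫⁻ y, ENNReal.ofReal (Ψ (U n y)) ∂Q ≤ C) (φ : C_c(Y, ℝ)) {K : ℝ}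
    (hK0 : 0 ≤ K) (hK : ∀ y, |φ y| ≤ K) {R : ℝ} (hR : 0 < R) {N : ℕ} (hN : 0 < weightSum 1 N) :
    |jointMean hU N (tensor φ (truncate hΨ R 1 continuous_const)) - ∫ y, φ y ∂Q| ≤ K * (R⁻¹ * C) := by
  change |weightedMean 1 N (fun n => ∫ y, tensor φ (truncate hΨ R 1 continuous_const) (y, U n y) ∂Q)
    - _| ≤ _
  rw [← weightedMean_const hN (∫ y, φ y ∂Q), ← weightedMean_sub, ← Real.norm_eq_abs]
  have hφ : Integrable (fun y => φ y) Q := φ.integrable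
  refine norm_weightedMean_le_of_le isAveraging_one
    (mul_nonneg hK0 (mul_nonneg (inv_nonneg.2 hR.le) C.2)) fun n => ?_
  rw [← integral_sub (integrable_joint hU _ n) hφ]
  refine (norm_integral_le_integral_norm _).trans ?_
  obtain ⟨hi, hle⟩ := integrable_growth hU hΨ hC n
  calc ∫ y, ‖tensor φ (truncate hΨ R 1 continuous_const) (y, U n y) - φ y‖ ∂Q
      ≤ ∫ y, K * (R⁻¹ * Ψ (U n y)) ∂Q := by
        refine integral_mono ((integrable_joint hU _ n).sub hφ).norm
          ((hi.const_mul _).const_mul _) fun y => ?_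
        have h1 := one_sub_cutoffFun_le hΨ hR (U n y)
        have h2 := cutoffFun_le_one (Ψ := Ψ) R (U n y)
        have : tensor φ (truncate hΨ R 1 continuous_const) (y, U n y) - φ y
            = -(φ y * (1 - cutoffFun Ψ R (U n y))) := by
          simp; ring
        change ‖tensor φ (truncate hΨ R 1 continuous_const) (y, U n y) - φ y‖ ≤ _
        rw [this, norm_neg, norm_mul, Real.norm_eq_abs, Real.norm_of_nonneg (sub_nonneg.2 h2)]
        exact mul_le_mul (hK y) h1 (sub_nonneg.2 h2) hK0
    _ = K * (R⁻¹ * ∫ y, Ψ (U n y) ∂Q) := by rw [integral_const_mul, integral_const_mul]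
    _ ≤ K * (R⁻¹ * C) := by gcongr

/-- The candidate is the conditional distribution of an ultrafilter limit of the averaged laws of
`(y, U_n(y))`. Convergence along all of `atTop`, and in `L¹`, is then inherited from `hlim`: the
given limits `h` must be the expectations under this kernel. -/
theorem exists_kernel_of_means [Nonempty E] (hU : ∀ n, AEMeasurable (U n) Q) (hΨ : IsGrowth Ψ)
    (hC : ∀ n, ∫⁻ y, ENNReal.ofReal (Ψ (U n y)) ∂Q ≤ C)
    (hlim : ∀ b : C_c(E, ℝ), ∃ h : Y → ℝ, Integrable h Q ∧
      Tendsto (fun N => ∫ y, |weightedMean 1 N (fun n => b (U n y)) - h y| ∂Q) atTop (𝓝 0)) :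
    ∃ V : Kernel Y E, IsMarkovKernel V ∧ MeansTendsto Q 1 U V := by
  have hbound : ∀ (Φ : C_c(Y × E, ℝ)) (K : ℝ), 0 ≤ K → (∀ z, |Φ z| ≤ K) → ∀ N,
      |jointMean hU N Φ| ≤ K * Q.real univ := by
    intro Φ K hK0 hK N
    rw [jointMean_apply, ← Real.norm_eq_abs]
    exact norm_integral_le_of_norm_le_const (Eventually.of_forall fun y =>
      norm_weightedMean_le_of_le isAveraging_one hK0 fun n => hK _)
  obtain ⟨Λ, hΛ⟩ := exists_ultralimit (jointMean hU) fun Φ => by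
    obtain ⟨K, hK0, hK⟩ := exists_bound_of_compactlySupported Φ
    exact ⟨_, hbound Φ K hK0 hK⟩
  obtain ⟨M, hMreg, hM⟩ := exists_measure_of_nonneg Λ fun Φ hΦ =>
    ge_of_tendsto' (hΛ Φ) fun N => weightedMean_nonneg isAveraging_one fun n =>
      integral_nonneg fun y => hΦ _
  have hMfin : IsFiniteMeasure M := by
    refine ⟨(measure_univ_le_of_integral_le (c := 1 * Q.real univ) fun Φ hΦ => ?_).trans_lt
      ENNReal.ofReal_lt_top⟩
    rw [hM]
    exact le_of_tendsto' (hΛ Φ) fun N => (le_abs_self _).trans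
      (hbound Φ 1 zero_le_one (fun z => by rw [abs_of_nonneg (hΦ z).1]; exact (hΦ z).2) N)
  -- Testing with `φ` alone is not allowed, since `φ ⊗ 1` is not compactly supported. The cutoff
  -- replaces `1`, with an error `C / R` that is sent to zero after the ultrafilter limit.
  have hfst : M.fst = Q := by
    refine Measure.ext_of_integral_eq_on_compactlySupported fun φ => ?_
    rw [Measure.fst, integral_map (f := fun y => φ y) measurable_fst.aemeasurable
      φ.continuous.measurable.aestronglyMeasurable]
    obtain ⟨K, hK0, hK⟩ := exists_bound_of_compactlySupported φ
    have h1 : Tendsto (fun R : ℕ => ∫ z, tensor φ (truncate hΨ R 1 continuous_const) z ∂M) atTop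
        (𝓝 (∫ z, φ z.1 ∂M)) := by
      refine tendsto_integral_of_dominated_convergence (fun _ => K)
        (fun R => (tensor φ _).continuous.measurable.aestronglyMeasurable)
        (integrable_const _) (fun R => Eventually.of_forall fun z => ?_)
        (Eventually.of_forall fun z => ?_)
      · rw [tensor_apply, truncate_apply, Pi.one_apply, one_mul, norm_mul,
          Real.norm_of_nonneg (cutoffFun_nonneg _ _)]
        calc ‖φ z.1‖ * cutoffFun Ψ R z.2 ≤ K * 1 :=
              mul_le_mul (hK _) (cutoffFun_le_one _ _) (cutoffFun_nonneg _ _) hK0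
          _ = K := mul_one K
      · simpa using (tendsto_cutoffFun (Ψ := Ψ) z.2).const_mul (φ z.1)
    have h2 : ∀ R : ℕ, 0 < R →
        |∫ z, tensor φ (truncate hΨ R 1 continuous_const) z ∂M - ∫ y, φ y ∂Q|
          ≤ K * ((R : ℝ)⁻¹ * C) := by
      intro R hR
      rw [hM]
      refine le_of_tendsto ((hΛ _).sub_const _).abs ?_
      refine (isAveraging_one.eventually_pos.filter_mono ?_).mono fun N hN =>
        abs_jointMean_sub_le hU hΨ hC φ hK0 hK (by exact_mod_cast hR) hN
      exact Nat.hyperfilter_le_atTop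
    have h3 : Tendsto (fun R : ℕ => K * ((R : ℝ)⁻¹ * C)) atTop (𝓝 0) := by
      simpa using ((tendsto_inv_atTop_nhds_zero_nat (𝕜 := ℝ)).mul_const (C : ℝ)).const_mul K
    have h4 : |∫ z, φ z.1 ∂M - ∫ y, φ y ∂Q| ≤ 0 :=
      le_of_tendsto_of_tendsto (h1.sub_const _).abs h3
        ((eventually_gt_atTop 0).mono fun R hR => h2 R hR)
    exact sub_eq_zero.1 (abs_eq_zero.1 (le_antisymm h4 (abs_nonneg _)))
  refine ⟨M.condKernel, inferInstance, fun b => ?_⟩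
  obtain ⟨h, hh, hlimh⟩ := hlim b
  obtain ⟨K, hK0, hK⟩ := exists_bound_of_compactlySupported b
  have hVint : Integrable (fun y => ∫ u, b u ∂M.condKernel y) Q := by
    refine Integrable.of_bound
      (b.continuous.measurable.stronglyMeasurable.integral_kernel).aestronglyMeasurable K
      (Eventually.of_forall fun y => ?_)
    refine (norm_integral_le_of_norm_le_const (Eventually.of_forall hK)).trans ?_
    simp
  -- Against any `φ ∈ C_c`, both functions integrate to `Λ (φ ⊗ b)`: the expectation by
  -- disintegration of `M`, and `h` by the assumed `L¹` convergence.
  have hae : (fun y => h y - ∫ u, b u ∂M.condKernel y) =ᵐ[Q] 0 := by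
    refine ae_eq_zero_of_integral_mul_compactlySupported (hh.sub hVint) fun φ => ?_
    have h1 : ∫ y, φ y * ∫ u, b u ∂M.condKernel y ∂Q = Λ (tensor φ b) := by
      have h2 := Measure.integral_compProd (μ := M.fst) (κ := M.condKernel)
        (f := fun z => tensor φ b z) (by
          rw [Measure.disintegrate]; exact (tensor φ b).integrable)
      rw [Measure.disintegrate, hM, hfst] at h2
      rw [h2]
      simp [integral_const_mul]
    obtain ⟨K', hK0', hK'⟩ := exists_bound_of_compactlySupported φ
    have h2 : Tendsto (fun N => jointMean hU N (tensor φ b)) atTop (𝓝 (∫ y, φ y * h y ∂Q)) := by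
      rw [tendsto_iff_dist_tendsto_zero]
      refine squeeze_zero (fun _ => dist_nonneg) (fun N => ?_) (by simpa using hlimh.const_mul K')
      have hmean := integrable_weightedMean_comp hU b 1 N
      have : jointMean hU N (tensor φ b) = ∫ y, φ y * weightedMean 1 N (fun n => b (U n y)) ∂Q := by
        rw [jointMean_apply]
        simp [weightedMean_const_mul]
      rw [this, Real.dist_eq, ← integral_sub (integrable_mul_compactlySupported hmean φ)
        (integrable_mul_compactlySupported hh φ), ← integral_const_mul, ← Real.norm_eq_abs]
      refine norm_integral_le_of_norm_le ((hmean.sub hh).abs.const_mul K')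
        (Eventually.of_forall fun y => ?_)
      rw [← mul_sub, norm_mul]
      exact mul_le_mul_of_nonneg_right (hK' y) (abs_nonneg _)
    have h3 : ∫ y, φ y * h y ∂Q = Λ (tensor φ b) :=
      tendsto_nhds_unique (h2.mono_left Nat.hyperfilter_le_atTop) (hΛ _)
    simp only [mul_sub]
    rw [integral_sub (integrable_mul_compactlySupported hh φ)
      (integrable_mul_compactlySupported hVint φ), h1, h3, sub_self]
  refine hlimh.congr fun N => integral_congr_ae ?_
  filter_upwards [hae] with y hy
  rw [sub_eq_zero.1 hy]

end Young

end EulerS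

namespace EulerS

/-! ### Weak-star limits, uniqueness of the Young measure and its moments -/

section Consequences

variable {Y E : Type*} [TopologicalSpace Y] [PolishSpace Y] [LocallyCompactSpace Y]
  [MeasurableSpace Y] [BorelSpace Y] [TopologicalSpace E] [PolishSpace E] [LocallyCompactSpace E]
  [MeasurableSpace E] [BorelSpace E]
  {Q : Measure Y} [IsFiniteMeasure Q] {U : ℕ → Y → E} {Ψ : E → ℝ} {C : ℝ≥0} {w : ℝ → ℝ}
  {V : Kernel Y E} [IsMarkovKernel V]

theorem abs_expectation_le {b : E → ℝ} {K : ℝ} (hK : ∀ u, |b u| ≤ K) (y : Y) :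
    |∫ u, b u ∂V y| ≤ K := by
  have h := norm_integral_le_of_norm_le_const (μ := V y) (f := fun u => b u)
    (Eventually.of_forall hK)
  simpa using h

theorem stronglyMeasurable_expectation {F : E → ℝ} (hF : Continuous F) :
    StronglyMeasurable fun y => ∫ u, F u ∂V y :=
  hF.measurable.stronglyMeasurable.integral_kernel

theorem integrable_expectation (b : C_c(E, ℝ)) : Integrable (fun y => ∫ u, b u ∂V y) Q := by
  obtain ⟨K, -, hK⟩ := exists_bound_of_compactlySupported b
  exact Integrable.of_bound (stronglyMeasurable_expectation b.continuous).aestronglyMeasurable K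
    (Eventually.of_forall fun y => abs_expectation_le hK y)

theorem exists_subseq_ae_of_tendsto_integral_abs {α : Type*} [MeasurableSpace α] {μ : Measure α}
    {x : ℕ → α → ℝ} {f : α → ℝ} (hx : ∀ N, Integrable (x N) μ) (hf : Integrable f μ)
    (h : Tendsto (fun N => ∫ y, |x N y - f y| ∂μ) atTop (𝓝 0)) :
    ∃ ns : ℕ → ℕ, StrictMono ns ∧ ∀ᵐ y ∂μ, Tendsto (fun k => x (ns k) y) atTop (𝓝 (f y)) := by
  refine TendstoInMeasure.exists_seq_tendsto_ae (tendstoInMeasure_of_tendsto_eLpNorm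
    (p := 1) one_ne_zero (fun N => (hx N).1) hf.1 ?_)
  have h1 := ENNReal.tendsto_ofReal h
  rw [ENNReal.ofReal_zero] at h1
  refine h1.congr fun N => ?_
  rw [eLpNorm_one_eq_lintegral_enorm, ← ofReal_integral_norm_eq_lintegral_enorm ((hx N).sub hf)]
  rfl

/-- Every subsequence has a further one converging almost everywhere, and the means are bounded by
`sup |b|`, so dominated convergence works against any integrable `φ`. -/
theorem MeansTendsto.hasSLimit (hw : IsAveraging w) (hU : ∀ n, AEMeasurable (U n) Q)
    (hV : MeansTendsto Q w U V) : HasSLimit Q w U V := by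
  intro b φ hφ
  obtain ⟨K, hK0, hK⟩ := exists_bound_of_compactlySupported b
  refine tendsto_of_subseq_tendsto fun ns hns => ?_
  obtain ⟨ms, hms, hae⟩ := exists_subseq_ae_of_tendsto_integral_abs
    (fun N => integrable_weightedMean_comp hU b w (ns N)) (integrable_expectation b)
    ((hV b).comp hns)
  refine ⟨ms, tendsto_integral_of_dominated_convergence (fun y => ‖φ y‖ * K)
    (fun k => hφ.1.mul (integrable_weightedMean_comp hU b w _).1) (hφ.norm.mul_const K)
    (fun k => Eventually.of_forall fun y => ?_) ?_⟩
  · rw [norm_mul]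
    exact mul_le_mul_of_nonneg_left (norm_weightedMean_le_of_le hw hK0 fun n => hK _)
      (norm_nonneg _)
  · filter_upwards [hae] with y hy
    exact hy.const_mul _

theorem integral_mul_snd {A : Set Y} (hA : MeasurableSet A) (b : C_c(E, ℝ)) :
    ∫ u, b u ∂((Q.restrict A) ⊗ₘ V).snd = ∫ y, A.indicator 1 y * ∫ u, b u ∂V y ∂Q := by
  rw [Measure.snd, integral_map (f := fun u => b u) measurable_snd.aemeasurable
    b.continuous.measurable.aestronglyMeasurable, Measure.integral_compProd]
  · rw [← integral_indicator hA]
    refine integral_congr_ae (Eventually.of_forall fun y => ?_)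
    by_cases hy : y ∈ A <;> simp [hy]
  · obtain ⟨K, hK0, hK⟩ := exists_bound_of_compactlySupported b
    exact Integrable.of_bound (b.continuous.measurable.comp measurable_snd).aestronglyMeasurable K
      (Eventually.of_forall fun y => hK _)

/-- Indicators of measurable sets `A` are admissible test functions, so the second marginals of
`Q|_A ⊗ V` and `Q|_A ⊗ V'` agree on `C_c`, hence as measures. Thus `Q ⊗ V` and `Q ⊗ V'` agree on
rectangles. -/
theorem HasSLimit.ae_eq {V' : Kernel Y E} [IsMarkovKernel V'] (h : HasSLimit Q w U V)
    (h' : HasSLimit Q w U V') : ∀ᵐ y ∂Q, V' y = V y := by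
  refine Kernel.ae_eq_of_compProd_eq ?_
  refine Measure.ext_prod fun {A B} hA hB => ?_
  have hsnd : ((Q.restrict A) ⊗ₘ V').snd = ((Q.restrict A) ⊗ₘ V).snd := by
    refine Measure.ext_of_integral_eq_on_compactlySupported fun b => ?_
    rw [integral_mul_snd hA, integral_mul_snd hA]
    have hi : Integrable (A.indicator (1 : Y → ℝ)) Q := (integrable_const (1 : ℝ)).indicator hA
    exact tendsto_nhds_unique (h' b _ hi) (h b _ hi)
  have key : ∀ (W : Kernel Y E) [IsMarkovKernel W],
      (Q ⊗ₘ W) (A ×ˢ B) = ((Q.restrict A) ⊗ₘ W).snd B := by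
    intro W _
    rw [Measure.snd_apply hB, Measure.compProd_apply_prod hA hB,
      Measure.compProd_apply (measurable_snd hB)]
    rfl
  rw [key, key, hsnd]

/-- The truncations of `Ψ` lie in `C_c`, and their integrals inherit the bound `C` from the
sequence; Fatou's lemma removes the truncation. -/
theorem MeansTendsto.lintegral_growth_le (hw : IsAveraging w) (hU : ∀ n, AEMeasurable (U n) Q)
    (hΨ : IsGrowth Ψ) (hC : ∀ n, ∫⁻ y, ENNReal.ofReal (Ψ (U n y)) ∂Q ≤ C)
    (hV : MeansTendsto Q w U V) : ∫⁻ y, ∫⁻ u, ENNReal.ofReal (Ψ u) ∂V y ∂Q ≤ C := by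
  have hmeas : Measurable fun z : Y × E => ENNReal.ofReal (Ψ z.2) :=
    (hΨ.continuous.measurable.comp measurable_snd).ennreal_ofReal
  rw [← Measure.lintegral_compProd hmeas]
  set b : ℕ → C_c(E, ℝ) := fun R => truncate hΨ R Ψ hΨ.continuous with hb
  have hb0 : ∀ R u, 0 ≤ b R u := fun R u => mul_nonneg (hΨ.nonneg u) (cutoffFun_nonneg _ _)
  have hle : ∀ R : ℕ, ∫⁻ z, ENNReal.ofReal (b R z.2) ∂(Q ⊗ₘ V) ≤ C := by
    intro R
    obtain ⟨K, hK0, hK⟩ := exists_bound_of_compactlySupported (b R)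
    have hi : Integrable (fun z : Y × E => b R z.2) (Q ⊗ₘ V) :=
      Integrable.of_bound ((b R).continuous.measurable.comp measurable_snd).aestronglyMeasurable K
        (Eventually.of_forall fun y => hK _)
    rw [← ofReal_integral_eq_lintegral_ofReal hi (Eventually.of_forall fun z => hb0 R z.2),
      Measure.integral_compProd hi, ← ENNReal.ofReal_coe_nnreal]
    refine ENNReal.ofReal_le_ofReal ?_
    have hconv : Tendsto (fun N => ∫ y, weightedMean w N (fun n => b R (U n y)) ∂Q) atTop
        (𝓝 (∫ y, ∫ u, b R u ∂V y ∂Q)) := by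
      simpa using hV.hasSLimit hw hU (b R) (fun _ => 1) (integrable_const _)
    refine le_of_tendsto' hconv fun N => ?_
    rw [integral_weightedMean N (integrable_comp_state hU (b R))]
    refine weightedMean_le_of_le hw C.2 fun n => ?_
    obtain ⟨h1, h2⟩ := integrable_growth hU hΨ hC n
    refine le_trans (integral_mono (integrable_comp_state hU (b R) n) h1 fun y => ?_) h2
    exact mul_le_of_le_one_right (hΨ.nonneg _) (cutoffFun_le_one _ _)
  calc ∫⁻ z, ENNReal.ofReal (Ψ z.2) ∂(Q ⊗ₘ V)
      = ∫⁻ z, liminf (fun R : ℕ => ENNReal.ofReal (b R z.2)) atTop ∂(Q ⊗ₘ V) := by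
        refine lintegral_congr fun z => ?_
        have : Tendsto (fun R : ℕ => ENNReal.ofReal (b R z.2)) atTop
            (𝓝 (ENNReal.ofReal (Ψ z.2))) := by
          refine ENNReal.tendsto_ofReal ?_
          simpa [hb] using (tendsto_cutoffFun (Ψ := Ψ) z.2).const_mul (Ψ z.2)
        exact this.liminf_eq.symm
    _ ≤ liminf (fun R : ℕ => ∫⁻ z, ENNReal.ofReal (b R z.2) ∂(Q ⊗ₘ V)) atTop :=
        lintegral_liminf_le fun R =>
          ((b R).continuous.measurable.comp measurable_snd).ennreal_ofReal
    _ ≤ C := liminf_le_of_le (by isBoundedDefault) fun c hc => by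
        obtain ⟨R, hR⟩ := hc.exists
        exact hR.trans (hle R)

/-! ### Convergence of means of functions of controlled growth -/

theorem lintegral_rpow_le_of_le_growth {F : E → ℝ} {q ε : ℝ} (hq : 0 ≤ q) (hε : 0 ≤ ε)
    (hF : ∀ u, |F u| ^ q ≤ ε * Ψ u) (μ : Measure E) :
    ∫⁻ u, ‖F u‖ₑ ^ q ∂μ ≤ ENNReal.ofReal ε * ∫⁻ u, ENNReal.ofReal (Ψ u) ∂μ := by
  rw [← lintegral_const_mul' _ _ ENNReal.ofReal_ne_top]
  refine lintegral_mono fun u => ?_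
  rw [← ENNReal.ofReal_mul hε, Real.enorm_eq_ofReal_abs,
    ENNReal.ofReal_rpow_of_nonneg (abs_nonneg _) hq]
  exact ENNReal.ofReal_le_ofReal (hF u)

theorem eLpNorm_ofReal_le {α G : Type*} [MeasurableSpace α] {μ : Measure α} [NormedAddCommGroup G]
    {f : α → G} {q : ℝ} (hq : 1 ≤ q) {a : ℝ≥0∞} (h : ∫⁻ x, ‖f x‖ₑ ^ q ∂μ ≤ a) :
    eLpNorm f (ENNReal.ofReal q) μ ≤ a ^ (1 / q) := by
  have hq0 : 0 < q := by linarith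
  rw [eLpNorm_eq_lintegral_rpow_enorm_toReal (by simpa using hq0) ENNReal.ofReal_ne_top,
    ENNReal.toReal_ofReal hq0.le]
  exact ENNReal.rpow_le_rpow h (by positivity)

theorem enorm_integral_rpow_le {μ : Measure E} [IsProbabilityMeasure μ] {F : E → ℝ}
    (hF : Continuous F) {q : ℝ} (hq : 1 ≤ q) : ‖∫ u, F u ∂μ‖ₑ ^ q ≤ ∫⁻ u, ‖F u‖ₑ ^ q ∂μ := by
  have hq0 : 0 < q := by linarith
  have h1 := eLpNorm_le_eLpNorm_of_exponent_le (μ := μ) (f := F) (p := 1) (q := ENNReal.ofReal q)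
    (by rwa [ENNReal.one_le_ofReal]) hF.measurable.aestronglyMeasurable
  rw [eLpNorm_one_eq_lintegral_enorm, eLpNorm_eq_lintegral_rpow_enorm_toReal (by simpa using hq0)
    ENNReal.ofReal_ne_top, ENNReal.toReal_ofReal hq0.le] at h1
  calc ‖∫ u, F u ∂μ‖ₑ ^ q ≤ ((∫⁻ u, ‖F u‖ₑ ^ q ∂μ) ^ (1 / q)) ^ q :=
        ENNReal.rpow_le_rpow ((enorm_integral_le_lintegral_enorm _).trans h1) hq0.le
    _ = _ := by rw [← ENNReal.rpow_mul, one_div_mul_cancel hq0.ne', ENNReal.rpow_one]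

theorem lintegral_comp_state_le {F : E → ℝ} {q ε : ℝ} (hq : 0 ≤ q) (hε : 0 ≤ ε)
    (hF : ∀ u, |F u| ^ q ≤ ε * Ψ u)
    (hC : ∀ n, ∫⁻ y, ENNReal.ofReal (Ψ (U n y)) ∂Q ≤ C) (n : ℕ) :
    ∫⁻ y, ‖F (U n y)‖ₑ ^ q ∂Q ≤ ENNReal.ofReal ε * C := by
  refine le_trans ?_ (mul_le_mul_right (hC n) _)
  rw [← lintegral_const_mul' _ _ ENNReal.ofReal_ne_top]
  refine lintegral_mono fun y => ?_
  rw [← ENNReal.ofReal_mul hε, Real.enorm_eq_ofReal_abs,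
    ENNReal.ofReal_rpow_of_nonneg (abs_nonneg _) hq]
  exact ENNReal.ofReal_le_ofReal (hF _)

theorem eLpNorm_weightedMean_le {α : Type*} [MeasurableSpace α] {μ : Measure α}
    (hw : IsAveraging w) (N : ℕ) {f : ℕ → α → ℝ} (hf : ∀ n, AEStronglyMeasurable (f n) μ)
    {p a : ℝ≥0∞} (hp : 1 ≤ p) (h : ∀ n, eLpNorm (f n) p μ ≤ a) :
    eLpNorm (fun x => weightedMean w N fun n => f n x) p μ ≤ a := by
  have h1 : (fun x => weightedMean w N fun n => f n x)
      = ∑ n ∈ Finset.range N, coeff w N n • f n := by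
    ext x; simp [weightedMean_eq_sum]
  rw [h1]
  calc _ ≤ ∑ n ∈ Finset.range N, eLpNorm (coeff w N n • f n) p μ :=
        eLpNorm_sum_le (fun n _ => (hf n).const_smul _) hp
    _ ≤ ∑ n ∈ Finset.range N, ENNReal.ofReal (coeff w N n) * a := by
        refine Finset.sum_le_sum fun n hn => ?_
        rw [eLpNorm_const_smul, Real.enorm_of_nonneg (coeff_nonneg hw hn)]
        exact mul_le_mul_right (h n) _
    _ = ENNReal.ofReal (∑ n ∈ Finset.range N, coeff w N n) * a := by
        rw [ENNReal.ofReal_sum_of_nonneg fun n hn => coeff_nonneg hw hn, Finset.sum_mul]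
    _ ≤ 1 * a := by
        gcongr
        exact ENNReal.ofReal_le_one.2 (sum_coeff_le_one hw N)
    _ = a := one_mul a

/-- Both the means and the expectation are bounded by `K`, so `|x|^q ≤ (2K)^{q-1} |x|` upgrades `L¹`
convergence to `L^q`. -/
theorem MeansTendsto.tendsto_eLpNorm_compactlySupported (hw : IsAveraging w)
    (hU : ∀ n, AEMeasurable (U n) Q) (hV : MeansTendsto Q w U V) (b : C_c(E, ℝ)) {q : ℝ}
    (hq : 1 ≤ q) :
    Tendsto (fun N => eLpNorm (fun y => weightedMean w N (fun n => b (U n y)) - ∫ u, b u ∂V y)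
      (ENNReal.ofReal q) Q) atTop (𝓝 0) := by
  have hq0 : 0 < q := by linarith
  obtain ⟨K, hK0, hK⟩ := exists_bound_of_compactlySupported b
  have h1 : ∀ N, eLpNorm (fun y => weightedMean w N (fun n => b (U n y)) - ∫ u, b u ∂V y)
      (ENNReal.ofReal q) Q ≤ (ENNReal.ofReal (K + K) ^ (q - 1) * ENNReal.ofReal
        (∫ y, |weightedMean w N (fun n => b (U n y)) - ∫ u, b u ∂V y| ∂Q)) ^ (1 / q) := by
    intro N
    refine eLpNorm_ofReal_le hq ?_
    have hi := (integrable_weightedMean_comp hU b w N).sub (integrable_expectation (V := V) b)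
    have h2 := ofReal_integral_norm_eq_lintegral_enorm hi
    simp only [Pi.sub_apply, Real.norm_eq_abs] at h2
    rw [h2, ← lintegral_const_mul' _ _ (ENNReal.rpow_ne_top_of_nonneg (by linarith)
      ENNReal.ofReal_ne_top)]
    refine lintegral_mono fun y => ?_
    set a := weightedMean w N (fun n => b (U n y)) - ∫ u, b u ∂V y with ha
    have hle : ‖a‖ₑ ≤ ENNReal.ofReal (K + K) := by
      rw [Real.enorm_eq_ofReal_abs]
      refine ENNReal.ofReal_le_ofReal ((abs_sub _ _).trans (add_le_add ?_ (abs_expectation_le hK y)))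
      exact norm_weightedMean_le_of_le (x := fun n => b (U n y)) hw hK0 fun n => hK _
    calc ‖a‖ₑ ^ q = ‖a‖ₑ ^ ((q - 1) + 1) := by ring_nf
      _ = ‖a‖ₑ ^ (q - 1) * ‖a‖ₑ := by
        rw [ENNReal.rpow_add_of_nonneg _ _ (by linarith) zero_le_one, ENNReal.rpow_one]
      _ ≤ _ := mul_le_mul_left (ENNReal.rpow_le_rpow hle (by linarith)) _
  refine tendsto_of_tendsto_of_tendsto_of_le_of_le tendsto_const_nhds ?_ (fun _ => bot_le) h1
  have h2 := ENNReal.tendsto_ofReal (hV b)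
  rw [ENNReal.ofReal_zero] at h2
  have h3 := ENNReal.Tendsto.const_mul (a := ENNReal.ofReal (K + K) ^ (q - 1)) h2
    (Or.inr (ENNReal.rpow_ne_top_of_nonneg (by linarith) ENNReal.ofReal_ne_top))
  rw [mul_zero] at h3
  have h4 := h3.ennrpow_const (1 / q)
  rwa [ENNReal.zero_rpow_of_pos (by positivity)] at h4

/-- `F` has order less than `1 / q` with respect to the growth function `Ψ`. -/
def IsSmallGrowth (Ψ F : E → ℝ) (q : ℝ) : Prop :=
  ∀ ε > 0, ∃ R, ∀ u, R ≤ Ψ u → |F u| ^ q ≤ ε * Ψ u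

theorem IsSmallGrowth.exists_tail {F : E → ℝ} {q : ℝ} (hq : 1 ≤ q) (hΨ : IsGrowth Ψ)
    (hF : IsSmallGrowth Ψ F q) {ε : ℝ} (hε : 0 < ε) :
    ∃ R : ℝ, ∀ S ≥ R, ∀ u, |F u * (1 - cutoffFun Ψ S u)| ^ q ≤ ε * Ψ u := by
  obtain ⟨R, hR⟩ := hF ε hε
  refine ⟨R, fun S hS u => ?_⟩
  rcases le_total (Ψ u) S with h | h
  · rw [cutoffFun_eq_one h, sub_self, mul_zero, abs_zero, Real.zero_rpow (by linarith)]
    exact mul_nonneg hε.le (hΨ.nonneg u)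
  · refine le_trans (Real.rpow_le_rpow (abs_nonneg _) ?_ (by linarith)) (hR u (hS.trans h))
    have h1 : 0 ≤ 1 - cutoffFun Ψ S u := sub_nonneg.2 (cutoffFun_le_one _ _)
    rw [abs_mul, abs_of_nonneg h1]
    exact mul_le_of_le_one_right (abs_nonneg _) (by linarith [cutoffFun_nonneg (Ψ := Ψ) S u])

theorem integrable_of_rpow_le_growth {μ : Measure E} [IsFiniteMeasure μ] {F : E → ℝ}
    (hF : Continuous F) {q ε : ℝ} (hq : 1 ≤ q) (hΨ : IsGrowth Ψ)
    (h : ∀ u, |F u| ^ q ≤ ε * Ψ u) (hμ : ∫⁻ u, ENNReal.ofReal (Ψ u) ∂μ < ⊤) :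
    Integrable F μ := by
  have hi : Integrable Ψ μ := ⟨hΨ.continuous.measurable.aestronglyMeasurable, by
    rwa [hasFiniteIntegral_iff_ofReal (Eventually.of_forall hΨ.nonneg)]⟩
  refine ((integrable_const (1 : ℝ)).add (hi.const_mul ε)).mono'
    hF.measurable.aestronglyMeasurable (Eventually.of_forall fun u => ?_)
  rw [Real.norm_eq_abs]
  refine le_trans ?_ (add_le_add_right (h u) 1)
  rcases le_total (|F u|) 1 with h1 | h1
  · exact h1.trans (le_add_of_nonneg_right (Real.rpow_nonneg (abs_nonneg _) _))
  · exact (Real.self_le_rpow_of_one_le h1 hq).trans (le_add_of_nonneg_left zero_le_one)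

theorem integrable_of_smallGrowth {μ : Measure E} [IsFiniteMeasure μ] {F : E → ℝ}
    (hF : Continuous F) {q : ℝ} (hq : 1 ≤ q) (hΨ : IsGrowth Ψ)
    (h : IsSmallGrowth Ψ F q) (hμ : ∫⁻ u, ENNReal.ofReal (Ψ u) ∂μ < ⊤) :
    Integrable F μ := by
  obtain ⟨R, hR⟩ := h.exists_tail hq hΨ one_pos
  have h1 := integrable_of_rpow_le_growth
    (hF.mul (continuous_const.sub (hΨ.continuous_cutoffFun R))) hq hΨ (hR R le_rfl) hμ
  have h2 := (truncate hΨ R F hF).integrable (μ := μ)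
  refine (h2.add h1).congr (Eventually.of_forall fun u => ?_)
  simp; ring

/-- Split `F` into a compactly supported part and a tail. The first converges; the tails of the
means and of the expectation are at most `(εC)^{1/q}` in `L^q`, uniformly in `N`, by small growth
and, for the expectation, Jensen's inequality. -/
theorem MeansTendsto.tendsto_eLpNorm (hw : IsAveraging w) (hU : ∀ n, AEMeasurable (U n) Q)
    (hΨ : IsGrowth Ψ) (hC : ∀ n, ∫⁻ y, ENNReal.ofReal (Ψ (U n y)) ∂Q ≤ C)
    (hV : MeansTendsto Q w U V) {F : E → ℝ} (hF : Continuous F) {q : ℝ} (hq : 1 ≤ q)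
    (hFΨ : IsSmallGrowth Ψ F q) :
    MemLp (fun y => ∫ u, F u ∂V y) (ENNReal.ofReal q) Q ∧
    Tendsto (fun N => eLpNorm (fun y => weightedMean w N (fun n => F (U n y)) - ∫ u, F u ∂V y)
      (ENNReal.ofReal q) Q) atTop (𝓝 0) := by
  have hq0 : 0 < q := by linarith
  have hq1 : 1 ≤ ENNReal.ofReal q := by rwa [ENNReal.one_le_ofReal]
  have hVC := hV.lintegral_growth_le hw hU hΨ hC
  have hVfin : ∀ᵐ y ∂Q, ∫⁻ u, ENNReal.ofReal (Ψ u) ∂V y < ⊤ :=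
    ae_lt_top (Measurable.lintegral_kernel hΨ.continuous.measurable.ennreal_ofReal)
      (hVC.trans_lt ENNReal.coe_lt_top).ne
  -- the decomposition of `F` into a compactly supported part and a tail
  have hsplit : ∀ R : ℝ, ∀ᵐ y ∂Q, ∫ u, F u ∂V y = ∫ u, truncate hΨ R F hF u ∂V y
      + ∫ u, F u * (1 - cutoffFun Ψ R u) ∂V y := by
    intro R
    filter_upwards [hVfin] with y hy
    have h1 := (truncate hΨ R F hF).integrable (μ := V y)
    have h2 := integrable_of_smallGrowth hF hq hΨ hFΨ hy
    rw [← integral_add h1]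
    · refine integral_congr_ae (Eventually.of_forall fun u => ?_)
      simp; ring
    · refine (h2.sub h1).congr (Eventually.of_forall fun u => ?_)
      simp; ring
  have htailcont : ∀ R : ℝ, Continuous fun u => F u * (1 - cutoffFun Ψ R u) := fun R =>
    hF.mul (continuous_const.sub (hΨ.continuous_cutoffFun R))
  have htailV : ∀ (R ε : ℝ), 0 ≤ ε → (∀ u, |F u * (1 - cutoffFun Ψ R u)| ^ q ≤ ε * Ψ u) →
      eLpNorm (fun y => ∫ u, F u * (1 - cutoffFun Ψ R u) ∂V y) (ENNReal.ofReal q) Q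
        ≤ (ENNReal.ofReal ε * C) ^ (1 / q) := by
    intro R ε hε h
    refine eLpNorm_ofReal_le hq ?_
    calc _ ≤ ∫⁻ y, ENNReal.ofReal ε * ∫⁻ u, ENNReal.ofReal (Ψ u) ∂V y ∂Q :=
          lintegral_mono fun y => (enorm_integral_rpow_le (htailcont R) hq).trans
            (lintegral_rpow_le_of_le_growth hq0.le hε h _)
      _ = ENNReal.ofReal ε * ∫⁻ y, ∫⁻ u, ENNReal.ofReal (Ψ u) ∂V y ∂Q :=
          lintegral_const_mul' _ _ ENNReal.ofReal_ne_top
      _ ≤ _ := mul_le_mul_right hVC _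
  refine ⟨?_, ?_⟩
  · obtain ⟨R, hR⟩ := hFΨ.exists_tail hq hΨ one_pos
    obtain ⟨K, hK0, hK⟩ := exists_bound_of_compactlySupported (truncate hΨ R F hF)
    refine MemLp.ae_eq ((hsplit R).mono fun y hy => hy.symm) (MemLp.add ?_ ⟨?_, ?_⟩)
    · exact MemLp.of_bound (stronglyMeasurable_expectation
        (truncate hΨ R F hF).continuous).aestronglyMeasurable K
        (Eventually.of_forall fun y => abs_expectation_le hK y)
    · exact (stronglyMeasurable_expectation (htailcont R)).aestronglyMeasurable
    · refine (htailV R 1 zero_le_one (hR R le_rfl)).trans_lt ?_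
      exact ENNReal.rpow_lt_top_of_nonneg (by positivity)
        (ENNReal.mul_ne_top ENNReal.ofReal_ne_top ENNReal.coe_ne_top)
  rw [ENNReal.tendsto_nhds_zero]
  intro δ hδ
  obtain ⟨r, hr0, hrδ⟩ := ENNReal.lt_iff_exists_nnreal_btwn.1 hδ
  have hr : (0 : ℝ) < r := by exact_mod_cast hr0
  -- Chosen so that each tail is at most `r / 3`; the `+ 1` avoids dividing by zero.
  set ε : ℝ := (r / 3) ^ q / (C + 1) with hεdef
  have hε : 0 < ε := by positivity
  have hsmall : (ENNReal.ofReal ε * C) ^ (1 / q) ≤ ENNReal.ofReal (r / 3) := by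
    have h1 : ENNReal.ofReal ε * C ≤ ENNReal.ofReal (r / 3) ^ q := by
      rw [ENNReal.ofReal_rpow_of_nonneg (by positivity) hq0.le, ← ENNReal.ofReal_coe_nnreal,
        ← ENNReal.ofReal_mul hε.le]
      refine ENNReal.ofReal_le_ofReal ?_
      rw [hεdef, div_mul_eq_mul_div, div_le_iff₀ (by positivity)]
      have : 0 ≤ ((r : ℝ) / 3) ^ q := by positivity
      nlinarith
    calc _ ≤ (ENNReal.ofReal (r / 3) ^ q) ^ (1 / q) := ENNReal.rpow_le_rpow h1 (by positivity)
      _ = _ := by rw [← ENNReal.rpow_mul, mul_one_div_cancel hq0.ne', ENNReal.rpow_one]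
  obtain ⟨R, hR⟩ := hFΨ.exists_tail hq hΨ hε
  have hR := hR R le_rfl
  have hB := (ENNReal.tendsto_nhds_zero.1 (hV.tendsto_eLpNorm_compactlySupported hw hU
    (truncate hΨ R F hF) hq)) (ENNReal.ofReal (r / 3)) (ENNReal.ofReal_pos.2 (by positivity))
  filter_upwards [hB] with N hN
  have hmeasT : ∀ n, AEStronglyMeasurable (fun y => F (U n y) * (1 - cutoffFun Ψ R (U n y))) Q :=
    fun n => aestronglyMeasurable_comp_state hU (htailcont R) n
  have hA : eLpNorm (fun y => weightedMean w N fun n => F (U n y) * (1 - cutoffFun Ψ R (U n y)))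
      (ENNReal.ofReal q) Q ≤ ENNReal.ofReal (r / 3) :=
    eLpNorm_weightedMean_le hw N hmeasT hq1 fun n =>
      (eLpNorm_ofReal_le hq (lintegral_comp_state_le hq0.le hε.le hR hC n)).trans hsmall
  have hD := (htailV R ε hε.le hR).trans hsmall
  have heq : (fun y => weightedMean w N (fun n => F (U n y)) - ∫ u, F u ∂V y) =ᵐ[Q]
      ((fun y => weightedMean w N fun n => F (U n y) * (1 - cutoffFun Ψ R (U n y)))
        + fun y => weightedMean w N (fun n => truncate hΨ R F hF (U n y))
          - ∫ u, truncate hΨ R F hF u ∂V y)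
        - fun y => ∫ u, F u * (1 - cutoffFun Ψ R u) ∂V y := by
    filter_upwards [hsplit R] with y hy
    have h3 : weightedMean w N (fun n => F (U n y))
        = weightedMean w N (fun n => F (U n y) * (1 - cutoffFun Ψ R (U n y)))
          + weightedMean w N (fun n => truncate hΨ R F hF (U n y)) := by
      rw [← weightedMean_add]
      congr 1
      ext n
      simp; ring
    simp only [Pi.sub_apply, Pi.add_apply]
    rw [hy, h3]
    ring
  have hm1 := aestronglyMeasurable_weightedMean (w := w) N hmeasT
  have hm2 := (integrable_weightedMean_comp hU (truncate hΨ R F hF) w N).1.sub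
    (integrable_expectation (V := V) (Q := Q) (truncate hΨ R F hF)).1
  have hm3 : AEStronglyMeasurable (fun y => ∫ u, F u * (1 - cutoffFun Ψ R u) ∂V y) Q :=
    (stronglyMeasurable_expectation (htailcont R)).aestronglyMeasurable
  rw [eLpNorm_congr_ae heq]
  calc _ ≤ ENNReal.ofReal (r / 3) + ENNReal.ofReal (r / 3) + ENNReal.ofReal (r / 3) :=
        (eLpNorm_sub_le (hm1.add hm2) hm3 hq1).trans
          (add_le_add ((eLpNorm_add_le hm1 hm2 hq1).trans (add_le_add hA hN)) hD)
    _ = r := by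
        rw [← ENNReal.ofReal_add (by positivity) (by positivity),
          ← ENNReal.ofReal_add (by positivity) (by positivity), ← ENNReal.ofReal_coe_nnreal]
        congr 1
        ring
    _ ≤ δ := hrδ.le

end Consequences

end EulerS

namespace EulerS

/-! ### Couplings -/

section Coupling

variable {X : Type*} [MeasurableSpace X]

theorem inv_max_mul_le_one (p q : ℝ≥0∞) : (max p q)⁻¹ * q ≤ 1 := by
  rcases eq_or_ne q 0 with rfl | h
  · simp
  calc (max p q)⁻¹ * q ≤ q⁻¹ * q := by gcongr; exact le_max_right _ _
    _ ≤ 1 := ENNReal.inv_mul_le_one q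

/-- In a cell with masses `p` and `q` this is the mass left unmatched on the `p` side; it vanishes
on the lighter side. -/
theorem one_sub_inv_max_mul_le {p q : ℝ≥0∞} (hp : p ≠ ⊤) (hq : q ≠ ⊤) :
    (1 - (max p q)⁻¹ * q) * p ≤ p - q := by
  rcases eq_or_ne p 0 with rfl | h0
  · simp
  rcases le_total p q with h | h
  · rw [max_eq_right h, ENNReal.inv_mul_cancel (fun h1 => h0 (le_antisymm (h1 ▸ h) bot_le)) hq]
    simp
  · rw [max_eq_left h, ENNReal.sub_mul (fun _ _ => hp), one_mul, mul_right_comm,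
      ENNReal.inv_mul_cancel h0 hp, one_mul]

theorem smul_add_one_sub_smul (μ : Measure X) {c : ℝ≥0∞} (hc : c ≤ 1) :
    c • μ + (1 - c) • μ = μ := by
  rw [← add_smul, add_tsub_cancel_of_le hc, one_smul]

theorem lintegral_prod_le_of_le_add (μ ν : Measure X) [IsFiniteMeasure μ] [IsFiniteMeasure ν]
    {c : X × X → ℝ≥0∞} {g : X → ℝ≥0∞} (hg : Measurable g)
    (hcg : ∀ z, c z ≤ g z.1 + g z.2) :
    ∫⁻ z, c z ∂μ.prod ν ≤ ν univ * ∫⁻ x, g x ∂μ + μ univ * ∫⁻ x, g x ∂ν := by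
  refine (lintegral_mono hcg).trans ?_
  rw [lintegral_add_left (f := fun z : X × X => g z.1) (hg.comp measurable_fst)]
  have h1 : ∫⁻ z, g z.1 ∂μ.prod ν = ν univ * ∫⁻ x, g x ∂μ := by
    rw [lintegral_prod (fun z : X × X => g z.1) (hg.comp measurable_fst).aemeasurable]
    simp only [lintegral_const]
    rw [lintegral_mul_const _ hg, mul_comm]
  have h2 : ∫⁻ z, g z.2 ∂μ.prod ν = μ univ * ∫⁻ x, g x ∂ν := by
    rw [lintegral_prod (fun z : X × X => g z.2) (hg.comp measurable_snd).aemeasurable]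
    simp only [lintegral_const, mul_comm]
  rw [h1, h2]

/-- In each cell the product `α i × β i` divided by the larger of the two masses matches the common
mass `min (α i univ) (β i univ)`. The unmatched remainders have equal total mass because `∑ α i` and
`∑ β i` do, and are coupled by their normalised product, whose cost is paid through `g`. -/
theorem exists_coupling {ι : Type*} [Fintype ι] (α β : ι → Measure X) [∀ i, IsFiniteMeasure (α i)]
    [∀ i, IsFiniteMeasure (β i)] (hmass : ∑ i, α i univ = ∑ i, β i univ)
    {c : X × X → ℝ≥0∞} {g : X → ℝ≥0∞} (hg : Measurable g)
    (hcg : ∀ z, c z ≤ g z.1 + g z.2) :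
    ∃ π : Measure (X × X), π.map Prod.fst = ∑ i, α i ∧ π.map Prod.snd = ∑ i, β i ∧
      ∫⁻ z, c z ∂π ≤ ∑ i, (max (α i univ) (β i univ))⁻¹ * ∫⁻ z, c z ∂(α i).prod (β i)
        + (∑ i, (1 - (max (α i univ) (β i univ))⁻¹ * β i univ) * ∫⁻ x, g x ∂α i
          + ∑ i, (1 - (max (α i univ) (β i univ))⁻¹ * α i univ) * ∫⁻ x, g x ∂β i) := by
  set M : ι → ℝ≥0∞ := fun i => (max (α i univ) (β i univ))⁻¹ with hM
  have hMβ : ∀ i, M i * β i univ ≤ 1 := fun i => inv_max_mul_le_one _ _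
  have hMα : ∀ i, M i * α i univ ≤ 1 := fun i => by
    simp only [hM]; rw [max_comm]; exact inv_max_mul_le_one _ _
  set α' : Measure X := ∑ i, (1 - M i * β i univ) • α i with hα'
  set β' : Measure X := ∑ i, (1 - M i * α i univ) • β i with hβ'
  have hα'u : α' univ + ∑ i, M i * β i univ * α i univ = ∑ i, α i univ := by
    simp only [hα', Measure.finsetSum_apply, Measure.smul_apply, smul_eq_mul,
      ← Finset.sum_add_distrib]
    refine Finset.sum_congr rfl fun i _ => ?_
    rw [← add_mul, tsub_add_cancel_of_le (hMβ i), one_mul]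
  have hβ'u : β' univ + ∑ i, M i * β i univ * α i univ = ∑ i, β i univ := by
    simp only [hβ', Measure.finsetSum_apply, Measure.smul_apply, smul_eq_mul,
      ← Finset.sum_add_distrib]
    refine Finset.sum_congr rfl fun i _ => ?_
    rw [mul_right_comm, ← add_mul, tsub_add_cancel_of_le (hMα i), one_mul]
  have hfin : ∑ i, α i univ ≠ ⊤ := ENNReal.sum_ne_top.2 fun i _ => measure_ne_top _ _
  have hmid : ∑ i, M i * β i univ * α i univ ≠ ⊤ :=
    ne_top_of_le_ne_top hfin (hα'u ▸ le_add_self)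
  have hαtop : α' univ ≠ ⊤ := ne_top_of_le_ne_top hfin (hα'u ▸ le_self_add)
  have heq : α' univ = β' univ := by
    rw [← hβ'u, ← hα'u] at hmass
    exact (ENNReal.add_left_inj hmid).1 hmass
  have : IsFiniteMeasure α' := ⟨hαtop.lt_top⟩
  have : IsFiniteMeasure β' := ⟨heq ▸ hαtop.lt_top⟩
  -- If nothing is left over, the remainder is the zero measure, and the infinite factor `0⁻¹` does
  -- no harm.
  have hrest : ∀ ν : Measure X, ν univ = α' univ → ((α' univ)⁻¹ * α' univ) • ν = ν := by
    intro ν hν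
    rcases eq_or_ne (α' univ) 0 with h0 | h0
    · rw [Measure.measure_univ_eq_zero.1 (hν.trans h0), smul_zero]
    · rw [ENNReal.inv_mul_cancel h0 hαtop, one_smul]
  refine ⟨∑ i, M i • (α i).prod (β i) + (α' univ)⁻¹ • α'.prod β', ?_, ?_, ?_⟩
  · rw [Measure.map_add _ _ measurable_fst, Measure.map_smul, Measure.map_fst_prod, smul_smul,
      ← heq, hrest α' rfl, hα', Measure.map_finset_sum' measurable_fst.aemeasurable,
      ← Finset.sum_add_distrib]
    refine Finset.sum_congr rfl fun i _ => ?_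
    rw [Measure.map_smul, Measure.map_fst_prod, smul_smul, smul_add_one_sub_smul _ (hMβ i)]
  · rw [Measure.map_add _ _ measurable_snd, Measure.map_smul, Measure.map_snd_prod, smul_smul,
      hrest β' heq.symm, hβ', Measure.map_finset_sum' measurable_snd.aemeasurable,
      ← Finset.sum_add_distrib]
    refine Finset.sum_congr rfl fun i _ => ?_
    rw [Measure.map_smul, Measure.map_snd_prod, smul_smul, smul_add_one_sub_smul _ (hMα i)]
  · rw [lintegral_add_measure, lintegral_finsetSum_measure, lintegral_smul_measure]
    simp only [lintegral_smul_measure, smul_eq_mul]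
    refine add_le_add le_rfl ?_
    have h1 : ∫⁻ x, g x ∂α' = ∑ i, (1 - M i * β i univ) * ∫⁻ x, g x ∂α i := by
      rw [hα', lintegral_finsetSum_measure]
      simp only [lintegral_smul_measure, smul_eq_mul]
    have h2 : ∫⁻ x, g x ∂β' = ∑ i, (1 - M i * α i univ) * ∫⁻ x, g x ∂β i := by
      rw [hβ', lintegral_finsetSum_measure]
      simp only [lintegral_smul_measure, smul_eq_mul]
    rw [← h1, ← h2]
    calc (α' univ)⁻¹ * ∫⁻ z, c z ∂α'.prod β'
        ≤ (α' univ)⁻¹ * (α' univ * ∫⁻ x, g x ∂α' + α' univ * ∫⁻ x, g x ∂β') := by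
          refine mul_le_mul_right ?_ _
          have := lintegral_prod_le_of_le_add α' β' hg hcg
          rwa [← heq] at this
      _ = (α' univ)⁻¹ * α' univ * (∫⁻ x, g x ∂α' + ∫⁻ x, g x ∂β') := by ring
      _ ≤ 1 * (∫⁻ x, g x ∂α' + ∫⁻ x, g x ∂β') :=
          mul_le_mul_left (ENNReal.inv_mul_le_one _) _
      _ = _ := one_mul _

end Coupling

/-! ### Partitions of unity with small supports -/

section PartitionOfUnity

variable {E : Type*} [PseudoMetricSpace E] [T2Space E] {Ψ : E → ℝ}

/-- A cutoff function is a finite sum of bumps of small support. -/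
theorem exists_partition (hΨ : IsGrowth Ψ) (S : ℝ) {η : ℝ} (hη : 0 < η) :
    ∃ (t : Finset E) (b : E → C_c(E, ℝ)), (∀ k u, 0 ≤ b k u) ∧
      (∀ u, ∑ k ∈ t, b k u = cutoffFun Ψ S u) ∧
      ∀ k u v, b k u ≠ 0 → b k v ≠ 0 → dist u v ≤ η := by
  obtain ⟨t, -, htfin, hcov⟩ :=
    (hΨ.exists_isCompact (S + 1)).finite_cover_balls (e := η / 4) (by positivity)
  set tent : E → E → ℝ := fun k u => max 0 (η / 2 - dist u k) with htent
  have htent0 : ∀ k u, 0 ≤ tent k u := fun k u => le_max_left _ _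
  -- The floor `η / 4` keeps the denominator positive everywhere. It is inactive where the cutoff is
  -- non-zero, since there some centre is within `η / 4` and its tent alone has height at least `η /
  -- 4`.
  set D : E → ℝ := fun u => max (η / 4) (∑ k ∈ htfin.toFinset, tent k u) with hD
  have hDpos : ∀ u, 0 < D u := fun u => lt_max_of_lt_left (by positivity)
  have hcont : ∀ k, Continuous fun u => tent k u / D u := fun k =>
    Continuous.div₀ (by simp only [htent]; fun_prop) (by simp only [hD, htent]; fun_prop)
      fun u => (hDpos u).ne'
  refine ⟨htfin.toFinset, fun k => truncate hΨ S (fun u => tent k u / D u) (hcont k), ?_, ?_, ?_⟩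
  · intro k u
    exact mul_nonneg (div_nonneg (htent0 k u) (hDpos u).le) (cutoffFun_nonneg _ _)
  · intro u
    simp only [truncate_apply, ← Finset.sum_mul, ← Finset.sum_div]
    rcases le_total (S + 1) (Ψ u) with h | h
    · rw [cutoffFun_eq_zero h, mul_zero]
    · obtain ⟨k, hk, huk⟩ := mem_iUnion₂.1 (hcov h)
      have h1 : η / 4 ≤ ∑ k ∈ htfin.toFinset, tent k u := by
        refine le_trans ?_ (Finset.single_le_sum (f := fun k => tent k u)
          (fun k _ => htent0 k u) (htfin.mem_toFinset.2 hk))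
        refine le_max_of_le_right ?_
        have := Metric.mem_ball.1 huk
        linarith
      have h2 : D u = ∑ k ∈ htfin.toFinset, tent k u := max_eq_right h1
      rw [← h2, div_self (hDpos u).ne', one_mul]
  · intro k u v hu hv
    have key : ∀ u, truncate hΨ S (fun u => tent k u / D u) (hcont k) u ≠ 0 → dist u k ≤ η / 2 := by
      intro u hu
      by_contra! hcon
      refine hu ?_
      rw [truncate_apply, htent]
      simp only
      rw [max_eq_left (by linarith), zero_div, zero_mul]
    calc dist u v ≤ dist u k + dist v k := dist_triangle_right _ _ _
      _ ≤ η / 2 + η / 2 := add_le_add (key u hu) (key v hv)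
      _ = η := by ring

end PartitionOfUnity

end EulerS

namespace EulerS

/-! ### Convergence in Wasserstein distance -/

section Wasserstein

variable {E : Type*} [NormedAddCommGroup E] [ProperSpace E] [MeasurableSpace E] [BorelSpace E]
  {Ψ : E → ℝ}

theorem wassersteinDist_rpow_le {s : ℝ} (hs : 0 < s) {μ ν : Measure E} {π : Measure (E × E)}
    (h1 : π.map Prod.fst = μ) (h2 : π.map Prod.snd = ν) :
    wassersteinDist s μ ν ^ s ≤ ∫⁻ z, edist z.1 z.2 ^ s ∂π := by
  rw [wassersteinDist, ← ENNReal.rpow_mul, one_div_mul_cancel hs.ne', ENNReal.rpow_one]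
  exact iInf_le_of_le π (iInf_le_of_le h1 (iInf_le_of_le h2 le_rfl))

/-- The weight `2^(s-1) |u|^s` controlling the transport cost. -/
noncomputable def transportWeight (s : ℝ) (u : E) : ℝ≥0∞ := 2 ^ (s - 1) * ‖u‖ₑ ^ s

theorem measurable_transportWeight (s : ℝ) : Measurable (transportWeight (E := E) s) :=
  (measurable_enorm.pow_const s).const_mul _

theorem edist_rpow_le {s : ℝ} (hs : 1 ≤ s) (z : E × E) :
    edist z.1 z.2 ^ s ≤ transportWeight s z.1 + transportWeight s z.2 := by
  rw [transportWeight, transportWeight, ← mul_add]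
  refine le_trans (ENNReal.rpow_le_rpow ?_ (by linarith)) (ENNReal.rpow_add_le_mul_rpow_add_rpow _ _ hs)
  rw [edist_eq_enorm_sub]
  exact enorm_sub_le

/-- The part of `μ` with density `b`. -/
noncomputable def part (μ : Measure E) (b : E → ℝ) : Measure E :=
  μ.withDensity fun u => ENNReal.ofReal (b u)

theorem part_univ (μ : Measure E) [IsFiniteMeasure μ] (b : C_c(E, ℝ)) (hb : ∀ u, 0 ≤ b u) :
    part μ b univ = ENNReal.ofReal (∫ u, b u ∂μ) := by
  rw [part, withDensity_apply _ MeasurableSet.univ, Measure.restrict_univ,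
    ofReal_integral_eq_lintegral_ofReal b.integrable (Eventually.of_forall hb)]

theorem lintegral_part (μ : Measure E) {b : E → ℝ} (hb : Continuous b) {g : E → ℝ≥0∞}
    (hg : Measurable g) : ∫⁻ u, g u ∂part μ b = ∫⁻ u, ENNReal.ofReal (b u) * g u ∂μ :=
  lintegral_withDensity_eq_lintegral_mul _ hb.measurable.ennreal_ofReal hg

theorem part_le {μ : Measure E} {b : E → ℝ} (hb : ∀ u, b u ≤ 1) : part μ b ≤ μ := by
  calc part μ b ≤ μ.withDensity 1 := withDensity_mono (Eventually.of_forall fun u => by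
        simpa using hb u)
    _ = μ := withDensity_one

theorem ae_part_ne_zero (μ : Measure E) {b : E → ℝ} (hb : Continuous b) :
    ∀ᵐ u ∂part μ b, b u ≠ 0 := by
  rw [part, ae_withDensity_iff hb.measurable.ennreal_ofReal]
  exact Eventually.of_forall fun u hu h => hu (by rw [h, ENNReal.ofReal_zero])

/-- Apply `exists_coupling` to the pieces of `μ` and `ν` cut out by the `b k` and by the tail `1 -
cutoff`. Mass matched inside a bump moves at most `η`; mass unmatched in a bump costs at most `G`
per unit on either side, and its total is governed by the differences of the integrals of `b k`. -/
theorem wassersteinDist_rpow_le_partition {s : ℝ} (hs : 1 ≤ s) (hΨ : IsGrowth Ψ) (S : ℝ) {η : ℝ}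
    {t : Finset E} {b : E → C_c(E, ℝ)} (hb0 : ∀ k u, 0 ≤ b k u)
    (hsum : ∀ u, ∑ k ∈ t, b k u = cutoffFun Ψ S u)
    (hdist : ∀ k u v, b k u ≠ 0 → b k v ≠ 0 → dist u v ≤ η)
    {G : ℝ≥0∞} (hG : ∀ u, Ψ u ≤ S + 1 → transportWeight s u ≤ G)
    (μ ν : Measure E) [IsProbabilityMeasure μ] [IsProbabilityMeasure ν] :
    wassersteinDist s μ ν ^ s ≤ ENNReal.ofReal η ^ s
      + 2 * (∫⁻ u, ENNReal.ofReal (1 - cutoffFun Ψ S u) * transportWeight s u ∂μ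
        + ∫⁻ u, ENNReal.ofReal (1 - cutoffFun Ψ S u) * transportWeight s u ∂ν)
      + G * ∑ k ∈ t, ENNReal.ofReal |∫ u, b k u ∂μ - ∫ u, b k u ∂ν| := by
  set g := transportWeight (E := E) s with hg
  have hgm : Measurable g := measurable_transportWeight s
  set b₀ : E → ℝ := fun u => 1 - cutoffFun Ψ S u with hb₀
  have hb₀c : Continuous b₀ := continuous_const.sub (hΨ.continuous_cutoffFun S)
  have hb₀0 : ∀ u, 0 ≤ b₀ u := fun u => sub_nonneg.2 (cutoffFun_le_one _ _)
  -- The index `none` is the cell at infinity, which completes the bumps to a partition of unity on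
  -- the whole space.
  set B : Option t → E → ℝ := fun i => i.elim b₀ fun k => b k with hB
  have hBc : ∀ i, Continuous (B i) := by
    rintro (_ | k)
    · exact hb₀c
    · exact (b k).continuous
  have hB0 : ∀ i u, 0 ≤ B i u := by
    rintro (_ | k) u
    · exact hb₀0 u
    · exact hb0 k u
  have hBsum : ∀ u, ∑ i, B i u = 1 := by
    intro u
    rw [Fintype.sum_option]
    simp only [hB, Option.elim]
    rw [Finset.sum_coe_sort t (fun k => b k u), hsum, hb₀]
    ring
  have hB1 : ∀ i u, B i u ≤ 1 := fun i u => by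
    rw [← hBsum u]
    exact Finset.single_le_sum (f := fun i => B i u) (fun i _ => hB0 i u) (Finset.mem_univ i)
  have hdecomp : ∀ ρ : Measure E, ∑ i, part ρ (B i) = ρ := by
    intro ρ
    ext A hA
    rw [Measure.finsetSum_apply]
    simp only [part, withDensity_apply _ hA]
    rw [← lintegral_finsetSum _ fun i _ => (hBc i).measurable.ennreal_ofReal]
    simp only [← ENNReal.ofReal_sum_of_nonneg fun i _ => hB0 i _, hBsum]
    simp
  have hfin : ∀ (ρ : Measure E) [IsFiniteMeasure ρ] i, IsFiniteMeasure (part ρ (B i)) :=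
    fun ρ _ i => isFiniteMeasure_of_le ρ (part_le (hB1 i))
  have hmass : ∀ (ρ : Measure E) [IsProbabilityMeasure ρ], ∑ i, part ρ (B i) univ = 1 := by
    intro ρ _
    rw [← Measure.finsetSum_apply, hdecomp, measure_univ]
  have := hfin μ
  have := hfin ν
  obtain ⟨π, hπ1, hπ2, hπ⟩ := exists_coupling (fun i => part μ (B i)) (fun i => part ν (B i))
    ((hmass μ).trans (hmass ν).symm) hgm (c := fun z => edist z.1 z.2 ^ s) (edist_rpow_le hs)
  rw [hdecomp] at hπ1 hπ2
  refine (wassersteinDist_rpow_le (by linarith) hπ1 hπ2).trans (hπ.trans ?_)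
  have htop : ∀ (ρ : Measure E) [IsFiniteMeasure ρ] i, part ρ (B i) univ ≠ ⊤ := fun ρ _ i =>
    have := hfin ρ i
    measure_ne_top _ _
  have hsome : ∀ (ρ : Measure E) [IsFiniteMeasure ρ] (k : t),
      part ρ (B (some k)) univ = ENNReal.ofReal (∫ u, b k u ∂ρ) :=
    fun ρ _ k => part_univ ρ (b k) (hb0 k)
  have hgsome : ∀ (ρ : Measure E) [IsFiniteMeasure ρ] (k : t),
      ∫⁻ u, g u ∂part ρ (B (some k)) ≤ part ρ (B (some k)) univ * G := by
    intro ρ _ k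
    rw [mul_comm, ← lintegral_const]
    refine lintegral_mono_ae ?_
    filter_upwards [ae_part_ne_zero ρ (hBc (some k))] with u hu
    refine hG u ?_
    by_contra! hcon
    have h1 := hsum u
    rw [cutoffFun_eq_zero hcon.le, Finset.sum_eq_zero_iff_of_nonneg fun k _ => hb0 k u] at h1
    exact hu (h1 k k.2)
  rw [Fintype.sum_option, Fintype.sum_option, Fintype.sum_option]
  -- The tail cell is not small, so its matched mass is also charged to the transport weight.
  -- Together with its unmatched mass this produces the factor `2` in the bound.
  have hnone : (max (part μ (B none) univ) (part ν (B none) univ))⁻¹ *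
      ∫⁻ z, edist z.1 z.2 ^ s ∂(part μ (B none)).prod (part ν (B none))
      ≤ ∫⁻ u, g u ∂part μ (B none) + ∫⁻ u, g u ∂part ν (B none) := by
    calc _ ≤ (max (part μ (B none) univ) (part ν (B none) univ))⁻¹ *
          (part ν (B none) univ * ∫⁻ u, g u ∂part μ (B none)
            + part μ (B none) univ * ∫⁻ u, g u ∂part ν (B none)) :=
          mul_le_mul_right (lintegral_prod_le_of_le_add _ _ hgm (edist_rpow_le hs)) _
      _ = (max (part μ (B none) univ) (part ν (B none) univ))⁻¹ * part ν (B none) univ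
            * ∫⁻ u, g u ∂part μ (B none)
          + (max (part ν (B none) univ) (part μ (B none) univ))⁻¹ * part μ (B none) univ
            * ∫⁻ u, g u ∂part ν (B none) := by
          rw [max_comm (part ν (B none) univ)]; ring
      _ ≤ 1 * ∫⁻ u, g u ∂part μ (B none) + 1 * ∫⁻ u, g u ∂part ν (B none) :=
          add_le_add (mul_le_mul_left (inv_max_mul_le_one _ _) _)
            (mul_le_mul_left (inv_max_mul_le_one _ _) _)
      _ = _ := by rw [one_mul, one_mul]
  have hgood : ∀ k : t, (max (part μ (B (some k)) univ) (part ν (B (some k)) univ))⁻¹ *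
      ∫⁻ z, edist z.1 z.2 ^ s ∂(part μ (B (some k))).prod (part ν (B (some k)))
      ≤ ENNReal.ofReal η ^ s * part μ (B (some k)) univ := by
    intro k
    have h1 : ∫⁻ z, edist z.1 z.2 ^ s ∂(part μ (B (some k))).prod (part ν (B (some k)))
        ≤ ENNReal.ofReal η ^ s * (part μ (B (some k)) univ * part ν (B (some k)) univ) := by
      rw [← Measure.prod_prod, univ_prod_univ, ← lintegral_const]
      refine lintegral_mono_ae ?_
      have h2 := ae_part_ne_zero μ (hBc (some k))
      have h3 := ae_part_ne_zero ν (hBc (some k))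
      filter_upwards [Measure.quasiMeasurePreserving_fst.ae h2,
        Measure.quasiMeasurePreserving_snd.ae h3] with z hz1 hz2
      refine ENNReal.rpow_le_rpow ?_ (by linarith)
      rw [edist_dist]
      exact ENNReal.ofReal_le_ofReal (hdist k _ _ hz1 hz2)
    calc _ ≤ (max (part μ (B (some k)) univ) (part ν (B (some k)) univ))⁻¹ *
          (ENNReal.ofReal η ^ s * (part μ (B (some k)) univ * part ν (B (some k)) univ)) :=
          mul_le_mul_right h1 _
      _ = ((max (part μ (B (some k)) univ) (part ν (B (some k)) univ))⁻¹
            * part ν (B (some k)) univ) * (ENNReal.ofReal η ^ s * part μ (B (some k)) univ) := by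
          ring
      _ ≤ 1 * _ := mul_le_mul_left (inv_max_mul_le_one _ _) _
      _ = _ := one_mul _
  have hrem1 : ∀ k : t, (1 - (max (part μ (B (some k)) univ) (part ν (B (some k)) univ))⁻¹ *
      part ν (B (some k)) univ) * ∫⁻ u, g u ∂part μ (B (some k))
      ≤ (part μ (B (some k)) univ - part ν (B (some k)) univ) * G := by
    intro k
    refine (mul_le_mul_right (hgsome μ k) _).trans ?_
    rw [← mul_assoc]
    exact mul_le_mul_left (one_sub_inv_max_mul_le (htop μ _) (htop ν _)) _
  have hrem2 : ∀ k : t, (1 - (max (part μ (B (some k)) univ) (part ν (B (some k)) univ))⁻¹ *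
      part μ (B (some k)) univ) * ∫⁻ u, g u ∂part ν (B (some k))
      ≤ (part ν (B (some k)) univ - part μ (B (some k)) univ) * G := by
    intro k
    refine (mul_le_mul_right (hgsome ν k) _).trans ?_
    rw [← mul_assoc, max_comm]
    exact mul_le_mul_left (one_sub_inv_max_mul_le (htop ν _) (htop μ _)) _
  have habs : ∀ k : t, (part μ (B (some k)) univ - part ν (B (some k)) univ)
      + (part ν (B (some k)) univ - part μ (B (some k)) univ)
      ≤ ENNReal.ofReal |∫ u, b k u ∂μ - ∫ u, b k u ∂ν| := by
    intro k
    rw [hsome, hsome]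
    have h1 : 0 ≤ ∫ u, b k u ∂μ := integral_nonneg (hb0 k)
    have h2 : 0 ≤ ∫ u, b k u ∂ν := integral_nonneg (hb0 k)
    rw [← ENNReal.ofReal_sub _ h1, ← ENNReal.ofReal_sub _ h2]
    rcases le_total (∫ u, b k u ∂μ) (∫ u, b k u ∂ν) with h | h
    · rw [ENNReal.ofReal_of_nonpos (sub_nonpos.2 h), zero_add, abs_sub_comm,
        abs_of_nonneg (sub_nonneg.2 h)]
    · rw [ENNReal.ofReal_of_nonpos (sub_nonpos.2 h), add_zero, abs_of_nonneg (sub_nonneg.2 h)]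
  have hsumgood : ∑ k : t, ENNReal.ofReal η ^ s * part μ (B (some k)) univ
      ≤ ENNReal.ofReal η ^ s := by
    rw [← Finset.mul_sum]
    refine mul_le_of_le_one_right' ?_
    have := hmass μ
    rw [Fintype.sum_option] at this
    exact le_of_le_of_eq le_add_self this
  have e0 : ∀ ρ : Measure E, ∫⁻ u, g u ∂part ρ (B none)
      = ∫⁻ u, ENNReal.ofReal (b₀ u) * g u ∂ρ := fun ρ => lintegral_part ρ hb₀c hgm
  have hle1 : ∀ a : ℝ≥0∞, 1 - a ≤ 1 := fun a => tsub_le_self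
  rw [e0, e0] at hnone ⊢
  calc _ ≤ ((∫⁻ u, ENNReal.ofReal (b₀ u) * g u ∂μ + ∫⁻ u, ENNReal.ofReal (b₀ u) * g u ∂ν)
        + ENNReal.ofReal η ^ s)
      + ((1 * ∫⁻ u, ENNReal.ofReal (b₀ u) * g u ∂μ
          + ∑ k : t, (part μ (B (some k)) univ - part ν (B (some k)) univ) * G)
        + (1 * ∫⁻ u, ENNReal.ofReal (b₀ u) * g u ∂ν
          + ∑ k : t, (part ν (B (some k)) univ - part μ (B (some k)) univ) * G)) :=
        add_le_add (add_le_add hnone ((Finset.sum_le_sum fun k _ => hgood k).trans hsumgood))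
          (add_le_add
            (add_le_add (mul_le_mul_left (hle1 _) _) (Finset.sum_le_sum fun k _ => hrem1 k))
            (add_le_add (mul_le_mul_left (hle1 _) _) (Finset.sum_le_sum fun k _ => hrem2 k)))
    _ = ENNReal.ofReal η ^ s + 2 * (∫⁻ u, ENNReal.ofReal (b₀ u) * g u ∂μ
          + ∫⁻ u, ENNReal.ofReal (b₀ u) * g u ∂ν)
        + G * ∑ k : t, ((part μ (B (some k)) univ - part ν (B (some k)) univ)
          + (part ν (B (some k)) univ - part μ (B (some k)) univ)) := by
        rw [Finset.sum_add_distrib, ← Finset.sum_mul, ← Finset.sum_mul]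
        ring
    _ ≤ _ := by
        gcongr
        rw [← Finset.sum_coe_sort t]
        exact Finset.sum_le_sum fun k _ => habs k

end Wasserstein

end EulerS

namespace EulerS

/-! ### From convergence of means to convergence of empirical measures in Wasserstein distance -/

section WassersteinLimit

variable {Y E : Type*} [TopologicalSpace Y] [PolishSpace Y] [LocallyCompactSpace Y]
  [MeasurableSpace Y] [BorelSpace Y] [NormedAddCommGroup E] [ProperSpace E]
  [MeasurableSpace E] [BorelSpace E]
  {Q : Measure Y} [IsFiniteMeasure Q] {U : ℕ → Y → E} {Ψ : E → ℝ} {C : ℝ≥0} {w : ℝ → ℝ}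
  {V : Kernel Y E} [IsMarkovKernel V]

theorem weightedEmpirical_eq (w : ℝ → ℝ) (N : ℕ) (x : ℕ → E) :
    weightedEmpirical w N x
      = ∑ n ∈ Finset.range N, ENNReal.ofReal (coeff w N n) • Measure.dirac (x n) := rfl

theorem lintegral_weightedEmpirical (w : ℝ → ℝ) (N : ℕ) (x : ℕ → E) (f : E → ℝ≥0∞) :
    ∫⁻ u, f u ∂weightedEmpirical w N x
      = ∑ n ∈ Finset.range N, ENNReal.ofReal (coeff w N n) * f (x n) := by
  rw [weightedEmpirical_eq, lintegral_finsetSum_measure]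
  simp [lintegral_smul_measure]

theorem isProbabilityMeasure_weightedEmpirical (hw : IsAveraging w) {N : ℕ}
    (hN : 0 < weightSum w N) (x : ℕ → E) : IsProbabilityMeasure (weightedEmpirical w N x) := by
  constructor
  rw [← lintegral_one, lintegral_weightedEmpirical]
  simp only [mul_one]
  rw [← ENNReal.ofReal_sum_of_nonneg fun n hn => coeff_nonneg hw hn, sum_coeff hN,
    ENNReal.ofReal_one]

theorem integral_weightedEmpirical (hw : IsAveraging w) (N : ℕ) (x : ℕ → E) (b : E → ℝ) :
    ∫ u, b u ∂weightedEmpirical w N x = weightedMean w N fun n => b (x n) := by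
  rw [weightedEmpirical_eq, integral_finsetSum_measure, weightedMean_eq_sum]
  · refine Finset.sum_congr rfl fun n hn => ?_
    rw [integral_smul_measure, integral_dirac, ENNReal.toReal_ofReal (coeff_nonneg hw hn)]
  · intro n _
    exact (integrable_dirac (by simp)).smul_measure ENNReal.ofReal_ne_top

/-- The parameters are fixed in the order mesh `η`, cutoff level `S`, finite partition; only then
does `N → ∞`, which kills the finite sum of `L¹` errors. The tail is uniformly small in `N` because
`‖u‖^s` is of lower order than `Ψ`. -/
theorem MeansTendsto.tendsto_wassersteinDist (hw : IsAveraging w)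
    (hU : ∀ n, AEMeasurable (U n) Q) (hΨ : IsGrowth Ψ)
    (hC : ∀ n, ∫⁻ y, ENNReal.ofReal (Ψ (U n y)) ∂Q ≤ C) (hV : MeansTendsto Q w U V)
    {s : ℝ} (hs : 1 ≤ s) (hsmall : IsSmallGrowth Ψ (fun u => ‖u‖) s) :
    Tendsto (fun N => ∫⁻ y, wassersteinDist s (weightedEmpirical w N fun n => U n y) (V y) ^ s ∂Q)
      atTop (𝓝 0) := by
  have hs0 : 0 < s := by linarith
  have hVC := hV.lintegral_growth_le hw hU hΨ hC
  rw [ENNReal.tendsto_nhds_zero]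
  intro δ hδ
  obtain ⟨r, hr0, hrδ⟩ := ENNReal.lt_iff_exists_nnreal_btwn.1 hδ
  have hr : (0 : ℝ) < r := by exact_mod_cast hr0
  set A : ℝ := Q.real univ with hA
  have hA0 : 0 ≤ A := measureReal_nonneg
  -- Makes `η ^ s * Q univ` at most `r / 3`.
  set η : ℝ := (r / (3 * (A + 1))) ^ (1 / s) with hη
  have hη0 : 0 < η := by positivity
  set P : ℝ := 2 ^ (s - 1) with hP
  have hP0 : 0 < P := by positivity
  -- The two tail terms enter as `2 * (κ + κ) = 4 * P * ε * C`, which this choice bounds by `r / 3`.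
  set ε : ℝ := r / (3 * (4 * P) * (C + 1)) with hε
  have hε0 : 0 < ε := by positivity
  obtain ⟨S, hS⟩ := hsmall ε hε0
  obtain ⟨t, b, hb0, hbsum, hbdist⟩ := exists_partition hΨ S hη0
  obtain ⟨ρ, hρ⟩ : ∃ ρ : ℝ, ∀ u, Ψ u ≤ S + 1 → ‖u‖ ≤ ρ := by
    obtain ⟨ρ, hρ⟩ := (hΨ.exists_isCompact (S + 1)).isBounded.exists_norm_le
    exact ⟨ρ, fun u hu => hρ u hu⟩
  set G : ℝ≥0∞ := 2 ^ (s - 1) * ENNReal.ofReal ρ ^ s with hG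
  have hGtop : G ≠ ⊤ := ENNReal.mul_ne_top
    (ENNReal.rpow_ne_top_of_nonneg (by linarith) (by norm_num))
    (ENNReal.rpow_ne_top_of_nonneg hs0.le ENNReal.ofReal_ne_top)
  have hGle : ∀ u, Ψ u ≤ S + 1 → transportWeight s u ≤ G := by
    intro u hu
    refine mul_le_mul_right (ENNReal.rpow_le_rpow ?_ hs0.le) _
    rw [← ofReal_norm]
    exact ENNReal.ofReal_le_ofReal (hρ u hu)
  set h : E → ℝ≥0∞ := fun u => ENNReal.ofReal (1 - cutoffFun Ψ S u) * transportWeight s u with hh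
  have hhm : Measurable h :=
    (continuous_const.sub (hΨ.continuous_cutoffFun S)).measurable.ennreal_ofReal.mul
      (measurable_transportWeight s)
  have hhle : ∀ u, h u ≤ ENNReal.ofReal (P * ε) * ENNReal.ofReal (Ψ u) := by
    intro u
    rcases le_total (Ψ u) S with hu | hu
    · simp [hh, cutoffFun_eq_one hu]
    · calc h u ≤ 1 * transportWeight s u := by
            refine mul_le_mul_left (ENNReal.ofReal_le_one.2 ?_) _
            linarith [cutoffFun_nonneg (Ψ := Ψ) S u]
        _ = ENNReal.ofReal (P * ‖u‖ ^ s) := by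
            rw [one_mul, transportWeight, ENNReal.ofReal_mul hP0.le, hP,
              ← ENNReal.ofReal_rpow_of_pos two_pos, ← ofReal_norm,
              ENNReal.ofReal_rpow_of_nonneg (norm_nonneg _) hs0.le]
            simp
        _ ≤ ENNReal.ofReal (P * (ε * Ψ u)) := by
            refine ENNReal.ofReal_le_ofReal (mul_le_mul_of_nonneg_left ?_ hP0.le)
            simpa using hS u hu
        _ = _ := by rw [← mul_assoc, ENNReal.ofReal_mul (by positivity)]
  set κ : ℝ≥0∞ := ENNReal.ofReal (P * ε) * C with hκ
  have hhUm : ∀ n, AEMeasurable (fun y => h (U n y)) Q := fun n => hhm.comp_aemeasurable (hU n)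
  have hhU : ∀ n, ∫⁻ y, h (U n y) ∂Q ≤ κ := fun n => by
    calc _ ≤ ∫⁻ y, ENNReal.ofReal (P * ε) * ENNReal.ofReal (Ψ (U n y)) ∂Q :=
          lintegral_mono fun y => hhle _
      _ = ENNReal.ofReal (P * ε) * ∫⁻ y, ENNReal.ofReal (Ψ (U n y)) ∂Q :=
          lintegral_const_mul' _ _ ENNReal.ofReal_ne_top
      _ ≤ _ := mul_le_mul_right (hC n) _
  have hhV : ∫⁻ y, ∫⁻ u, h u ∂V y ∂Q ≤ κ := by
    calc _ ≤ ∫⁻ y, ENNReal.ofReal (P * ε) * ∫⁻ u, ENNReal.ofReal (Ψ u) ∂V y ∂Q :=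
          lintegral_mono fun y => by
            rw [← lintegral_const_mul' _ _ ENNReal.ofReal_ne_top]
            exact lintegral_mono fun u => hhle u
      _ = ENNReal.ofReal (P * ε) * ∫⁻ y, ∫⁻ u, ENNReal.ofReal (Ψ u) ∂V y ∂Q :=
          lintegral_const_mul' _ _ ENNReal.ofReal_ne_top
      _ ≤ _ := mul_le_mul_right hVC _
  have hemp : ∀ N, ∫⁻ y, ∫⁻ u, h u ∂(weightedEmpirical w N fun n => U n y) ∂Q ≤ κ := by
    intro N
    simp only [lintegral_weightedEmpirical]
    rw [lintegral_finsetSum' _ fun n _ => (hhUm n).const_mul _]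
    calc _ ≤ ∑ n ∈ Finset.range N, ENNReal.ofReal (coeff w N n) * κ := by
          refine Finset.sum_le_sum fun n _ => ?_
          rw [lintegral_const_mul' _ _ ENNReal.ofReal_ne_top]
          exact mul_le_mul_right (hhU n) _
      _ = ENNReal.ofReal (∑ n ∈ Finset.range N, coeff w N n) * κ := by
          rw [ENNReal.ofReal_sum_of_nonneg fun n hn => coeff_nonneg hw hn, Finset.sum_mul]
      _ ≤ 1 * κ := mul_le_mul_left (ENNReal.ofReal_le_one.2 (sum_coeff_le_one hw N)) _
      _ = κ := one_mul κ
  have hthird : Tendsto (fun N => G * ∑ k ∈ t, ENNReal.ofReal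
      (∫ y, |weightedMean w N (fun n => b k (U n y)) - ∫ u, b k u ∂V y| ∂Q)) atTop (𝓝 0) := by
    have h1 : Tendsto (fun N => ∑ k ∈ t, ENNReal.ofReal
        (∫ y, |weightedMean w N (fun n => b k (U n y)) - ∫ u, b k u ∂V y| ∂Q)) atTop (𝓝 0) := by
      rw [← Finset.sum_const_zero (s := t)]
      refine tendsto_finsetSum _ fun k _ => ?_
      simpa using ENNReal.tendsto_ofReal (hV (b k))
    simpa using ENNReal.Tendsto.const_mul h1 (Or.inr hGtop)
  filter_upwards [ENNReal.tendsto_nhds_zero.1 hthird (ENNReal.ofReal (r / 3))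
    (ENNReal.ofReal_pos.2 (by positivity)), hw.eventually_pos] with N hN hNpos
  have hprob := fun y => isProbabilityMeasure_weightedEmpirical hw hNpos fun n => U n y
  have hm1 : AEMeasurable (fun y => ∫⁻ u, h u ∂(weightedEmpirical w N fun n => U n y)) Q := by
    simp only [lintegral_weightedEmpirical]
    exact Finset.aemeasurable_fun_sum _ fun n _ => (hhUm n).const_mul _
  have hm2 : Measurable fun y => ∫⁻ u, h u ∂V y := hhm.lintegral_kernel
  have hm3 : AEMeasurable (fun y => ENNReal.ofReal η ^ s
      + 2 * (∫⁻ u, h u ∂(weightedEmpirical w N fun n => U n y) + ∫⁻ u, h u ∂V y)) Q :=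
    ((hm1.add hm2.aemeasurable).const_mul 2).const_add _
  have hdiff : ∀ k, Integrable (fun y => weightedMean w N (fun n => b k (U n y))
      - ∫ u, b k u ∂V y) Q := fun k =>
    (integrable_weightedMean_comp hU (b k) w N).sub (integrable_expectation (b k))
  calc ∫⁻ y, wassersteinDist s (weightedEmpirical w N fun n => U n y) (V y) ^ s ∂Q
      ≤ ∫⁻ y, (ENNReal.ofReal η ^ s
        + 2 * (∫⁻ u, h u ∂(weightedEmpirical w N fun n => U n y) + ∫⁻ u, h u ∂V y))
        + G * ∑ k ∈ t, ENNReal.ofReal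
          |weightedMean w N (fun n => b k (U n y)) - ∫ u, b k u ∂V y| ∂Q := by
        -- Measurability of the Wasserstein distance in `y` plays no role: only the majorant is
        -- integrated term by term.
        refine lintegral_mono fun y => ?_
        have := wassersteinDist_rpow_le_partition hs hΨ S hb0 hbsum hbdist hGle
          (weightedEmpirical w N fun n => U n y) (V y)
        simpa only [integral_weightedEmpirical hw] using this
    _ = (ENNReal.ofReal η ^ s * Q univ
        + 2 * (∫⁻ y, ∫⁻ u, h u ∂(weightedEmpirical w N fun n => U n y) ∂Q
          + ∫⁻ y, ∫⁻ u, h u ∂V y ∂Q))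
        + G * ∑ k ∈ t, ENNReal.ofReal
          (∫ y, |weightedMean w N (fun n => b k (U n y)) - ∫ u, b k u ∂V y| ∂Q) := by
        rw [lintegral_add_left' hm3,
          lintegral_add_left' aemeasurable_const, lintegral_const, lintegral_const_mul' _ _
          (by norm_num), lintegral_add_left' hm1, lintegral_const_mul' _ _ hGtop,
          lintegral_finsetSum' _ fun k _ => (hdiff k).1.aemeasurable.abs.ennreal_ofReal]
        congr 2
        refine Finset.sum_congr rfl fun k _ => ?_
        rw [ofReal_integral_eq_lintegral_ofReal (hdiff k).abs
          (Eventually.of_forall fun y => abs_nonneg _)]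
    _ ≤ ENNReal.ofReal (r / 3) + 2 * (κ + κ) + ENNReal.ofReal (r / 3) := by
        refine add_le_add (add_le_add ?_ (mul_le_mul_right (add_le_add (hemp N) hhV) _)) hN
        have h1 : Q univ = ENNReal.ofReal A := by
          rw [hA, measureReal_def, ENNReal.ofReal_toReal (measure_ne_top _ _)]
        rw [h1, ENNReal.ofReal_rpow_of_pos hη0, hη, ← Real.rpow_mul (by positivity),
          one_div_mul_cancel hs0.ne', Real.rpow_one, ← ENNReal.ofReal_mul (by positivity)]
        refine ENNReal.ofReal_le_ofReal ?_
        rw [div_mul_eq_mul_div, div_le_div_iff₀ (by positivity) (by positivity)]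
        nlinarith
    _ ≤ ENNReal.ofReal (r / 3) + ENNReal.ofReal (r / 3) + ENNReal.ofReal (r / 3) := by
        refine add_le_add (add_le_add le_rfl ?_) le_rfl
        have h1 : 2 * (κ + κ) = ENNReal.ofReal (4 * (P * ε * C)) := by
          have h2 : κ = ENNReal.ofReal (P * ε * C) := by
            rw [ENNReal.ofReal_mul (by positivity), ENNReal.ofReal_coe_nnreal]
          rw [h2, ENNReal.ofReal_mul (p := 4) (by norm_num), ENNReal.ofReal_ofNat]
          ring
        rw [h1]
        refine ENNReal.ofReal_le_ofReal ?_
        rw [hε]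
        have : 4 * (P * (r / (3 * (4 * P) * (C + 1))) * C) = r * C / (3 * (C + 1)) := by
          field_simp
        rw [this, div_le_div_iff₀ (by positivity) (by positivity)]
        nlinarith
    _ = r := by
        rw [← ENNReal.ofReal_add (by positivity) (by positivity),
          ← ENNReal.ofReal_add (by positivity) (by positivity), ← ENNReal.ofReal_coe_nnreal]
        congr 1
        ring
    _ ≤ δ := hrδ.le

end WassersteinLimit

end EulerS

namespace EulerS

/-! ### Functionals bounded in time -/

section TimeKernel

variable {X : Type*} [TopologicalSpace X] [CompactSpace X] [PolishSpace X] [MeasurableSpace X]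
  [BorelSpace X]

/-- The constant function one on a compact space. -/
noncomputable def oneC (X : Type*) [TopologicalSpace X] [CompactSpace X] : C_c(X, ℝ) where
  toFun _ := 1
  continuous_toFun := continuous_const
  hasCompactSupport' := HasCompactSupport.of_compactSpace _

@[simp] theorem oneC_apply (x : X) : oneC X x = 1 := rfl

/-- Restriction of a compactly supported function to a time slice. -/
noncomputable def slice (Φ : C_c(ℝ × X, ℝ)) (t : ℝ) : C_c(X, ℝ) where
  toFun x := Φ (t, x)
  continuous_toFun := Φ.continuous.comp (Continuous.prodMk_right t)
  hasCompactSupport' := HasCompactSupport.of_compactSpace _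

@[simp] theorem slice_apply (Φ : C_c(ℝ × X, ℝ)) (t : ℝ) (x : X) : slice Φ t x = Φ (t, x) := rfl

theorem integrable_compProd_bounded {μ : Measure ℝ} [IsFiniteMeasure μ] {Z : Kernel ℝ X}
    [IsFiniteKernel Z] (Φ : C_c(ℝ × X, ℝ)) : Integrable (fun z => Φ z) (μ ⊗ₘ Z) := by
  obtain ⟨K, -, hK⟩ := exists_bound_of_compactlySupported Φ
  exact Integrable.of_bound Φ.continuous.measurable.aestronglyMeasurable K
    (Eventually.of_forall hK)

theorem integrable_integral_kernel {μ : Measure ℝ} [IsFiniteMeasure μ] {Z : Kernel ℝ X}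
    [IsFiniteKernel Z] (Φ : C_c(ℝ × X, ℝ)) : Integrable (fun t => ∫ x, Φ (t, x) ∂Z t) μ :=
  Integrable.integral_compProd (κ := Kernel.const Unit μ) (η := Kernel.prodMkLeft Unit Z) (a := ())
    (f := fun z : ℝ × X => Φ z) (integrable_compProd_bounded Φ)

/-- Riesz gives a measure `M` on `ℝ × X`. The bound on `ψ ⊗ 1` says that its time marginal is at
most `c μ`, hence has a density bounded by `c`; multiplying the conditional measures by this density
gives the kernel. -/
theorem exists_timeKernel [Nonempty X] {μ : Measure ℝ} [IsFiniteMeasure μ]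
    (Λ : C_c(ℝ × X, ℝ) →ₗ[ℝ] ℝ) (hΛ : ∀ Φ : C_c(ℝ × X, ℝ), (∀ z, 0 ≤ Φ z) → 0 ≤ Λ Φ) {c : ℝ}
    (hc0 : 0 ≤ c)
    (hc : ∀ ψ : C_c(ℝ, ℝ), (∀ t, 0 ≤ ψ t) → Λ (tensor ψ (oneC X)) ≤ c * ∫ t, ψ t ∂μ) :
    ∃ Z : Kernel ℝ X, (∀ t, Z t univ ≤ ENNReal.ofReal c) ∧
      ∀ Φ : C_c(ℝ × X, ℝ), Λ Φ = ∫ t, ∫ x, Φ (t, x) ∂Z t ∂μ := by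
  obtain ⟨M, hMreg, hM⟩ := exists_measure_of_nonneg Λ hΛ
  have hMfin : IsFiniteMeasure M := by
    refine ⟨(measure_univ_le_of_integral_le (c := c * μ.real univ) fun Φ hΦ => ?_).trans_lt
      ENNReal.ofReal_lt_top⟩
    -- With `ψ = 1` on the time projection of the support of `Φ ≤ 1` one has `Φ ≤ ψ ⊗ 1`, to which
    -- the time bound applies.
    obtain ⟨ψ, hψ1, -, hψ⟩ := exists_compactlySupported_between
      (Φ.hasCompactSupport.isCompact.image continuous_fst) isOpen_univ (subset_univ _)
    calc ∫ z, Φ z ∂M ≤ ∫ z, tensor ψ (oneC X) z ∂M := by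
          refine integral_mono Φ.integrable (tensor ψ (oneC X)).integrable fun z => ?_
          by_cases hz : z ∈ tsupport Φ
          · have := hψ1 z.1 ⟨z, hz, rfl⟩
            simpa [this] using (hΦ z).2
          · have h0 : Φ z = 0 := image_eq_zero_of_notMem_tsupport hz
            simpa [h0] using (hψ z.1).1
      _ = Λ (tensor ψ (oneC X)) := hM _
      _ ≤ c * ∫ t, ψ t ∂μ := hc ψ fun t => (hψ t).1
      _ ≤ c * ∫ _t, (1 : ℝ) ∂μ := by
          refine mul_le_mul_of_nonneg_left ?_ hc0
          exact integral_mono ψ.integrable (integrable_const _) fun t => (hψ t).2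
      _ = c * μ.real univ := by simp
  have hle : M.fst ≤ ENNReal.ofReal c • μ := by
    have : IsFiniteMeasure (ENNReal.ofReal c • μ) := Measure.smul_finite μ ENNReal.ofReal_ne_top
    refine measure_le_of_integral_le fun ψ hψ => ?_
    rw [Measure.fst, integral_map (f := fun t => ψ t) measurable_fst.aemeasurable
      ψ.continuous.measurable.aestronglyMeasurable, integral_smul_measure,
      ENNReal.toReal_ofReal hc0]
    refine le_trans (le_of_eq ?_) (hc ψ hψ)
    rw [← hM]
    simp
  have hac : M.fst ≪ μ := Measure.absolutelyContinuous_of_le_smul hle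
  -- Taking the minimum with `c` changes the density only on a null set, but yields the mass bound
  -- at every time.
  set δ : ℝ → ℝ≥0∞ := fun t => min (M.fst.rnDeriv μ t) (ENNReal.ofReal c) with hδ
  have hδm : Measurable δ := (Measure.measurable_rnDeriv _ _).min measurable_const
  have hδae : M.fst.rnDeriv μ =ᵐ[μ] δ := by
    have h1 : M.fst.rnDeriv μ ≤ᵐ[μ] fun _ => ENNReal.ofReal c := by
      refine ae_le_of_forall_setLIntegral_le_of_sigmaFinite (Measure.measurable_rnDeriv _ _)
        fun s hs _ => ?_
      rw [Measure.setLIntegral_rnDeriv hac, lintegral_const, Measure.restrict_apply_univ]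
      exact hle s
    filter_upwards [h1] with t ht
    exact (min_eq_left ht).symm
  have hfst : μ.withDensity δ = M.fst := by
    rw [← withDensity_congr_ae hδae, Measure.withDensity_rnDeriv_eq _ _ hac]
  let Z : Kernel ℝ X := ⟨fun t => δ t • M.condKernel t,
    Measure.measurable_of_measurable_coe _ fun s hs =>
      hδm.mul (Kernel.measurable_coe M.condKernel hs)⟩
  have hZ : ∀ t s, Z t s = δ t * M.condKernel t s := fun t s => rfl
  have hZle : ∀ t, Z t univ ≤ ENNReal.ofReal c := fun t => by
    rw [hZ, measure_univ, mul_one]; exact min_le_right _ _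
  have hZfin : IsFiniteKernel Z := ⟨⟨ENNReal.ofReal c, ENNReal.ofReal_lt_top, hZle⟩⟩
  have hcomp : μ ⊗ₘ Z = M := by
    rw [← Measure.disintegrate M M.condKernel, ← hfst]
    ext s hs
    rw [Measure.compProd_apply hs, Measure.compProd_apply hs,
      lintegral_withDensity_eq_lintegral_mul _ hδm (Kernel.measurable_kernel_prodMk_left hs)]
    rfl
  refine ⟨Z, hZle, fun Φ => ?_⟩
  rw [← hM, ← hcomp, Measure.integral_compProd (integrable_compProd_bounded Φ)]

/-- Moving the negative coefficients to the other side turns the identity into an equality between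
two positive kernels, `W c` and `W (-c)`, where `ENNReal.ofReal` selects the positive parts.
Equality of kernels gives one null set of times valid for all `A`. -/
theorem ae_sum_eq_zero_of_integral {ι : Type*} [Fintype ι] {μ : Measure ℝ} [IsFiniteMeasure μ]
    (Z : ι → Kernel ℝ X) [∀ i, IsFiniteKernel (Z i)] (c : ι → ℝ)
    (h : ∀ Φ : C_c(ℝ × X, ℝ), ∑ i, c i * ∫ t, ∫ x, Φ (t, x) ∂Z i t ∂μ = 0) :
    ∀ᵐ t ∂μ, ∀ A, ∑ i, c i * (Z i t).real A = 0 := by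
  let W : (ι → ℝ) → Kernel ℝ X := fun e => ⟨fun t => ∑ i, ENNReal.ofReal (e i) • Z i t, by
    refine Measure.measurable_of_measurable_coe _ fun s hs => ?_
    simp only [Measure.finsetSum_apply, Measure.smul_apply, smul_eq_mul]
    exact Finset.measurable_fun_sum _ fun i _ => (Kernel.measurable_coe (Z i) hs).const_mul _⟩
  have hW : ∀ e t s, W e t s = ∑ i, ENNReal.ofReal (e i) * Z i t s := fun e t s => by
    change (∑ i, ENNReal.ofReal (e i) • Z i t : Measure X) s = _
    simp [Measure.finsetSum_apply]
  have hfin : ∀ e, IsFiniteKernel (W e) := fun e => by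
    refine ⟨⟨∑ i, ENNReal.ofReal (e i) * (Z i).bound, ?_, fun t => ?_⟩⟩
    · exact ENNReal.sum_lt_top.2 fun i _ => ENNReal.mul_lt_top ENNReal.ofReal_lt_top
        (Kernel.bound_lt_top _)
    · rw [hW]
      exact Finset.sum_le_sum fun i _ => mul_le_mul_right (Kernel.measure_le_bound _ _ _) _
  have hint : ∀ e (Φ : C_c(ℝ × X, ℝ)), ∫ z, Φ z ∂(μ ⊗ₘ W e)
      = ∑ i, max (e i) 0 * ∫ t, ∫ x, Φ (t, x) ∂Z i t ∂μ := by
    intro e Φ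
    rw [Measure.integral_compProd (integrable_compProd_bounded Φ)]
    have h1 : ∀ t, ∫ x, Φ (t, x) ∂W e t = ∑ i, max (e i) 0 * ∫ x, Φ (t, x) ∂Z i t := by
      intro t
      change ∫ x, Φ (t, x) ∂(∑ i, ENNReal.ofReal (e i) • Z i t) = _
      rw [integral_finsetSum_measure]
      · refine Finset.sum_congr rfl fun i _ => ?_
        rw [integral_smul_measure, ENNReal.toReal_ofReal', smul_eq_mul]
      · intro i _
        exact (slice Φ t).integrable.smul_measure ENNReal.ofReal_ne_top
    simp only [h1]
    rw [integral_finsetSum _ fun i _ => (integrable_integral_kernel Φ).const_mul _]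
    simp only [integral_const_mul]
  have heq : μ ⊗ₘ W c = μ ⊗ₘ W (-c) := by
    refine Measure.ext_of_integral_eq_on_compactlySupported fun Φ => ?_
    rw [hint, hint, ← sub_eq_zero, ← Finset.sum_sub_distrib]
    refine Eq.trans ?_ (h Φ)
    refine Finset.sum_congr rfl fun i _ => ?_
    rw [← sub_mul, Pi.neg_apply, max_zero_sub_max_neg_zero_eq_self]
  filter_upwards [Kernel.ae_eq_of_compProd_eq heq] with t ht A
  have h1 := congrArg (fun ρ : Measure X => (ρ A).toReal) ht
  simp only [hW] at h1
  rw [ENNReal.toReal_sum fun i _ => ENNReal.mul_ne_top ENNReal.ofReal_ne_top (measure_ne_top _ _),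
    ENNReal.toReal_sum fun i _ => ENNReal.mul_ne_top ENNReal.ofReal_ne_top (measure_ne_top _ _),
    ← sub_eq_zero, ← Finset.sum_sub_distrib] at h1
  rw [← h1]
  refine Finset.sum_congr rfl fun i _ => ?_
  rw [ENNReal.toReal_mul, ENNReal.toReal_mul, ENNReal.toReal_ofReal', ENNReal.toReal_ofReal',
    ← sub_mul, Pi.neg_apply, max_zero_sub_max_neg_zero_eq_self, measureReal_def]

end TimeKernel

end EulerS

namespace EulerS

/-! ### Integrals against signed measures -/

section Signed

variable {X : Type*} [TopologicalSpace X] [MeasurableSpace X] [BorelSpace X]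

theorem isFiniteMeasure_variation (μ : SignedMeasure X) : IsFiniteMeasure μ.variation := by
  rw [← SignedMeasure.totalVariation_eq_variation]
  exact ⟨by simp only [SignedMeasure.totalVariation, Measure.add_apply]
            exact ENNReal.add_lt_top.2 ⟨measure_lt_top _ _, measure_lt_top _ _⟩⟩

theorem integrable_signed (μ : SignedMeasure X) (f : C_c(X, ℝ)) : μ.Integrable (fun x => f x) := by
  have := isFiniteMeasure_variation μ
  exact f.integrable

theorem signedIntegral_toSignedMeasure (ν : Measure X) [IsFiniteMeasure ν] (f : X → ℝ) :
    ∫ᵛ x, f x ∂•ν.toSignedMeasure = ∫ x, f x ∂ν := by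
  rw [← VectorMeasure.integral_toSignedMeasure]
  congr 1
  ext
  simp

theorem signedIntegral_eq_jordan (μ : SignedMeasure X) (f : C_c(X, ℝ)) :
    ∫ᵛ x, f x ∂•μ = ∫ x, f x ∂μ.toJordanDecomposition.posPart
      - ∫ x, f x ∂μ.toJordanDecomposition.negPart := by
  conv_lhs => rw [← SignedMeasure.toSignedMeasure_toJordanDecomposition μ,
    JordanDecomposition.toSignedMeasure]
  rw [VectorMeasure.integral_sub_vectorMeasure (integrable_signed _ f) (integrable_signed _ f),
    signedIntegral_toSignedMeasure, signedIntegral_toSignedMeasure]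

theorem signedIntegral_sum {ι κ : Type*} [Fintype ι] [Fintype κ] (μ : ι → κ → SignedMeasure X)
    (c : ι → κ → ℝ) (f : C_c(X, ℝ)) :
    ∫ᵛ x, f x ∂•(∑ i, ∑ j, c i j • μ i j) = ∑ i, ∑ j, c i j * ∫ᵛ x, f x ∂•(μ i j) := by
  rw [VectorMeasure.integral_finsetSum_vectorMeasure fun i _ => integrable_signed _ f]
  refine Finset.sum_congr rfl fun i _ => ?_
  rw [VectorMeasure.integral_finsetSum_vectorMeasure fun j _ => integrable_signed _ f]
  refine Finset.sum_congr rfl fun j _ => ?_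
  rw [VectorMeasure.integral_smul_vectorMeasure, smul_eq_mul]

theorem signedIntegral_mem_Icc {μ : SignedMeasure X} (hμ : ∀ A, MeasurableSet A → 0 ≤ μ A)
    (f : C_c(X, ℝ)) {l u : ℝ} (hl : ∀ x, l ≤ f x) (hu : ∀ x, f x ≤ u) :
    l * μ univ ≤ ∫ᵛ x, f x ∂•μ ∧ ∫ᵛ x, f x ∂•μ ≤ u * μ univ := by
  have h0 : 0 ≤[univ] μ := by
    rw [VectorMeasure.le_restrict_univ_iff_le, VectorMeasure.le_iff]
    exact fun A hA => by simpa using hμ A hA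
  set ν := μ.toMeasureOfZeroLE univ MeasurableSet.univ h0 with hν
  have hνμ : ν.toSignedMeasure = μ := SignedMeasure.toMeasureOfZeroLE_toSignedMeasure μ h0
  have hu' : μ univ = ν.real univ := by
    rw [hν, SignedMeasure.toMeasureOfZeroLE_real_apply _ _ _ MeasurableSet.univ, univ_inter]
  rw [hu']
  have hi : ∫ᵛ x, f x ∂•μ = ∫ x, f x ∂ν := by
    rw [← signedIntegral_toSignedMeasure, hνμ]
  rw [hi]
  constructor
  · have := integral_mono (integrable_const l) f.integrable hl (μ := ν)
    simpa [mul_comm] using this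
  · have := integral_mono f.integrable (integrable_const u) hu (μ := ν)
    simpa [mul_comm] using this

end Signed

/-! ### Positive semi-definite matrices of signed measures -/

section StressMatrix

variable {X : Type*} [TopologicalSpace X] [CompactSpace X] [MeasurableSpace X] [BorelSpace X]
  {d : ℕ}

/-- The quadratic form of a matrix of real numbers. -/
noncomputable def quad (M : Fin d → Fin d → ℝ) (ξ : Fin d → ℝ) : ℝ := ∑ i, ∑ j, ξ i * ξ j * M i j

theorem quad_single (M : Fin d → Fin d → ℝ) (i : Fin d) : quad M (Pi.single i 1) = M i i := by
  simp [quad, Pi.single_apply]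

theorem quad_single_add (M : Fin d → Fin d → ℝ) (i j : Fin d) :
    quad M (Pi.single i 1 + Pi.single j 1) = M i i + M i j + M j i + M j j := by
  simp [quad, Pi.single_apply, add_mul, mul_add, Finset.sum_add_distrib]
  ring

theorem quad_single_sub (M : Fin d → Fin d → ℝ) (i j : Fin d) :
    quad M (Pi.single i 1 - Pi.single j 1) = M i i - M i j - M j i + M j j := by
  simp [quad, Pi.single_apply, sub_mul, mul_sub, Finset.sum_sub_distrib]
  ring

/-- A symmetric matrix is recovered from its quadratic form on the vectors `e_i` and `e_i + e_j`.
This reduces representing a matrix of functionals to representing positive scalar ones. -/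
theorem quad_polarisation (M : Fin d → Fin d → ℝ) (hM : ∀ i j, M i j = M j i) (ξ : Fin d → ℝ) :
    ∑ i, ∑ j, ξ i * ξ j * (2⁻¹ * (quad M (Pi.single i 1 + Pi.single j 1)
      - quad M (Pi.single i 1) - quad M (Pi.single j 1))) = quad M ξ := by
  refine Finset.sum_congr rfl fun i _ => Finset.sum_congr rfl fun j _ => ?_
  rw [quad_single_add, quad_single, quad_single, hM j i]
  ring

/-- Symmetry and positive semi-definiteness of a matrix of signed measures. -/
def IsPSDMeasure (R : Fin d → Fin d → SignedMeasure X) : Prop :=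
  (∀ i j, R i j = R j i) ∧ ∀ (ξ : Fin d → ℝ) (A : Set X), MeasurableSet A →
    0 ≤ ∑ i, ∑ j, ξ i * ξ j * R i j A

variable {R : Fin d → Fin d → SignedMeasure X}

/-- For fixed `ξ` the combination `∑ ξ_i ξ_j R_ij` is a non-negative measure, so its integrals obey
the usual two-sided bounds. -/
theorem IsPSDMeasure.quad_mem_Icc (hR : IsPSDMeasure R) (ξ : Fin d → ℝ) (f : C_c(X, ℝ)) {l u : ℝ}
    (hl : ∀ x, l ≤ f x) (hu : ∀ x, f x ≤ u) :
    l * quad (fun i j => R i j univ) ξ ≤ quad (fun i j => ∫ᵛ x, f x ∂•(R i j)) ξ ∧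
      quad (fun i j => ∫ᵛ x, f x ∂•(R i j)) ξ ≤ u * quad (fun i j => R i j univ) ξ := by
  have happ : ∀ A, (∑ i, ∑ j, (ξ i * ξ j) • R i j) A = ∑ i, ∑ j, ξ i * ξ j * R i j A := by
    intro A
    simp
  have := signedIntegral_mem_Icc (μ := ∑ i, ∑ j, (ξ i * ξ j) • R i j)
    (fun A hA => by rw [happ]; exact hR.2 ξ A hA) f hl hu
  rwa [signedIntegral_sum, happ] at this

theorem IsPSDMeasure.quad_univ_nonneg (hR : IsPSDMeasure R) (ξ : Fin d → ℝ) :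
    0 ≤ quad (fun i j => R i j univ) ξ := hR.2 ξ univ MeasurableSet.univ

theorem IsPSDMeasure.diag_nonneg (hR : IsPSDMeasure R) (i : Fin d) : 0 ≤ R i i univ := by
  simpa [quad_single] using hR.quad_univ_nonneg (Pi.single i 1)

theorem IsPSDMeasure.diag_le (hR : IsPSDMeasure R) (i : Fin d) :
    R i i univ ≤ ∑ k, R k k univ :=
  Finset.single_le_sum (f := fun k => R k k univ) (fun k _ => hR.diag_nonneg k)
    (Finset.mem_univ i)

/-- By polarisation `2 |∫ f dR_ij|` is at most `K` times the masses of the forms at `e_i + e_j`,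
`e_i` and `e_j`. Non-negativity at `e_i - e_j` gives `2 R_ij ≤ R_ii + R_jj`, so everything is at
most `3K (R_ii + R_jj) ≤ 6K tr`. -/
theorem IsPSDMeasure.abs_integral_le (hR : IsPSDMeasure R) (i j : Fin d) (f : C_c(X, ℝ)) {K : ℝ}
    (hK : ∀ x, |f x| ≤ K) (hK0 : 0 ≤ K) :
    |∫ᵛ x, f x ∂•(R i j)| ≤ 3 * K * ∑ k, R k k univ := by
  have hl : ∀ x, -K ≤ f x := fun x => (abs_le.1 (hK x)).1
  have hu : ∀ x, f x ≤ K := fun x => (abs_le.1 (hK x)).2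
  have h1 := hR.quad_mem_Icc (Pi.single i 1 + Pi.single j 1) f hl hu
  have h2 := hR.quad_mem_Icc (Pi.single i 1) f hl hu
  have h3 := hR.quad_mem_Icc (Pi.single j 1) f hl hu
  have h4 := hR.quad_univ_nonneg (Pi.single i 1 - Pi.single j 1)
  have hsym := hR.1 j i
  simp only [quad_single_add, quad_single, quad_single_sub, hsym] at h1 h2 h3 h4
  have hi := hR.diag_le i
  have hj := hR.diag_le j
  have hi0 := hR.diag_nonneg i
  have h5 : K * (2 * R i j univ) ≤ K * (R i i univ + R j j univ) :=
    mul_le_mul_of_nonneg_left (by linarith) hK0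
  have h6 := mul_le_mul_of_nonneg_left hi hK0
  have h7 := mul_le_mul_of_nonneg_left hj hK0
  rw [abs_le]
  constructor <;> nlinarith

end StressMatrix

end EulerS

namespace EulerS

/-! ### Reynolds stresses as functionals -/

section Reynolds

variable {d : ℕ} {T : ℝ} {R : StressField d}

/-- Serves to evaluate test functions frozen at a discretised time: countably many measurable
representatives differ from the `g i` on one common null set. -/
theorem aestronglyMeasurable_of_countable_choice {Ω ι : Type*} [MeasurableSpace Ω]
    [MeasurableSpace ι] [Countable ι] [MeasurableSingletonClass ι] {μ : Measure Ω}
    {g : ι → Ω → ℝ} (hg : ∀ i, AEStronglyMeasurable (g i) μ) {n : Ω → ι} (hn : Measurable n) :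
    AEStronglyMeasurable (fun t => g (n t) t) μ := by
  have hm : Measurable (fun p : Ω × ι => (hg p.2).mk (g p.2) p.1) :=
    measurable_from_prod_countable_left fun i => (hg i).stronglyMeasurable_mk.measurable
  refine ⟨fun t => (hg (n t)).mk (g (n t)) t,
    (hm.comp (measurable_id.prodMk hn)).stronglyMeasurable, ?_⟩
  filter_upwards [ae_all_iff.2 fun i => (hg i).ae_eq_mk] with t ht
  exact ht (n t)

theorem IsReynoldsStress.isPSD (hR : IsReynoldsStress T R) :
    ∀ᵐ t ∂(volume.restrict (Ioo 0 T)), IsPSDMeasure (R t) := by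
  filter_upwards [hR.symm, hR.posSemidef] with t h1 h2 using ⟨h1, h2⟩

theorem tendsto_signedIntegral_slice (μ : SignedMeasure (Torus d)) (Φ : C_c(ℝ × Torus d, ℝ))
    {u : ℕ → ℝ} {t : ℝ} (hu : Tendsto u atTop (𝓝 t)) :
    Tendsto (fun k => ∫ᵛ x, Φ (u k, x) ∂•μ) atTop (𝓝 (∫ᵛ x, Φ (t, x) ∂•μ)) := by
  have hj : ∀ s, ∫ᵛ x, Φ (s, x) ∂•μ = ∫ x, Φ (s, x) ∂μ.toJordanDecomposition.posPart
      - ∫ x, Φ (s, x) ∂μ.toJordanDecomposition.negPart :=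
    fun s => signedIntegral_eq_jordan μ (slice Φ s)
  obtain ⟨K, -, hK⟩ := exists_bound_of_compactlySupported Φ
  have hlim : ∀ ν : Measure (Torus d), IsFiniteMeasure ν →
      Tendsto (fun k => ∫ x, Φ (u k, x) ∂ν) atTop (𝓝 (∫ x, Φ (t, x) ∂ν)) := by
    intro ν _
    refine tendsto_integral_of_dominated_convergence (fun _ => K)
      (fun k => (slice Φ (u k)).continuous.aestronglyMeasurable) (integrable_const _)
      (fun k => Eventually.of_forall fun x => hK _) (Eventually.of_forall fun x => ?_)
    exact (Φ.continuous.tendsto (t, x)).comp (hu.prodMk_nhds tendsto_const_nhds)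
  simp only [hj]
  exact (hlim _ inferInstance).sub (hlim _ inferInstance)

/-- Weak-star measurability is available only for test functions independent of time. Freezing `Φ`
at the grid time `⌊t(k+1)⌋/(k+1)` reduces to these, and continuity of `Φ` lets `k → ∞`; the
natural-number floor suffices as `t > 0`. -/
theorem IsReynoldsStress.aestronglyMeasurable (hR : IsReynoldsStress T R) (i j : Fin d)
    (Φ : C_c(ℝ × Torus d, ℝ)) :
    AEStronglyMeasurable (fun t => ∫ᵛ x, Φ (t, x) ∂•(R t i j)) (volume.restrict (Ioo 0 T)) := by
  let g : ℕ → ℕ → ℝ → ℝ := fun k n t => ∫ᵛ x, Φ ((n : ℝ) / (k + 1), x) ∂•(R t i j)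
  have hg : ∀ k n, AEStronglyMeasurable (g k n) (volume.restrict (Ioo 0 T)) := fun k n =>
    hR.measurable i j ⟨fun x => Φ ((n : ℝ) / (k + 1), x),
      Φ.continuous.comp (Continuous.prodMk_right _)⟩
  refine aestronglyMeasurable_of_tendsto_ae atTop (f := fun k (t : ℝ) => g k ⌊t * (k + 1)⌋₊ t)
    (fun k => aestronglyMeasurable_of_countable_choice (hg k)
      (Nat.measurable_floor.comp (measurable_mul_const ((k : ℝ) + 1)))) ?_
  filter_upwards [ae_restrict_mem measurableSet_Ioo] with t ht
  refine tendsto_signedIntegral_slice _ Φ ?_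
  have h1 : Tendsto (fun k : ℕ => (k : ℝ) + 1) atTop atTop :=
    tendsto_atTop_add_const_right _ _ tendsto_natCast_atTop_atTop
  exact (tendsto_nat_floor_mul_div_atTop ht.1.le).comp h1

theorem IsReynoldsStress.ae_abs_integral_le (hR : IsReynoldsStress T R) (i j : Fin d) :
    ∀ᵐ t ∂(volume.restrict (Ioo 0 T)), ∀ (Φ : C_c(ℝ × Torus d, ℝ)) (K : ℝ), 0 ≤ K →
      (∀ z, |Φ z| ≤ K) → |∫ᵛ x, Φ (t, x) ∂•(R t i j)| ≤ 3 * K * traceMass R t := by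
  filter_upwards [hR.isPSD] with t ht Φ K hK0 hK
  exact ht.abs_integral_le i j (slice Φ t) (fun x => hK _) hK0

theorem IsReynoldsStress.integrable (hR : IsReynoldsStress T R) (i j : Fin d)
    (Φ : C_c(ℝ × Torus d, ℝ)) :
    Integrable (fun t => ∫ᵛ x, Φ (t, x) ∂•(R t i j)) (volume.restrict (Ioo 0 T)) := by
  obtain ⟨C, hC⟩ := hR.bounded
  obtain ⟨K, hK0, hK⟩ := exists_bound_of_compactlySupported Φ
  refine Integrable.of_bound (hR.aestronglyMeasurable i j Φ) (3 * K * C) ?_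
  filter_upwards [hC, hR.ae_abs_integral_le i j] with t h1 h2
  exact (h2 Φ K hK0 hK).trans (mul_le_mul_of_nonneg_left h1 (by positivity))

theorem IsReynoldsStress.integrable_traceMass (hR : IsReynoldsStress T R) :
    Integrable (traceMass R) (volume.restrict (Ioo 0 T)) := by
  obtain ⟨C, hC⟩ := hR.bounded
  refine Integrable.of_bound (Finset.aestronglyMeasurable_fun_sum Finset.univ fun i _ => ?_) C ?_
  · refine (hR.measurable i i 1).congr ?_
    filter_upwards [hR.isPSD] with t ht
    have h := ht.quad_mem_Icc (Pi.single i 1) (oneC (Torus d)) (l := 1) (u := 1) (fun x => by simp)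
      (fun x => by simp)
    simp only [quad_single, one_mul] at h
    exact le_antisymm h.2 h.1
  · filter_upwards [hC, hR.isPSD] with t h1 h2
    have h3 : 0 ≤ traceMass R t := Finset.sum_nonneg fun i _ => h2.diag_nonneg i
    rwa [Real.norm_of_nonneg h3]

/-- The functional `Φ ↦ ∫_0^T ∫ Φ d𝔑_{ij} dt`. -/
noncomputable def stressFunctional (T : ℝ) (R : StressField d) (i j : Fin d)
    (Φ : C_c(ℝ × Torus d, ℝ)) : ℝ :=
  ∫ t in Ioo 0 T, ∫ᵛ x, Φ (t, x) ∂•(R t i j)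

theorem IsReynoldsStress.stressFunctional_add (hR : IsReynoldsStress T R) (i j : Fin d)
    (Φ Ψ : C_c(ℝ × Torus d, ℝ)) :
    stressFunctional T R i j (Φ + Ψ) = stressFunctional T R i j Φ + stressFunctional T R i j Ψ := by
  rw [stressFunctional, stressFunctional, stressFunctional,
    ← integral_add (hR.integrable i j Φ) (hR.integrable i j Ψ)]
  congr 1 with t
  exact VectorMeasure.integral_fun_add (integrable_signed _ (slice Φ t))
    (integrable_signed _ (slice Ψ t))

theorem stressFunctional_smul (i j : Fin d) (c : ℝ) (Φ : C_c(ℝ × Torus d, ℝ)) :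
    stressFunctional T R i j (c • Φ) = c * stressFunctional T R i j Φ := by
  rw [stressFunctional, stressFunctional, ← integral_const_mul]
  congr 1 with t
  exact VectorMeasure.integral_fun_smul (B := ContinuousLinearMap.lsmul ℝ ℝ) (μ := R t i j) c (fun x => Φ (t, x))

theorem quad_sum_integral {X : Type*} [MeasurableSpace X] {μ : Measure X} {f : Fin d → Fin d → X → ℝ}
    (hf : ∀ i j, Integrable (f i j) μ) (ξ : Fin d → ℝ) :
    quad (fun i j => ∫ t, f i j t ∂μ) ξ = ∫ t, quad (fun i j => f i j t) ξ ∂μ := by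
  simp only [quad]
  rw [integral_finsetSum _ fun i _ => integrable_finsetSum _ fun j _ => (hf i j).const_mul _]
  refine Finset.sum_congr rfl fun i _ => ?_
  rw [integral_finsetSum _ fun j _ => (hf i j).const_mul _]
  simp only [integral_const_mul]

theorem integrable_quad {X : Type*} [MeasurableSpace X] {μ : Measure X}
    {f : Fin d → Fin d → X → ℝ} (hf : ∀ i j, Integrable (f i j) μ) (ξ : Fin d → ℝ) :
    Integrable (fun t => quad (fun i j => f i j t) ξ) μ :=
  integrable_finsetSum _ fun i _ => integrable_finsetSum _ fun j _ => (hf i j).const_mul _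

/-- A symmetric matrix of functionals which is positive semi-definite and bounded in time is given
by a Reynolds stress. -/
theorem exists_reynoldsStress (N : Fin d → Fin d → C_c(ℝ × Torus d, ℝ) →ₗ[ℝ] ℝ)
    (hsym : ∀ i j Φ, N i j Φ = N j i Φ)
    (hpos : ∀ ξ (Φ : C_c(ℝ × Torus d, ℝ)), (∀ z, 0 ≤ Φ z) → 0 ≤ quad (fun i j => N i j Φ) ξ)
    (hbdd : ∀ ξ, ∃ c, 0 ≤ c ∧ ∀ ψ : C_c(ℝ, ℝ), (∀ t, 0 ≤ ψ t) →
      quad (fun i j => N i j (tensor ψ (oneC (Torus d)))) ξ ≤ c * ∫ t in Ioo 0 T, ψ t) :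
    ∃ R : StressField d, IsReynoldsStress T R ∧
      ∀ i j Φ, N i j Φ = stressFunctional T R i j Φ := by
  set μ : Measure ℝ := volume.restrict (Ioo 0 T) with hμ
  choose c hc0 hc using hbdd
  -- In each direction `ξ` the quadratic form is a positive scalar functional, represented by a
  -- kernel `Z ξ` with bounded mass.
  let Nq : (Fin d → ℝ) → C_c(ℝ × Torus d, ℝ) →ₗ[ℝ] ℝ := fun ξ => ∑ i, ∑ j, (ξ i * ξ j) • N i j
  have hNq : ∀ ξ Φ, Nq ξ Φ = quad (fun i j => N i j Φ) ξ := by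
    intro ξ Φ
    simp [Nq, quad, LinearMap.sum_apply]
  have hex : ∀ ξ, ∃ Z : Kernel ℝ (Torus d), (∀ t, Z t univ ≤ ENNReal.ofReal (c ξ)) ∧
      ∀ Φ : C_c(ℝ × Torus d, ℝ), quad (fun i j => N i j Φ) ξ = ∫ t, ∫ x, Φ (t, x) ∂Z t ∂μ := by
    intro ξ
    obtain ⟨Z, h1, h2⟩ := exists_timeKernel (μ := μ) (Nq ξ)
      (fun Φ hΦ => by rw [hNq]; exact hpos ξ Φ hΦ) (hc0 ξ)
      (fun ψ hψ => by rw [hNq]; exact hc ξ ψ hψ)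
    exact ⟨Z, h1, fun Φ => by rw [← hNq, h2]⟩
  choose Z hZ hZN using hex
  have hfin : ∀ ξ, IsFiniteKernel (Z ξ) := fun ξ =>
    ⟨⟨ENNReal.ofReal (c ξ), ENNReal.ofReal_lt_top, hZ ξ⟩⟩
  let e : Fin d → Fin d → ℝ := fun i => Pi.single i 1
  -- Only the directions `e_i` and `e_i + e_j` are used; the entries come from polarisation, as
  -- signed measures.
  let R : StressField d := fun t i j => (2⁻¹ : ℝ) • ((Z (e i + e j) t).toSignedMeasure
    - (Z (e i) t).toSignedMeasure - (Z (e j) t).toSignedMeasure)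
  have hRA : ∀ t i j A, MeasurableSet A → R t i j A = 2⁻¹ * ((Z (e i + e j) t).real A
      - (Z (e i) t).real A - (Z (e j) t).real A) := by
    intro t i j A hA
    simp [R, Measure.toSignedMeasure_apply_measurable hA]
  have hRint : ∀ t i j (f : C_c(Torus d, ℝ)), ∫ᵛ x, f x ∂•(R t i j)
      = 2⁻¹ * (∫ x, f x ∂Z (e i + e j) t - ∫ x, f x ∂Z (e i) t - ∫ x, f x ∂Z (e j) t) := by
    intro t i j f
    have hi : ∀ ξ, (Z ξ t).toSignedMeasure.Integrable (fun x => f x) := fun ξ =>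
      integrable_signed _ f
    simp only [R]
    rw [VectorMeasure.integral_smul_vectorMeasure,
      VectorMeasure.integral_sub_vectorMeasure ((hi _).sub_vectorMeasure (hi _)) (hi _),
      VectorMeasure.integral_sub_vectorMeasure (hi _) (hi _), signedIntegral_toSignedMeasure,
      signedIntegral_toSignedMeasure, signedIntegral_toSignedMeasure, smul_eq_mul]
  have hrat : ∀ ξ : Fin d → ℝ, ∀ᵐ t ∂μ, ∀ A, MeasurableSet A →
      0 ≤ ∑ i, ∑ j, ξ i * ξ j * R t i j A := by
    intro ξ
    have hfin' : ∀ o : Option (Fin d × Fin d × Fin 3), IsFiniteKernel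
        (o.elim (Z ξ) fun p => Z (![e p.1 + e p.2.1, e p.1, e p.2.1] p.2.2)) := by
      rintro (_ | p)
      · exact hfin ξ
      · exact hfin _
    -- The index `none` carries `-Z ξ` and the triples carry the polarised expression for the form
    -- of `R` at `ξ`. Hence that form is the positive measure `Z ξ t` for almost every `t`.
    have := ae_sum_eq_zero_of_integral (μ := μ) (ι := Option (Fin d × Fin d × Fin 3))
      (fun o => o.elim (Z ξ) fun p => Z (![e p.1 + e p.2.1, e p.1, e p.2.1] p.2.2))
      (fun o => o.elim (-1) fun p => ξ p.1 * ξ p.2.1 * 2⁻¹ * ![1, -1, -1] p.2.2) ?_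
    · filter_upwards [this] with t ht A hA
      have h1 := ht A
      rw [Fintype.sum_option] at h1
      simp only [Option.elim, Fintype.sum_prod_type, Fin.sum_univ_three] at h1
      have h2 : ∑ i, ∑ j, ξ i * ξ j * R t i j A = (Z ξ t).real A := by
        rw [← sub_eq_zero, ← h1, sub_eq_neg_add]
        congr 1
        · ring
        refine Finset.sum_congr rfl fun i _ => Finset.sum_congr rfl fun j _ => ?_
        rw [hRA t i j A hA]
        simp
        ring
      rw [h2]
      exact measureReal_nonneg
    · intro Φ
      rw [Fintype.sum_option]
      simp only [Option.elim, Fintype.sum_prod_type, Fin.sum_univ_three, ← hZN]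
      rw [← quad_polarisation (fun i j => N i j Φ) (fun i j => hsym i j Φ) ξ]
      rw [neg_one_mul, neg_add_eq_zero]
      refine Finset.sum_congr rfl fun i _ => Finset.sum_congr rfl fun j _ => ?_
      simp [e]
      ring
  have hmeas : ∀ ξ (f : C_c(Torus d, ℝ)), Measurable fun t => ∫ x, f x ∂Z ξ t := fun ξ f =>
    (f.continuous.stronglyMeasurable.integral_kernel (κ := Z ξ)).measurable
  refine ⟨R, ⟨?_, ?_, ?_, ?_⟩, ?_⟩
  · refine Eventually.of_forall fun t i j => ?_
    simp only [R]
    rw [add_comm (e i) (e j), sub_right_comm]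
  -- The exceptional null set depends on `ξ`. Rational directions give a common one, and the
  -- inequality is closed in `ξ`.
  · have hall : ∀ᵐ t ∂μ, ∀ ξ : Fin d → ℚ, ∀ A, MeasurableSet A →
        0 ≤ ∑ i, ∑ j, (ξ i : ℝ) * (ξ j : ℝ) * R t i j A :=
      ae_all_iff.2 fun ξ => hrat fun i => (ξ i : ℝ)
    filter_upwards [hall] with t ht ξ A hA
    have hcl : IsClosed {ξ : Fin d → ℝ | 0 ≤ ∑ i, ∑ j, ξ i * ξ j * R t i j A} :=
      isClosed_le continuous_const (by fun_prop)
    have hd : DenseRange (fun ξ : Fin d → ℚ => fun i => (ξ i : ℝ)) :=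
      DenseRange.piMap fun _ => Rat.denseRange_cast
    exact hd.induction_on (p := fun ξ => 0 ≤ ∑ i, ∑ j, ξ i * ξ j * R t i j A) ξ hcl
      fun ξ => ht ξ A hA
  · intro i j f
    let f' : C_c(Torus d, ℝ) := ⟨f, HasCompactSupport.of_compactSpace _⟩
    have h1 : (fun t => ∫ᵛ x, f x ∂•(R t i j)) = fun t => 2⁻¹ * (∫ x, f' x ∂Z (e i + e j) t
        - ∫ x, f' x ∂Z (e i) t - ∫ x, f' x ∂Z (e j) t) := by
      ext t
      exact hRint t i j f'
    rw [h1]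
    exact ((((hmeas _ f').sub (hmeas _ f')).sub (hmeas _ f')).const_mul _).aestronglyMeasurable
  · refine ⟨∑ i, 2⁻¹ * c (e i + e i), Eventually.of_forall fun t => ?_⟩
    refine Finset.sum_le_sum fun i _ => ?_
    rw [hRA t i i univ MeasurableSet.univ]
    refine mul_le_mul_of_nonneg_left ?_ (by norm_num)
    have h1 : (Z (e i + e i) t).real univ ≤ c (e i + e i) :=
      ENNReal.toReal_le_of_le_ofReal (hc0 _) (hZ _ t)
    have h2 : 0 ≤ (Z (e i) t).real univ := measureReal_nonneg
    linarith
  · intro i j Φ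
    have hK : ∀ ξ, Integrable (fun t => ∫ x, Φ (t, x) ∂Z ξ t) μ := fun ξ =>
      integrable_integral_kernel Φ
    have h1 : stressFunctional T R i j Φ = ∫ t, 2⁻¹ * (∫ x, Φ (t, x) ∂Z (e i + e j) t
        - ∫ x, Φ (t, x) ∂Z (e i) t - ∫ x, Φ (t, x) ∂Z (e j) t) ∂μ := by
      rw [stressFunctional]
      congr 1 with t
      exact hRint t i j (slice Φ t)
    rw [h1, integral_const_mul, integral_sub (by exact (hK _).sub (hK _)) (hK _),
      integral_sub (hK _) (hK _), ← hZN, ← hZN, ← hZN]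
    simp only [e, quad_single, quad_single_add]
    rw [hsym j i]
    ring

end Reynolds

end EulerS

namespace EulerS

/-! ### The growth function of the Euler system -/

section Growth

variable {d : ℕ} {a γ : ℝ}

/-- The integrability exponent of the momentum. -/
noncomputable def momentumExponent (γ : ℝ) : ℝ := 2 * γ / (γ + 1)

theorem one_lt_momentumExponent (hγ : 1 < γ) : 1 < momentumExponent γ := by
  rw [momentumExponent, one_lt_div (by linarith)]; linarith

theorem momentumExponent_lt (hγ : 1 < γ) : momentumExponent γ < γ := by
  rw [momentumExponent, div_lt_iff₀ (by linarith)]; nlinarith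

/-- The growth function `|ϱ|^γ + |m|^{2γ/(γ+1)}`. -/
noncomputable def eulerGrowth (γ : ℝ) (u : State d) : ℝ :=
  |u.fst| ^ γ + ‖u.snd‖ ^ momentumExponent γ

theorem le_one_add_rpow {x q : ℝ} (hx : 0 ≤ x) (hq : 1 ≤ q) : x ≤ 1 + x ^ q := by
  rcases le_total x 1 with h | h
  · have := Real.rpow_nonneg hx q
    linarith
  · have := Real.rpow_le_rpow_of_exponent_le h hq
    rw [Real.rpow_one] at this
    linarith

theorem rpow_le_one_add_rpow {x p q : ℝ} (hx : 0 ≤ x) (hp : 0 ≤ p) (hpq : p ≤ q) :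
    x ^ p ≤ 1 + x ^ q := by
  rcases le_total x 1 with h | h
  · have h1 := Real.rpow_nonneg hx q
    have h2 := Real.rpow_le_one hx h hp
    linarith
  · have := Real.rpow_le_rpow_of_exponent_le h hpq
    linarith

theorem norm_le_fst_add_snd (u : State d) : ‖u‖ ≤ |u.fst| + ‖u.snd‖ := by
  refine abs_le_of_sq_le_sq' ?_ (by positivity) |>.2
  rw [WithLp.prod_norm_sq_eq_of_L2, Real.norm_eq_abs]
  nlinarith [abs_nonneg u.fst, norm_nonneg u.snd]

theorem eulerGrowth_nonneg (u : State d) : 0 ≤ eulerGrowth γ u := by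
  unfold eulerGrowth; positivity

theorem isGrowth_eulerGrowth (hγ : 1 < γ) : IsGrowth (eulerGrowth (d := d) γ) := by
  have hp := one_lt_momentumExponent hγ
  refine ⟨?_, eulerGrowth_nonneg, ?_⟩
  · have h1 : Continuous fun u : State d => u.fst := WithLp.continuous_fst ..
    have h2 : Continuous fun u : State d => u.snd := WithLp.continuous_snd ..
    exact (h1.abs.rpow_const fun _ => Or.inr (by linarith)).add
      (h2.norm.rpow_const fun _ => Or.inr (by linarith))
  · refine tendsto_atTop_mono (f := fun u : State d => ‖u‖ - 2) (fun u => ?_)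
      (tendsto_atTop_add_const_right _ _ (tendsto_norm_cocompact_atTop (E := State d)))
    have h1 := norm_le_fst_add_snd u
    have h2 := le_one_add_rpow (abs_nonneg u.fst) hγ.le
    have h3 := le_one_add_rpow (norm_nonneg u.snd) hp.le
    unfold eulerGrowth
    linarith

/-- Since `|F|^q = (|F|^p)^{q/p}`, it is bounded by a multiple of `Ψ^{q/p}` for large `Ψ`, which is
sublinear because `q < p`. -/
theorem isSmallGrowth_of_le {E : Type*} {Ψ F : E → ℝ} {p q c : ℝ} (hc : 0 < c)
    (hF : ∀ u, |F u| ^ p ≤ c * (1 + Ψ u)) (hq : 0 ≤ q) (hqp : q < p) :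
    IsSmallGrowth Ψ F q := by
  intro ε hε
  have hp : 0 < p := by linarith
  set θ := q / p with hθ
  have hθ1 : θ < 1 := by rwa [hθ, div_lt_one hp]
  have hθ0 : 0 ≤ θ := by positivity
  have hlim : Tendsto (fun x : ℝ => ε * x ^ (1 - θ)) atTop atTop :=
    (tendsto_rpow_atTop (by linarith)).const_mul_atTop hε
  obtain ⟨R, hR⟩ := eventually_atTop.1
    ((hlim.eventually_ge_atTop ((2 * c) ^ θ)).and (eventually_ge_atTop 1))
  refine ⟨R, fun u hu => ?_⟩
  obtain ⟨h1, h2⟩ := hR _ hu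
  have h0 : 0 < Ψ u := by linarith
  calc |F u| ^ q = (|F u| ^ p) ^ θ := by
        rw [← Real.rpow_mul (abs_nonneg _), hθ, mul_div_cancel₀ _ hp.ne']
    _ ≤ (2 * c * Ψ u) ^ θ := by
        refine Real.rpow_le_rpow (by positivity) ((hF u).trans ?_) hθ0
        nlinarith
    _ = (2 * c) ^ θ * Ψ u ^ θ := Real.mul_rpow (by positivity) h0.le
    _ ≤ ε * Ψ u ^ (1 - θ) * Ψ u ^ θ := by gcongr
    _ = ε * Ψ u := by
        rw [mul_assoc, ← Real.rpow_add h0]; simp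

theorem isSmallGrowth_density {q : ℝ} (hq : 0 ≤ q) (hqγ : q < γ) :
    IsSmallGrowth (eulerGrowth (d := d) γ) (fun u => u.fst) q := by
  refine isSmallGrowth_of_le one_pos (fun u => ?_) hq hqγ
  have : 0 ≤ ‖u.snd‖ ^ momentumExponent γ := by positivity
  unfold eulerGrowth
  linarith

theorem isSmallGrowth_momentum {q : ℝ} (hq : 0 ≤ q) (hqγ : q < momentumExponent γ) (i : Fin d) :
    IsSmallGrowth (eulerGrowth (d := d) γ) (fun u => u.snd i) q := by
  refine isSmallGrowth_of_le one_pos (fun u => ?_) hq hqγ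
  have h1 : |u.snd i| ^ momentumExponent γ ≤ ‖u.snd‖ ^ momentumExponent γ :=
    Real.rpow_le_rpow (abs_nonneg _) (PiLp.norm_apply_le u.snd i) (by linarith)
  have : 0 ≤ |u.fst| ^ γ := by positivity
  unfold eulerGrowth
  linarith

theorem isSmallGrowth_norm (hγ : 1 < γ) {q : ℝ} (hq : 0 ≤ q) (hqγ : q < momentumExponent γ) :
    IsSmallGrowth (eulerGrowth (d := d) γ) (fun u => ‖u‖) q := by
  have hp := one_lt_momentumExponent hγ
  refine isSmallGrowth_of_le (c := 2 ^ momentumExponent γ) (by positivity) (fun u => ?_) hq hqγ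
  have hle : ‖u‖ ≤ 2 * max |u.fst| ‖u.snd‖ := by
    have := norm_le_fst_add_snd u
    have h1 := le_max_left |u.fst| ‖u.snd‖
    have h2 := le_max_right |u.fst| ‖u.snd‖
    linarith
  rw [abs_norm]
  refine (Real.rpow_le_rpow (norm_nonneg _) hle (by linarith)).trans ?_
  rw [Real.mul_rpow (by norm_num) (le_max_of_le_left (abs_nonneg _))]
  refine mul_le_mul_of_nonneg_left ?_ (by positivity)
  have h3 : 0 ≤ ‖u.snd‖ ^ momentumExponent γ := by positivity
  have h4 : 0 ≤ |u.fst| ^ γ := by positivity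
  have h5 := rpow_le_one_add_rpow (abs_nonneg u.fst) (by linarith) (momentumExponent_lt hγ).le
  unfold eulerGrowth
  rcases max_cases |u.fst| ‖u.snd‖ with ⟨h, -⟩ | ⟨h, -⟩ <;> rw [h] <;> linarith

/-- The constant relating the growth function to the energy. -/
noncomputable def growthConst (a γ : ℝ) : ℝ := 2 + 2 * (γ - 1) / a

/-- The identity `x^{2γ/(γ+1)} = (x²/r)^{γ/(γ+1)} (r^γ)^{1/(γ+1)}` and weighted AM-GM. This is the
origin of the momentum exponent. -/
theorem momentum_rpow_le (hγ : 1 < γ) {r x : ℝ} (hr : 0 < r) (hx : 0 ≤ x) :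
    x ^ momentumExponent γ ≤ x ^ 2 / r + r ^ γ := by
  have h1 : 0 < γ + 1 := by linarith
  have hA : 0 ≤ x ^ 2 / r := by positivity
  have hB : 0 ≤ r ^ γ := by positivity
  have h := Real.geom_mean_le_arith_mean2_weighted (w₁ := γ / (γ + 1)) (w₂ := 1 / (γ + 1))
    (by positivity) (by positivity) hA hB (by field_simp)
  have h2 : (x ^ 2 / r) ^ (γ / (γ + 1)) * (r ^ γ) ^ (1 / (γ + 1)) = x ^ momentumExponent γ := by
    rw [Real.div_rpow (by positivity) hr.le, ← Real.rpow_mul hr.le, mul_one_div, div_mul_cancel₀ _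
      (by positivity), ← Real.rpow_natCast, ← Real.rpow_mul hx, momentumExponent]
    congr 1
    push_cast
    ring
  rw [h2] at h
  refine h.trans (add_le_add ?_ ?_)
  · refine mul_le_of_le_one_left hA ?_
    rw [div_le_one h1]; linarith
  · refine mul_le_of_le_one_left hB ?_
    rw [div_le_one h1]; linarith

theorem eulerGrowth_le_energy (ha : 0 < a) (hγ : 1 < γ) (u : State d) :
    ENNReal.ofReal (eulerGrowth γ u)
      ≤ ENNReal.ofReal (growthConst a γ) * energy a γ u.fst u.snd := by
  have hp := one_lt_momentumExponent hγ
  have hg : 0 < growthConst a γ := by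
    have : 0 < 2 * (γ - 1) / a := div_pos (by linarith) ha
    unfold growthConst
    linarith
  unfold energy
  split_ifs with h1 h2
  · rw [← ENNReal.ofReal_mul hg.le]
    refine ENNReal.ofReal_le_ofReal ?_
    have h3 := momentum_rpow_le hγ h1 (norm_nonneg u.snd)
    have hγ1 : 0 < γ - 1 := by linarith
    have h4 : 0 ≤ ‖u.snd‖ ^ 2 / u.fst := by positivity
    have h5 : 0 ≤ u.fst ^ γ := by positivity
    -- The summand `2` restores `|m|²/ϱ` from its half, and `2(γ-1)/a` restores `2ϱ^γ` from the
    -- pressure potential; the two cross terms are non-negative and discarded.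
    have h6 : growthConst a γ * (1 / 2 * (‖u.snd‖ ^ 2 / u.fst) + a / (γ - 1) * u.fst ^ γ)
        = ‖u.snd‖ ^ 2 / u.fst + 2 * u.fst ^ γ
          + ((γ - 1) / a * (‖u.snd‖ ^ 2 / u.fst) + 2 * (a / (γ - 1)) * u.fst ^ γ) := by
      unfold growthConst
      field_simp
      ring
    have h7 : 0 ≤ (γ - 1) / a * (‖u.snd‖ ^ 2 / u.fst) := by positivity
    have h8 : 0 ≤ 2 * (a / (γ - 1)) * u.fst ^ γ := by positivity
    rw [h6, eulerGrowth, abs_of_pos h1]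
    linarith
  · have h3 : eulerGrowth γ u = 0 := by
      rw [eulerGrowth, h2.1, h2.2, abs_zero, norm_zero, Real.zero_rpow (by linarith),
        Real.zero_rpow (by linarith), add_zero]
    simp [h3]
  · rw [ENNReal.mul_top (by simpa using hg)]
    exact le_top

end Growth

end EulerS

namespace EulerS

/-! ### Convex densities of the Euler system -/

section Density

variable {d : ℕ} {a γ : ℝ}

/-- The states of finite energy. -/
def stateSpace (d : ℕ) : Set (State d) := {u | 0 ≤ u.fst ∧ (u.fst = 0 → u.snd = 0)}

theorem energy_lt_top_iff {u : State d} : energy a γ u.fst u.snd < ⊤ ↔ u ∈ stateSpace d := by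
  unfold energy stateSpace
  simp only [mem_ofPred_eq]
  split_ifs with h1 h2
  · exact ⟨fun _ => ⟨h1.le, fun h => absurd h h1.ne'⟩, fun _ => ENNReal.ofReal_lt_top⟩
  · exact ⟨fun _ => ⟨h2.1.ge, fun _ => h2.2⟩, fun _ => ENNReal.zero_lt_top⟩
  · refine ⟨fun h => absurd h (lt_irrefl _), fun h => absurd ?_ h2⟩
    have h3 : u.fst = 0 := le_antisymm (not_lt.1 h1) h.1
    exact ⟨h3, h.2 h3⟩

theorem convex_stateSpace : Convex ℝ (stateSpace d) := by
  rintro u ⟨hu0, hu⟩ v ⟨hv0, hv⟩ α β hα hβ -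
  have h1 : 0 ≤ α * u.fst := mul_nonneg hα hu0
  have h2 : 0 ≤ β * v.fst := mul_nonneg hβ hv0
  refine ⟨by simpa using add_nonneg h1 h2, fun h => ?_⟩
  have h3 : α * u.fst + β * v.fst = 0 := by simpa using h
  have h4 : α * u.fst = 0 := by linarith
  have h5 : β * v.fst = 0 := by linarith
  have h6 : α • u.snd = 0 := by
    rcases mul_eq_zero.1 h4 with h | h
    · rw [h, zero_smul]
    · rw [hu h, smul_zero]
  have h7 : β • v.snd = 0 := by
    rcases mul_eq_zero.1 h5 with h | h
    · rw [h, zero_smul]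
    · rw [hv h, smul_zero]
  simp [h6, h7]

theorem zero_mem_stateSpace : (0 : State d) ∈ stateSpace d := ⟨le_rfl, fun _ => rfl⟩

/-- Non-negative convex functions of the state which vanish at the vacuum and are continuous away
from it. -/
structure IsFluidDensity (f : State d → ℝ) : Prop where
  convexOn : ConvexOn ℝ (stateSpace d) f
  nonneg : ∀ u, 0 ≤ f u
  vacuum : ∀ u, ¬ 0 < u.fst → f u = 0
  continuousAt : ∀ u, 0 < u.fst → ContinuousAt f u
  measurable : Measurable f

theorem IsFluidDensity.add {f g : State d → ℝ} (hf : IsFluidDensity f) (hg : IsFluidDensity g) :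
    IsFluidDensity (fun u => f u + g u) where
  convexOn := hf.convexOn.add hg.convexOn
  nonneg u := add_nonneg (hf.nonneg u) (hg.nonneg u)
  vacuum u hu := by rw [hf.vacuum u hu, hg.vacuum u hu, add_zero]
  continuousAt u hu := (hf.continuousAt u hu).add (hg.continuousAt u hu)
  measurable := hf.measurable.add hg.measurable

theorem IsFluidDensity.const_mul {f : State d → ℝ} (hf : IsFluidDensity f) {c : ℝ} (hc : 0 ≤ c) :
    IsFluidDensity (fun u => c * f u) where
  convexOn := hf.convexOn.smul hc
  nonneg u := mul_nonneg hc (hf.nonneg u)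
  vacuum u hu := by rw [hf.vacuum u hu, mul_zero]
  continuousAt u hu := (hf.continuousAt u hu).const_mul c
  measurable := hf.measurable.const_mul c

theorem IsFluidDensity.sum {ι : Type*} (s : Finset ι) {f : ι → State d → ℝ}
    (hf : ∀ i, IsFluidDensity (f i)) : IsFluidDensity (fun u => ∑ i ∈ s, f i u) := by
  classical
  induction s using Finset.induction_on with
  | empty =>
    simp only [Finset.sum_empty]
    exact ⟨convexOn_const _ convex_stateSpace, fun _ => le_rfl, fun _ _ => rfl,
      fun _ _ => continuousAt_const, measurable_const⟩
  | insert i s hi ih =>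
    simp only [Finset.sum_insert hi]
    exact (hf i).add ih

/-- The momentum flux in direction `ξ`, a convex function of the state. -/
noncomputable def flux (ξ : Fin d → ℝ) (u : State d) : ℝ :=
  if 0 < u.fst then (∑ i, ξ i * u.snd i) ^ 2 / u.fst else 0

theorem quad_convective (ξ : Fin d → ℝ) (u : State d) :
    quad (fun i j => convective u.fst u.snd i j) ξ = flux ξ u := by
  unfold quad convective flux
  split_ifs with h
  · rw [pow_two, Finset.sum_mul_sum, Finset.sum_div]
    refine Finset.sum_congr rfl fun i _ => ?_
    rw [Finset.sum_div]
    exact Finset.sum_congr rfl fun j _ => by ring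
  · simp

theorem measurable_fst_state : Measurable fun u : State d => u.fst :=
  (WithLp.continuous_fst ..).measurable

theorem continuous_snd_apply (i : Fin d) : Continuous fun u : State d => u.snd i :=
  (EuclideanSpace.proj (𝕜 := ℝ) i).continuous.comp (WithLp.continuous_snd ..)

/-- On the states of finite energy `s²/ϱ` dominates the linear functions `2cs - c²ϱ` for all `c`,
with equality at `c = s/ϱ`. Evaluating these tangents at the convex combination proves convexity,
vacuum included. -/
theorem isFluidDensity_flux (ξ : Fin d → ℝ) : IsFluidDensity (flux ξ) := by
  set s : State d → ℝ := fun u => ∑ i, ξ i * u.snd i with hs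
  have hsc : Continuous s := continuous_finsetSum _ fun i _ =>
    continuous_const.mul (continuous_snd_apply i)
  have hfc : Continuous fun u : State d => u.fst := WithLp.continuous_fst ..
  have htan : ∀ u ∈ stateSpace d, ∀ c, 2 * c * s u - c ^ 2 * u.fst ≤ flux ξ u := by
    rintro u ⟨hu0, hu⟩ c
    unfold flux
    split_ifs with h
    · rw [le_div_iff₀ h]
      change _ ≤ s u ^ 2
      nlinarith [sq_nonneg (s u - c * u.fst)]
    · have h0 : u.fst = 0 := le_antisymm (not_lt.1 h) hu0
      simp [hs, hu h0, h0]
  have hn : ∀ u : State d, 0 ≤ flux ξ u := fun u => by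
    unfold flux
    split_ifs
    · positivity
    · exact le_rfl
  refine ⟨⟨convex_stateSpace, ?_⟩, hn, fun u hu => if_neg hu, fun u hu => ?_, ?_⟩
  · intro u hu v hv α β hα hβ _
    simp only [smul_eq_mul]
    by_cases h : 0 < (α • u + β • v).fst
    · set z := α • u + β • v with hz
      have hsz : s z = α * s u + β * s v := by
        simp only [hs, hz, Finset.mul_sum, ← Finset.sum_add_distrib]
        refine Finset.sum_congr rfl fun i _ => ?_
        simp
        ring
      have hfz : z.fst = α * u.fst + β * v.fst := by simp [hz]
      have h1 := mul_le_mul_of_nonneg_left (htan u hu (s z / z.fst)) hα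
      have h2 := mul_le_mul_of_nonneg_left (htan v hv (s z / z.fst)) hβ
      have h3 : flux ξ z = 2 * (s z / z.fst) * s z - (s z / z.fst) ^ 2 * z.fst := by
        unfold flux
        rw [if_pos h]
        change s z ^ 2 / z.fst = _
        field_simp
        ring
      rw [h3]
      generalize s z / z.fst = c at h1 h2
      rw [hsz, hfz]
      linarith
    · have h0 : flux ξ (α • u + β • v) = 0 := if_neg h
      rw [h0]
      exact add_nonneg (mul_nonneg hα (hn u)) (mul_nonneg hβ (hn v))
  · have hev : (fun u : State d => s u ^ 2 / u.fst) =ᶠ[𝓝 u] flux ξ := by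
      filter_upwards [hfc.continuousAt.eventually (lt_mem_nhds hu)] with v hv
      exact (if_pos hv).symm
    exact ((hsc.continuousAt.pow 2).div hfc.continuousAt hu.ne').congr hev
  · exact Measurable.ite (measurableSet_lt measurable_const measurable_fst_state)
      ((hsc.measurable.pow_const 2).div measurable_fst_state) measurable_const

/-- The power of the density entering the pressure. -/
noncomputable def densityPow (γ : ℝ) (u : State d) : ℝ := if 0 < u.fst then u.fst ^ γ else 0

theorem densityPow_eq (hγ : 1 < γ) {u : State d} (hu : u ∈ stateSpace d) :
    densityPow γ u = u.fst ^ γ := by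
  unfold densityPow
  split_ifs with h
  · rfl
  · rw [le_antisymm (not_lt.1 h) hu.1, Real.zero_rpow (by linarith)]

theorem isFluidDensity_densityPow (hγ : 1 < γ) : IsFluidDensity (densityPow (d := d) γ) := by
  have hfc : Continuous fun u : State d => u.fst := WithLp.continuous_fst ..
  refine ⟨?_, fun u => ?_, fun u hu => if_neg hu, fun u hu => ?_, ?_⟩
  · have h1 := (convexOn_rpow hγ.le).comp_linearMap (WithLp.fstₗ 2 ℝ ℝ (Vec d))
    have h2 : ConvexOn ℝ (stateSpace d) (fun u : State d => u.fst ^ γ) :=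
      h1.subset (fun u hu => hu.1) convex_stateSpace
    exact h2.congr fun u hu => (densityPow_eq hγ hu).symm
  · unfold densityPow
    split_ifs
    · positivity
    · exact le_rfl
  · have hev : (fun u : State d => u.fst ^ γ) =ᶠ[𝓝 u] densityPow γ := by
      filter_upwards [hfc.continuousAt.eventually (lt_mem_nhds hu)] with v hv
      exact (if_pos hv).symm
    exact (hfc.continuousAt.rpow_const (Or.inl hu.ne')).congr hev
  · exact Measurable.ite (measurableSet_lt measurable_const measurable_fst_state)
      (measurable_fst_state.pow_const γ) measurable_const

/-- The density `‖m‖² / ϱ`. -/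
noncomputable def fluxTrace (u : State d) : ℝ := ∑ i, flux (Pi.single i 1) u

theorem fluxTrace_eq (u : State d) :
    fluxTrace u = if 0 < u.fst then ‖u.snd‖ ^ 2 / u.fst else 0 := by
  unfold fluxTrace flux
  split_ifs with h
  · rw [EuclideanSpace.norm_sq_eq, ← Finset.sum_div]
    simp [Pi.single_apply]
  · simp

/-- The energy as a real-valued function, equal to zero outside of the states of finite energy. -/
noncomputable def energyDensity (a γ : ℝ) (u : State d) : ℝ :=
  1 / 2 * fluxTrace u + a / (γ - 1) * densityPow γ u

theorem isFluidDensity_fluxTrace : IsFluidDensity (fluxTrace (d := d)) :=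
  IsFluidDensity.sum _ fun i => isFluidDensity_flux (Pi.single i 1)

theorem isFluidDensity_energyDensity (ha : 0 < a) (hγ : 1 < γ) :
    IsFluidDensity (energyDensity (d := d) a γ) :=
  (isFluidDensity_fluxTrace.const_mul (by norm_num)).add
    ((isFluidDensity_densityPow hγ).const_mul (div_nonneg ha.le (by linarith)))

theorem energy_eq_ofReal {u : State d} (hu : u ∈ stateSpace d) :
    energy a γ u.fst u.snd = ENNReal.ofReal (energyDensity a γ u) := by
  unfold energy energyDensity
  rw [fluxTrace_eq]
  unfold densityPow
  by_cases h : 0 < u.fst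
  · simp [h]
  · have h0 : u.fst = 0 := le_antisymm (not_lt.1 h) hu.1
    simp [h0, hu.2 h0]

theorem ofReal_energyDensity_le (u : State d) :
    ENNReal.ofReal (energyDensity a γ u) ≤ energy a γ u.fst u.snd := by
  by_cases hu : u ∈ stateSpace d
  · rw [energy_eq_ofReal hu]
  · rw [not_lt_top_iff.1 (mt energy_lt_top_iff.1 hu)]
    exact le_top

theorem measurableSet_stateSpace : MeasurableSet (stateSpace d) := by
  have h2 : Measurable fun u : State d => u.snd := (WithLp.continuous_snd ..).measurable
  exact (measurableSet_le measurable_const measurable_fst_state).inter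
    ((measurable_fst_state (measurableSet_singleton 0)).compl.union
      (h2 (measurableSet_singleton 0)) |>.congr (by ext u; simp [imp_iff_not_or]; rfl))

theorem measurable_energy (ha : 0 < a) (hγ : 1 < γ) :
    Measurable fun u : State d => energy a γ u.fst u.snd := by
  classical
  have h : (fun u : State d => energy a γ u.fst u.snd) = fun u =>
      if u ∈ stateSpace d then ENNReal.ofReal (energyDensity a γ u) else ⊤ := by
    ext u
    split_ifs with hu
    · exact energy_eq_ofReal hu
    · exact not_lt_top_iff.1 (mt energy_lt_top_iff.1 hu)
  rw [h]
  exact Measurable.ite measurableSet_stateSpace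
    (isFluidDensity_energyDensity ha hγ).measurable.ennreal_ofReal measurable_const

theorem weightedMean_mem_stateSpace {x : ℕ → State d} (hx : ∀ n, x n ∈ stateSpace d) (N : ℕ) :
    weightedMean 1 N x ∈ stateSpace d := by
  rcases N.eq_zero_or_pos with rfl | hN
  · simpa [weightedMean] using zero_mem_stateSpace
  · rw [weightedMean_eq_sum]
    refine convex_stateSpace.sum_mem (fun n hn => coeff_nonneg isAveraging_one hn)
      (sum_coeff ?_) fun n _ => hx n
    rw [weightSum_one]
    exact_mod_cast hN

theorem IsFluidDensity.weightedMean_le {f : State d → ℝ} (hf : IsFluidDensity f)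
    {x : ℕ → State d} (hx : ∀ n, x n ∈ stateSpace d) (N : ℕ) :
    f (weightedMean 1 N x) ≤ weightedMean 1 N (fun n => f (x n)) := by
  rcases N.eq_zero_or_pos with rfl | hN
  · have h0 : weightedMean 1 0 x = 0 := by simp [weightedMean]
    rw [h0, hf.vacuum _ (by simp)]
    simp [weightedMean]
  · rw [weightedMean_eq_sum, weightedMean_eq_sum]
    refine hf.convexOn.map_sum_le (fun n hn => coeff_nonneg isAveraging_one hn)
      (sum_coeff ?_) fun n _ => hx n
    rw [weightSum_one]
    exact_mod_cast hN

end Density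

end EulerS

namespace EulerS

/-! ### Lower semicontinuity of convex densities along averages -/

section Fatou

variable {d : ℕ} {a γ : ℝ} {Y : Type*} [MeasurableSpace Y] {Q : Measure Y} {U : ℕ → Y → State d}

theorem le_of_tendsto_of_frequently_le {x y : ℕ → ℝ} {l m : ℝ} (hx : Tendsto x atTop (𝓝 l))
    (hy : Tendsto y atTop (𝓝 m)) (h : ∃ᶠ k in atTop, x k ≤ y k) : l ≤ m := by
  by_contra! hlt
  exact h ((hy.eventually_lt hx hlt).mono fun k hk => not_le.2 hk)

theorem norm_sq_le_of_energyDensity (ha : 0 < a) (hγ : 1 < γ) {u : State d}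
    (hu : u ∈ stateSpace d) : ‖u.snd‖ ^ 2 ≤ 2 * energyDensity a γ u * u.fst := by
  unfold energyDensity
  rw [fluxTrace_eq]
  have h1 : 0 ≤ a / (γ - 1) * densityPow γ u :=
    mul_nonneg (div_nonneg ha.le (by linarith)) ((isFluidDensity_densityPow hγ).nonneg u)
  split_ifs with h
  · have h2 : ‖u.snd‖ ^ 2 / u.fst * u.fst = ‖u.snd‖ ^ 2 := div_mul_cancel₀ _ h.ne'
    nlinarith [mul_nonneg h1 h.le]
  · have h0 : u.fst = 0 := le_antisymm (not_lt.1 h) hu.1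
    simp [hu.2 h0, h0]

/-- The inequality `|m|² ≤ 2Eϱ` holds with a bounded `E` for infinitely many indices, and so passes
to the limit: where the limit density vanishes, the momentum must vanish. -/
theorem mem_stateSpace_of_tendsto (ha : 0 < a) (hγ : 1 < γ) {x : ℕ → State d} {u : State d}
    (hx : ∀ k, x k ∈ stateSpace d) (hu : Tendsto x atTop (𝓝 u))
    (hfin : liminf (fun k => ENNReal.ofReal (energyDensity a γ (x k))) atTop ≠ ⊤) :
    u ∈ stateSpace d := by
  have h1 : Tendsto (fun k => (x k).fst) atTop (𝓝 u.fst) :=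
    ((WithLp.continuous_fst (p := 2) (α := ℝ) (β := Vec d)).tendsto u).comp hu
  have h2 : Tendsto (fun k => (x k).snd) atTop (𝓝 u.snd) :=
    ((WithLp.continuous_snd (p := 2) (α := ℝ) (β := Vec d)).tendsto u).comp hu
  refine ⟨ge_of_tendsto' h1 fun k => (hx k).1, fun h0 => ?_⟩
  obtain ⟨M, hM⟩ : ∃ M : ℝ≥0, ∃ᶠ k in atTop,
      ENNReal.ofReal (energyDensity a γ (x k)) < (M : ℝ≥0∞) := by
    obtain ⟨M, hM⟩ := ENNReal.lt_iff_exists_nnreal_btwn.1 (lt_top_iff_ne_top.2 hfin)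
    exact ⟨M, frequently_lt_of_liminf_lt (by isBoundedDefault) hM.1⟩
  have h3 : ∃ᶠ k in atTop, ‖(x k).snd‖ ^ 2 ≤ 2 * M * (x k).fst := by
    refine hM.mono fun k hk => (norm_sq_le_of_energyDensity ha hγ (hx k)).trans ?_
    have h4 : energyDensity a γ (x k) ≤ M := by
      have := (ENNReal.ofReal_le_iff_le_toReal ENNReal.coe_ne_top).1 hk.le
      simpa using this
    exact mul_le_mul_of_nonneg_right (by linarith) (hx k).1
  have h5 := le_of_tendsto_of_frequently_le (h2.norm.pow 2) (h1.const_mul (2 * (M : ℝ))) h3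
  rw [h0, mul_zero] at h5
  exact norm_eq_zero.1 (pow_eq_zero_iff two_ne_zero |>.1 (le_antisymm h5 (sq_nonneg _)))

/-- Away from vacuum the density is continuous; at vacuum its value is zero and there is nothing to
prove. -/
theorem IsFluidDensity.ofReal_le_liminf {f : State d → ℝ} (hf : IsFluidDensity f)
    {x : ℕ → State d} {u : State d} (hu : Tendsto x atTop (𝓝 u)) {c : ℝ} :
    ENNReal.ofReal (c * f u) ≤ liminf (fun k => ENNReal.ofReal (c * f (x k))) atTop := by
  by_cases h : 0 < u.fst
  · have h1 : Tendsto (fun k => ENNReal.ofReal (c * f (x k))) atTop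
        (𝓝 (ENNReal.ofReal (c * f u))) :=
      ENNReal.tendsto_ofReal ((((hf.continuousAt u h).tendsto).comp hu).const_mul c)
    exact h1.liminf_eq.ge
  · rw [hf.vacuum u h]
    simp

variable {ns : ℕ → ℕ} {u : Y → State d} {f : State d → ℝ} {φ : Y → ℝ}

theorem aemeasurable_weightedMean_state (hU : ∀ n, AEMeasurable (U n) Q) (N : ℕ) :
    AEMeasurable (fun y => weightedMean 1 N (fun n => U n y)) Q :=
  (aestronglyMeasurable_weightedMean N fun n => (hU n).aestronglyMeasurable).aemeasurable

theorem IsFluidDensity.lintegral_weightedMean_le (hf : IsFluidDensity f)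
    (hUD : ∀ n, ∀ᵐ y ∂Q, U n y ∈ stateSpace d) (hφ0 : ∀ y, 0 ≤ φ y)
    (hint : ∀ n, Integrable (fun y => φ y * f (U n y)) Q) (N : ℕ) :
    ∫⁻ y, ENNReal.ofReal (φ y * f (weightedMean 1 N (fun n => U n y))) ∂Q
      ≤ ENNReal.ofReal (weightedMean 1 N (fun n => ∫ y, φ y * f (U n y) ∂Q)) := by
  rw [← integral_weightedMean N hint, ofReal_integral_eq_lintegral_ofReal
    (integrable_weightedMean N hint) (Eventually.of_forall fun y =>
      weightedMean_nonneg isAveraging_one fun n => mul_nonneg (hφ0 y) (hf.nonneg _))]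
  refine lintegral_mono_ae ?_
  filter_upwards [ae_all_iff.2 hUD] with y hy
  refine ENNReal.ofReal_le_ofReal ?_
  rw [weightedMean_const_mul]
  exact mul_le_mul_of_nonneg_left (hf.weightedMean_le hy N) (hφ0 y)

/-- Fatou's lemma along the almost everywhere convergent averages, then Jensen's inequality for each
average. -/
theorem IsFluidDensity.lintegral_le_liminf (hf : IsFluidDensity f)
    (hU : ∀ n, AEMeasurable (U n) Q)
    (hUD : ∀ n, ∀ᵐ y ∂Q, U n y ∈ stateSpace d) (hφ : AEMeasurable φ Q) (hφ0 : ∀ y, 0 ≤ φ y)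
    (hint : ∀ n, Integrable (fun y => φ y * f (U n y)) Q)
    (hae : ∀ᵐ y ∂Q, Tendsto (fun k => weightedMean 1 (ns k) (fun n => U n y)) atTop (𝓝 (u y))) :
    ∫⁻ y, ENNReal.ofReal (φ y * f (u y)) ∂Q ≤ liminf (fun k => ENNReal.ofReal
      (weightedMean 1 (ns k) (fun n => ∫ y, φ y * f (U n y) ∂Q))) atTop := by
  calc ∫⁻ y, ENNReal.ofReal (φ y * f (u y)) ∂Q
      ≤ ∫⁻ y, liminf (fun k => ENNReal.ofReal
          (φ y * f (weightedMean 1 (ns k) (fun n => U n y)))) atTop ∂Q := by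
        refine lintegral_mono_ae ?_
        filter_upwards [hae] with y hy using hf.ofReal_le_liminf hy
    _ ≤ liminf (fun k => ∫⁻ y, ENNReal.ofReal
          (φ y * f (weightedMean 1 (ns k) (fun n => U n y))) ∂Q) atTop :=
        lintegral_liminf_le' fun k => (hφ.mul
          (hf.measurable.comp_aemeasurable (aemeasurable_weightedMean_state hU _))).ennreal_ofReal
    _ ≤ _ := liminf_le_liminf (Eventually.of_forall fun k =>
        hf.lintegral_weightedMean_le hUD hφ0 hint _)

/-- The integral of a convex density at the limit of the averages is bounded by any limit of the
averaged integrals. -/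
theorem IsFluidDensity.lintegral_le_of_tendsto (hf : IsFluidDensity f)
    (hU : ∀ n, AEMeasurable (U n) Q)
    (hUD : ∀ n, ∀ᵐ y ∂Q, U n y ∈ stateSpace d) (hφ : AEMeasurable φ Q) (hφ0 : ∀ y, 0 ≤ φ y)
    (hint : ∀ n, Integrable (fun y => φ y * f (U n y)) Q)
    (hsub : ∀ ns : ℕ → ℕ, StrictMono ns → ∃ ms : ℕ → ℕ, StrictMono ms ∧ ∀ᵐ y ∂Q,
      Tendsto (fun k => weightedMean 1 (ns (ms k)) (fun n => U n y)) atTop (𝓝 (u y)))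
    {L : ℝ} {l : Filter ℕ} [NeBot l] (hl : l ≤ atTop)
    (hL : Tendsto (fun N => weightedMean 1 N (fun n => ∫ y, φ y * f (U n y) ∂Q)) l (𝓝 L)) :
    ∫⁻ y, ENNReal.ofReal (φ y * f (u y)) ∂Q ≤ ENNReal.ofReal L := by
  -- The limit along `l` is a cluster point, so it is attained along an ordinary subsequence;
  -- Fatou's lemma needs sequences, not ultrafilters.
  obtain ⟨ns, hns, hnL⟩ := (hL.mapClusterPt.mono hl).tendsto_subseq
  obtain ⟨ms, hms, hae⟩ := hsub ns hns
  refine (hf.lintegral_le_liminf hU hUD hφ hφ0 hint hae).trans (le_of_eq ?_)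
  exact (ENNReal.tendsto_ofReal (hnL.comp hms.tendsto_atTop)).liminf_eq

/-- Jensen and Fatou bound the integral of the lower limit of the energies of the averages, which is
therefore finite almost everywhere. -/
theorem ae_mem_stateSpace_of_tendsto (ha : 0 < a) (hγ : 1 < γ) (hU : ∀ n, AEMeasurable (U n) Q)
    (hUD : ∀ n, ∀ᵐ y ∂Q, U n y ∈ stateSpace d)
    (hint : ∀ n, Integrable (fun y => energyDensity a γ (U n y)) Q) {C : ℝ} (hC0 : 0 ≤ C)
    (hC : ∀ n, ∫ y, energyDensity a γ (U n y) ∂Q ≤ C)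
    (hae : ∀ᵐ y ∂Q, Tendsto (fun k => weightedMean 1 (ns k) (fun n => U n y)) atTop (𝓝 (u y))) :
    ∀ᵐ y ∂Q, u y ∈ stateSpace d := by
  have hf := isFluidDensity_energyDensity (d := d) ha hγ
  have hm : ∀ k, AEMeasurable (fun y => ENNReal.ofReal
      (energyDensity a γ (weightedMean 1 (ns k) (fun n => U n y)))) Q := fun k =>
    (hf.measurable.comp_aemeasurable (aemeasurable_weightedMean_state hU _)).ennreal_ofReal
  have h1 : ∫⁻ y, liminf (fun k => ENNReal.ofReal
      (energyDensity a γ (weightedMean 1 (ns k) (fun n => U n y)))) atTop ∂Q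
        ≤ ENNReal.ofReal C := by
    refine (lintegral_liminf_le' hm).trans (liminf_le_of_le (by isBoundedDefault) ?_)
    intro b hb
    obtain ⟨k, hk⟩ := hb.exists
    refine hk.trans ?_
    have := hf.lintegral_weightedMean_le (φ := fun _ => 1) hUD (fun _ => zero_le_one)
      (by simpa using hint) (ns k)
    simp only [one_mul] at this
    exact this.trans (ENNReal.ofReal_le_ofReal (weightedMean_le_of_le isAveraging_one hC0 hC))
  have hlim : AEMeasurable (fun y => liminf (fun k => ENNReal.ofReal
      (energyDensity a γ (weightedMean 1 (ns k) (fun n => U n y)))) atTop) Q := by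
    refine ⟨fun y => liminf (fun k => (hm k).mk _ y) atTop,
      Measurable.liminf fun k => (hm k).measurable_mk, ?_⟩
    filter_upwards [ae_all_iff.2 fun k => (hm k).ae_eq_mk] with y hy
    exact congrArg (fun x : ℕ → ℝ≥0∞ => liminf x atTop) (funext hy)
  have h2 := ae_lt_top' hlim (h1.trans_lt ENNReal.ofReal_lt_top).ne
  filter_upwards [h2, hae, ae_all_iff.2 hUD] with y hy1 hy2 hy3
  exact mem_stateSpace_of_tendsto ha hγ (fun k => weightedMean_mem_stateSpace hy3 _) hy2 hy1.ne

end Fatou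

end EulerS

namespace EulerS

/-! ### Energy bounds -/

section EnergyBounds

variable {d : ℕ} {a γ κ T : ℝ}

instance isFiniteMeasure_spaceTime (d : ℕ) (T : ℝ) : IsFiniteMeasure (spaceTime d T) := by
  unfold spaceTime
  infer_instance

/-- A state field of finite energy together with a Reynolds stress. -/
structure HasFiniteEnergy (a γ T : ℝ) (u : ℝ × Torus d → State d) (R : StressField d) :
    Prop where
  aemeasurable : AEMeasurable u (spaceTime d T)
  stress : IsReynoldsStress T R
  mem : ∀ᵐ y ∂(spaceTime d T), u y ∈ stateSpace d
  integrable : Integrable (fun y => energyDensity a γ (u y)) (spaceTime d T)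

/-- The energy of the state field and the Reynolds stress is bounded by `E` at almost every
time. -/
structure HasEnergyBound (a γ κ T E : ℝ) (u : ℝ × Torus d → State d) (R : StressField d) : Prop
    extends HasFiniteEnergy a γ T u R where
  slice_le : ∀ᵐ t ∂(volume.restrict (Ioo 0 T)),
    (∫ x, energyDensity a γ (u (t, x))) + κ * traceMass R t ≤ E

theorem aemeasurable_toState {ρ : ℝ × Torus d → ℝ} {m : ℝ × Torus d → Vec d}
    {μ : Measure (ℝ × Torus d)} (hρ : AEMeasurable ρ μ) (hm : AEMeasurable m μ) :
    AEMeasurable (toState ρ m) μ :=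
  (WithLp.prod_continuous_toLp 2 ℝ (Vec d)).measurable.comp_aemeasurable (hρ.prodMk hm)

theorem lintegral_energy_le (ha : 0 < a) (hγ : 1 < γ) {u : ℝ × Torus d → State d}
    (hu : AEMeasurable u (spaceTime d T)) {E : ℝ≥0}
    (hE : ∀ᵐ t ∂(volume.restrict (Ioo 0 T)),
      ∫⁻ x, energy a γ (u (t, x)).fst (u (t, x)).snd ≤ E) :
    ∫⁻ y, energy a γ (u y).fst (u y).snd ∂(spaceTime d T) ≤ E * ENNReal.ofReal T := by
  have hm : AEMeasurable (fun y => energy a γ (u y).fst (u y).snd) (spaceTime d T) :=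
    (measurable_energy ha hγ).comp_aemeasurable hu
  unfold spaceTime at hm ⊢
  rw [lintegral_prod _ hm]
  refine (lintegral_mono_ae hE).trans ?_
  simp

theorem hasEnergyBound (ha : 0 < a) (hγ : 1 < γ) {u : ℝ × Torus d → State d}
    (hu : AEMeasurable u (spaceTime d T)) {R : StressField d} (hR : IsReynoldsStress T R)
    {E : ℝ≥0} (hE : ∀ᵐ t ∂(volume.restrict (Ioo 0 T)),
      (∫⁻ x, energy a γ (u (t, x)).fst (u (t, x)).snd) + ENNReal.ofReal (κ * traceMass R t) ≤ E) :
    HasEnergyBound a γ κ T E u R := by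
  have hf := isFluidDensity_energyDensity (d := d) ha hγ
  have hlt := (lintegral_energy_le ha hγ hu (hE.mono fun t ht => le_self_add.trans ht)).trans_lt
    (ENNReal.mul_lt_top ENNReal.coe_lt_top ENNReal.ofReal_lt_top)
  have hmem : ∀ᵐ y ∂(spaceTime d T), u y ∈ stateSpace d := by
    filter_upwards [ae_lt_top' ((measurable_energy ha hγ).comp_aemeasurable hu) hlt.ne] with y hy
    exact energy_lt_top_iff.1 hy
  have hint : Integrable (fun y => energyDensity a γ (u y)) (spaceTime d T) := by
    refine ⟨(hf.measurable.comp_aemeasurable hu).aestronglyMeasurable, ?_⟩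
    rw [hasFiniteIntegral_iff_ofReal (Eventually.of_forall fun y => hf.nonneg _)]
    exact (lintegral_mono fun y => ofReal_energyDensity_le _).trans_lt hlt
  refine ⟨⟨hu, hR, hmem, hint⟩, ?_⟩
  unfold spaceTime at hint
  filter_upwards [hE, hint.prod_right_ae] with t h1 h2
  have h3 : ENNReal.ofReal (∫ x, energyDensity a γ (u (t, x)))
      ≤ ∫⁻ x, energy a γ (u (t, x)).fst (u (t, x)).snd := by
    rw [ofReal_integral_eq_lintegral_ofReal h2 (Eventually.of_forall fun x => hf.nonneg _)]
    exact lintegral_mono fun x => ofReal_energyDensity_le _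
  have h4 := (ENNReal.ofReal_add_le.trans (add_le_add_left h3 _)).trans h1
  simpa using (ENNReal.ofReal_le_iff_le_toReal ENNReal.coe_ne_top).1 h4

variable {E : ℝ} {u : ℝ × Torus d → State d} {R : StressField d}

theorem integral_spaceTime {f : ℝ × Torus d → ℝ} (hf : Integrable f (spaceTime d T)) :
    ∫ y, f y ∂(spaceTime d T) = ∫ t in Ioo 0 T, ∫ x, f (t, x) := by
  unfold spaceTime at hf ⊢
  exact integral_prod _ hf

theorem ae_traceMass_nonneg (hR : IsReynoldsStress T R) :
    ∀ᵐ t ∂(volume.restrict (Ioo 0 T)), 0 ≤ traceMass R t := by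
  filter_upwards [hR.isPSD] with t ht
  exact Finset.sum_nonneg fun i _ => ht.diag_nonneg i

theorem HasEnergyBound.ae_traceMass_le (h : HasEnergyBound a γ κ T E u R) (ha : 0 < a)
    (hγ : 1 < γ) (hκ : 0 < κ) :
    ∀ᵐ t ∂(volume.restrict (Ioo 0 T)), traceMass R t ≤ E / κ := by
  filter_upwards [h.slice_le] with t ht
  have : 0 ≤ ∫ x, energyDensity a γ (u (t, x)) :=
    integral_nonneg fun x => (isFluidDensity_energyDensity ha hγ).nonneg _
  rw [le_div_iff₀ hκ]
  linarith

theorem HasEnergyBound.ae_integral_le (h : HasEnergyBound a γ κ T E u R) (hκ : 0 < κ) :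
    ∀ᵐ t ∂(volume.restrict (Ioo 0 T)), ∫ x, energyDensity a γ (u (t, x)) ≤ E := by
  filter_upwards [h.slice_le, ae_traceMass_nonneg h.stress] with t ht h0
  have : 0 ≤ κ * traceMass R t := by positivity
  linarith

theorem integrable_mul_density {f : State d → ℝ} (hu : AEMeasurable u (spaceTime d T))
    (hf : Measurable f) {K : ℝ} (hfK : ∀ v, |f v| ≤ K * energyDensity a γ v)
    (hint : Integrable (fun y => energyDensity a γ (u y)) (spaceTime d T))
    (Φ : C_c(ℝ × Torus d, ℝ)) : Integrable (fun y => Φ y * f (u y)) (spaceTime d T) := by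
  obtain ⟨M, hM0, hM⟩ := exists_bound_of_compactlySupported Φ
  have h1 : Integrable (fun y => f (u y)) (spaceTime d T) :=
    (hint.const_mul K).mono' (hf.comp_aemeasurable hu).aestronglyMeasurable
      (Eventually.of_forall fun y => hfK _)
  exact h1.bdd_mul Φ.continuous.measurable.aestronglyMeasurable (Eventually.of_forall hM)

/-- The densities of the stress tensor, `1_{ϱ>0} m_i m_j / ϱ + p(ϱ) δ_{ij}`. -/
noncomputable def stressDensity (a γ : ℝ) (i j : Fin d) (u : State d) : ℝ :=
  convective u.fst u.snd i j + if i = j then a * densityPow γ u else 0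

theorem stressDensity_symm (i j : Fin d) (v : State d) :
    stressDensity a γ i j v = stressDensity a γ j i v := by
  unfold stressDensity convective
  simp only [mul_comm (v.snd i), eq_comm (a := i)]

theorem measurable_stressDensity (hγ : 1 < γ) (i j : Fin d) :
    Measurable (stressDensity (d := d) a γ i j) := by
  refine Measurable.add ?_ ?_
  · exact Measurable.ite (measurableSet_lt measurable_const measurable_fst_state)
      (((continuous_snd_apply i).measurable.mul (continuous_snd_apply j).measurable).div
        measurable_fst_state) measurable_const
  · split_ifs
    · exact (isFluidDensity_densityPow hγ).measurable.const_mul a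
    · exact measurable_const

theorem fluxTrace_le_energyDensity (ha : 0 < a) (hγ : 1 < γ) (v : State d) :
    fluxTrace v ≤ 2 * energyDensity a γ v := by
  have : 0 ≤ a / (γ - 1) * densityPow γ v :=
    mul_nonneg (div_nonneg ha.le (by linarith)) ((isFluidDensity_densityPow hγ).nonneg v)
  unfold energyDensity
  linarith

theorem densityPow_le_energyDensity (ha : 0 < a) (hγ : 1 < γ) (v : State d) :
    a * densityPow γ v ≤ (γ - 1) * energyDensity a γ v := by
  have h1 := isFluidDensity_fluxTrace.nonneg v
  have h2 : 0 < γ - 1 := by linarith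
  have h3 : (γ - 1) * (a / (γ - 1) * densityPow γ v) = a * densityPow γ v := by
    field_simp
  unfold energyDensity
  rw [mul_add, h3]
  have : 0 ≤ (γ - 1) * (1 / 2 * fluxTrace v) := by positivity
  linarith

theorem abs_stressDensity_le (ha : 0 < a) (hγ : 1 < γ) (i j : Fin d) (v : State d) :
    |stressDensity a γ i j v| ≤ (γ + 1) * energyDensity a γ v := by
  have h1 := fluxTrace_le_energyDensity ha hγ v
  have h2 := densityPow_le_energyDensity ha hγ v
  have h3 : 0 ≤ a * densityPow γ v := mul_nonneg ha.le ((isFluidDensity_densityPow hγ).nonneg v)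
  have h4 : |convective v.fst v.snd i j| ≤ fluxTrace v := by
    rw [fluxTrace_eq]
    unfold convective
    split_ifs with h
    · rw [abs_div, abs_of_pos h, abs_mul]
      refine div_le_div_of_nonneg_right ?_ h.le
      rw [pow_two]
      exact mul_le_mul (PiLp.norm_apply_le v.snd i) (PiLp.norm_apply_le v.snd j) (abs_nonneg _)
        (norm_nonneg _)
    · simp
  have h5 : |if i = j then a * densityPow γ v else 0| ≤ a * densityPow γ v := by
    split_ifs
    · rw [abs_of_nonneg h3]
    · rwa [abs_zero]
  have h6 := abs_add_le (convective v.fst v.snd i j) (if i = j then a * densityPow γ v else 0)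
  unfold stressDensity
  linarith

/-- The quadratic form of the stress tensor in direction `ξ`. -/
noncomputable def stressQuad (a γ : ℝ) (ξ : Fin d → ℝ) (v : State d) : ℝ :=
  flux ξ v + a * (∑ i, ξ i ^ 2) * densityPow γ v

theorem quad_stressDensity (ξ : Fin d → ℝ) (v : State d) :
    quad (fun i j => stressDensity a γ i j v) ξ = stressQuad a γ ξ v := by
  unfold stressQuad
  rw [← quad_convective]
  unfold quad stressDensity
  simp only [mul_add, Finset.sum_add_distrib, mul_ite, mul_zero, Finset.sum_ite_eq,
    Finset.mem_univ, if_true]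
  congr 1
  rw [Finset.mul_sum, Finset.sum_mul]
  exact Finset.sum_congr rfl fun i _ => by ring

theorem isFluidDensity_stressQuad (ha : 0 < a) (hγ : 1 < γ) (ξ : Fin d → ℝ) :
    IsFluidDensity (stressQuad a γ ξ) :=
  (isFluidDensity_flux ξ).add ((isFluidDensity_densityPow hγ).const_mul
    (mul_nonneg ha.le (Finset.sum_nonneg fun _ _ => sq_nonneg _)))

theorem exists_stressQuad_le (ha : 0 < a) (hγ : 1 < γ) (ξ : Fin d → ℝ) :
    ∃ K, 0 ≤ K ∧ ∀ v : State d, |stressQuad a γ ξ v| ≤ K * energyDensity a γ v := by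
  refine ⟨∑ i, ∑ j, |ξ i * ξ j| * (γ + 1), Finset.sum_nonneg fun i _ =>
    Finset.sum_nonneg fun j _ => by positivity, fun v => ?_⟩
  rw [← quad_stressDensity, quad, Finset.sum_mul]
  refine (Finset.abs_sum_le_sum_abs _ _).trans (Finset.sum_le_sum fun i _ => ?_)
  rw [Finset.sum_mul]
  refine (Finset.abs_sum_le_sum_abs _ _).trans (Finset.sum_le_sum fun j _ => ?_)
  rw [abs_mul, mul_assoc]
  exact mul_le_mul_of_nonneg_left (abs_stressDensity_le ha hγ i j v) (abs_nonneg _)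

theorem sum_stressDensity_diag (v : State d) :
    ∑ i, stressDensity a γ i i v = fluxTrace v + d * (a * densityPow γ v) := by
  have h : ∀ i : Fin d, stressDensity a γ i i v
      = flux (Pi.single i 1) v + a * densityPow γ v := by
    intro i
    rw [← quad_convective, quad_single]
    simp [stressDensity]
  simp only [h, Finset.sum_add_distrib, fluxTrace]
  simp

end EnergyBounds

end EulerS

namespace EulerS

/-! ### The total stress as a functional -/

section Pairing

variable {d : ℕ} {a γ κ T E : ℝ} {u : ℝ × Torus d → State d} {R : StressField d}

theorem HasEnergyBound.mono (h : HasEnergyBound a γ κ T E u R) {E' : ℝ} (hE : E ≤ E') :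
    HasEnergyBound a γ κ T E' u R :=
  ⟨h.toHasFiniteEnergy, h.slice_le.mono fun _ ht => ht.trans hE⟩

theorem integral_Ioo_const (hT : 0 < T) (c : ℝ) : ∫ _t in Ioo 0 T, c = T * c := by
  simp [hT.le]

theorem HasEnergyBound.integral_energy_le (h : HasEnergyBound a γ κ T E u R) (hT : 0 < T)
    (hκ : 0 < κ) : ∫ y, energyDensity a γ (u y) ∂(spaceTime d T) ≤ T * E := by
  have h1 := h.integrable
  rw [integral_spaceTime h1, ← integral_Ioo_const hT]
  unfold spaceTime at h1
  exact integral_mono_ae h1.integral_prod_left (integrable_const _) (h.ae_integral_le hκ)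

theorem HasFiniteEnergy.integrable_stress (h : HasFiniteEnergy a γ T u R) (ha : 0 < a)
    (hγ : 1 < γ) (i j : Fin d) (Φ : C_c(ℝ × Torus d, ℝ)) :
    Integrable (fun y => Φ y * stressDensity a γ i j (u y)) (spaceTime d T) :=
  integrable_mul_density h.aemeasurable (measurable_stressDensity hγ i j)
    (abs_stressDensity_le ha hγ i j) h.integrable Φ

/-- The functional given by the stress tensor of a state field. -/
noncomputable def densityPairing (a γ T : ℝ) (u : ℝ × Torus d → State d) (i j : Fin d)
    (Φ : C_c(ℝ × Torus d, ℝ)) : ℝ :=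
  ∫ y, Φ y * stressDensity a γ i j (u y) ∂(spaceTime d T)

theorem densityPairing_add (hi : ∀ Φ : C_c(ℝ × Torus d, ℝ),
      Integrable (fun y => Φ y * stressDensity a γ i j (u y)) (spaceTime d T))
    (Φ Φ' : C_c(ℝ × Torus d, ℝ)) : densityPairing a γ T u i j (Φ + Φ')
      = densityPairing a γ T u i j Φ + densityPairing a γ T u i j Φ' := by
  unfold densityPairing
  rw [← integral_add (hi Φ) (hi Φ')]
  congr 1 with y
  simp [add_mul]

theorem densityPairing_smul (i j : Fin d) (c : ℝ) (Φ : C_c(ℝ × Torus d, ℝ)) :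
    densityPairing a γ T u i j (c • Φ) = c * densityPairing a γ T u i j Φ := by
  unfold densityPairing
  rw [← integral_const_mul]
  congr 1 with y
  simp [mul_assoc]

theorem densityPairing_symm (i j : Fin d) (Φ : C_c(ℝ × Torus d, ℝ)) :
    densityPairing a γ T u i j Φ = densityPairing a γ T u j i Φ := by
  unfold densityPairing
  simp only [stressDensity_symm i j]

/-- The functional given by the stress tensor and the Reynolds stress. -/
noncomputable def HasFiniteEnergy.pairing (h : HasFiniteEnergy a γ T u R) (ha : 0 < a)
    (hγ : 1 < γ) (i j : Fin d) : C_c(ℝ × Torus d, ℝ) →ₗ[ℝ] ℝ where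
  toFun Φ := densityPairing a γ T u i j Φ + stressFunctional T R i j Φ
  map_add' Φ Φ' := by
    rw [densityPairing_add (h.integrable_stress ha hγ i j), h.stress.stressFunctional_add]
    ring
  map_smul' c Φ := by
    rw [densityPairing_smul, stressFunctional_smul, RingHom.id_apply, smul_eq_mul]
    ring

/-- The spatial integrals of the stress tensor and the Reynolds stress at a given time. -/
noncomputable def stressSlice (a γ : ℝ) (u : ℝ × Torus d → State d) (R : StressField d)
    (i j : Fin d) (Φ : C_c(ℝ × Torus d, ℝ)) (t : ℝ) : ℝ :=
  (∫ x, Φ (t, x) * stressDensity a γ i j (u (t, x))) + ∫ᵛ x, Φ (t, x) ∂•(R t i j)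

theorem HasFiniteEnergy.integrable_stressSlice (h : HasFiniteEnergy a γ T u R) (ha : 0 < a)
    (hγ : 1 < γ) (i j : Fin d) (Φ : C_c(ℝ × Torus d, ℝ)) :
    Integrable (stressSlice a γ u R i j Φ) (volume.restrict (Ioo 0 T)) := by
  have h1 := h.integrable_stress ha hγ i j Φ
  unfold spaceTime at h1
  exact h1.integral_prod_left.add (h.stress.integrable i j Φ)

theorem HasFiniteEnergy.pairing_eq (h : HasFiniteEnergy a γ T u R) (ha : 0 < a)
    (hγ : 1 < γ) (i j : Fin d) (Φ : C_c(ℝ × Torus d, ℝ)) :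
    h.pairing ha hγ i j Φ = ∫ t in Ioo 0 T, stressSlice a γ u R i j Φ t := by
  have h1 := h.integrable_stress ha hγ i j Φ
  have h2 : h.pairing ha hγ i j Φ
      = densityPairing a γ T u i j Φ + stressFunctional T R i j Φ := rfl
  rw [h2, densityPairing, integral_spaceTime h1, stressFunctional]
  unfold spaceTime at h1
  exact (integral_add h1.integral_prod_left (h.stress.integrable i j Φ)).symm

theorem HasFiniteEnergy.pairing_symm (h : HasFiniteEnergy a γ T u R) (ha : 0 < a)
    (hγ : 1 < γ) (i j : Fin d) (Φ : C_c(ℝ × Torus d, ℝ)) :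
    h.pairing ha hγ i j Φ = h.pairing ha hγ j i Φ := by
  rw [h.pairing_eq, h.pairing_eq]
  refine integral_congr_ae ?_
  filter_upwards [h.stress.symm] with t ht
  unfold stressSlice
  rw [ht i j]
  simp only [stressDensity_symm i j]

theorem HasFiniteEnergy.ae_integrable_slice (h : HasFiniteEnergy a γ T u R) :
    ∀ᵐ t ∂(volume.restrict (Ioo 0 T)), Integrable (fun x => energyDensity a γ (u (t, x))) := by
  have h1 := h.integrable
  unfold spaceTime at h1
  exact h1.prod_right_ae

theorem HasFiniteEnergy.ae_aemeasurable_slice (h : HasFiniteEnergy a γ T u R) :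
    ∀ᵐ t ∂(volume.restrict (Ioo 0 T)), AEMeasurable (fun x => u (t, x)) := by
  have h1 := h.aemeasurable.aestronglyMeasurable
  unfold spaceTime at h1
  filter_upwards [h1.prodMk_left] with t ht using ht.aemeasurable

theorem HasFiniteEnergy.ae_integrable_density (h : HasFiniteEnergy a γ T u R)
    {f : State d → ℝ} (hf : Measurable f) {K : ℝ} (hfK : ∀ v, |f v| ≤ K * energyDensity a γ v) :
    ∀ᵐ t ∂(volume.restrict (Ioo 0 T)), Integrable (fun x => f (u (t, x))) := by
  filter_upwards [h.ae_integrable_slice, h.ae_aemeasurable_slice] with t h1 h2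
  exact (h1.const_mul K).mono' (hf.comp_aemeasurable h2).aestronglyMeasurable
    (Eventually.of_forall fun x => hfK _)

/-- The null set of times is chosen before `Φ`, and `Φ` is bounded only on the slice at `t`. This
pointwise form in time is what makes the limit stress essentially bounded in time. -/
theorem HasEnergyBound.ae_abs_stressSlice_le (h : HasEnergyBound a γ κ T E u R) (ha : 0 < a)
    (hγ : 1 < γ) (hκ : 0 < κ) (i j : Fin d) :
    ∀ᵐ t ∂(volume.restrict (Ioo 0 T)), ∀ (Φ : C_c(ℝ × Torus d, ℝ)) (M : ℝ), 0 ≤ M →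
      (∀ x, |Φ (t, x)| ≤ M) →
      |stressSlice a γ u R i j Φ t| ≤ M * ((γ + 1) * E + 3 * (E / κ)) := by
  filter_upwards [h.ae_integrable_slice, h.stress.isPSD, h.ae_integral_le hκ,
    h.ae_traceMass_le ha hγ hκ, h.ae_aemeasurable_slice] with t h1 h2 h3 h4 h5 Φ M hM0 hM
  have h6 : |∫ x, Φ (t, x) * stressDensity a γ i j (u (t, x))| ≤ M * ((γ + 1) * E) := by
    rw [← Real.norm_eq_abs]
    refine (norm_integral_le_of_norm_le (f := fun x => Φ (t, x) * stressDensity a γ i j (u (t, x)))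
      (h1.const_mul (M * (γ + 1))) (Eventually.of_forall fun x => ?_)).trans ?_
    · rw [norm_mul, mul_assoc]
      exact mul_le_mul (hM x) (abs_stressDensity_le ha hγ i j _) (norm_nonneg _) hM0
    · rw [integral_const_mul, mul_assoc]
      refine mul_le_mul_of_nonneg_left (mul_le_mul_of_nonneg_left h3 (by linarith)) hM0
  have h7 := h2.abs_integral_le i j (slice Φ t) hM hM0
  have h8 : 3 * M * traceMass R t ≤ M * (3 * (E / κ)) := by
    have := mul_le_mul_of_nonneg_left h4 hM0
    linarith
  unfold stressSlice
  refine (abs_add_le _ _).trans ?_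
  rw [mul_add]
  exact add_le_add h6 (h7.trans h8)

/-- The constant is independent of the state field and of its Reynolds stress, as the ultrafilter
limit of the averaged pairings requires. -/
theorem HasEnergyBound.exists_pairing_bound (ha : 0 < a) (hγ : 1 < γ) (hκ : 0 < κ) (C : ℝ)
    (Φ : C_c(ℝ × Torus d, ℝ)) : ∃ K, ∀ {u R} (h : HasEnergyBound a γ κ T C u R) (i j : Fin d),
      |h.pairing ha hγ i j Φ| ≤ K := by
  obtain ⟨M, hM0, hM⟩ := exists_bound_of_compactlySupported Φ
  refine ⟨∫ _t in Ioo 0 T, M * ((γ + 1) * C + 3 * (C / κ)), fun {u R} h i j => ?_⟩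
  rw [h.pairing_eq, ← Real.norm_eq_abs]
  refine norm_integral_le_of_norm_le (f := fun t => stressSlice a γ u R i j Φ t)
    (integrable_const _) ?_
  filter_upwards [h.ae_abs_stressSlice_le ha hγ hκ i j] with t ht
  exact ht Φ M hM0 fun x => hM _

theorem HasFiniteEnergy.quad_pairing (h : HasFiniteEnergy a γ T u R) (ha : 0 < a)
    (hγ : 1 < γ) (ξ : Fin d → ℝ) (Φ : C_c(ℝ × Torus d, ℝ)) :
    quad (fun i j => h.pairing ha hγ i j Φ) ξ
      = ∫ t in Ioo 0 T, quad (fun i j => stressSlice a γ u R i j Φ t) ξ := by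
  simp only [h.pairing_eq]
  exact quad_sum_integral (fun i j => h.integrable_stressSlice ha hγ i j Φ) ξ

theorem quad_densityPairing {Φ : C_c(ℝ × Torus d, ℝ)} (hi : ∀ i j, Integrable (fun y => Φ y * stressDensity a γ i j (u y))
      (spaceTime d T)) (ξ : Fin d → ℝ) :
    quad (fun i j => ∫ y, Φ y * stressDensity a γ i j (u y) ∂(spaceTime d T)) ξ
      = ∫ y, Φ y * stressQuad a γ ξ (u y) ∂(spaceTime d T) := by
  rw [quad_sum_integral hi]
  congr 1 with y
  rw [← quad_stressDensity, quad, quad, Finset.mul_sum]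
  refine Finset.sum_congr rfl fun i _ => ?_
  rw [Finset.mul_sum]
  exact Finset.sum_congr rfl fun j _ => by ring

theorem quad_add (M M' : Fin d → Fin d → ℝ) (ξ : Fin d → ℝ) :
    quad (fun i j => M i j + M' i j) ξ = quad M ξ + quad M' ξ := by
  simp [quad, mul_add, Finset.sum_add_distrib]

theorem quad_sub (M M' : Fin d → Fin d → ℝ) (ξ : Fin d → ℝ) :
    quad (fun i j => M i j - M' i j) ξ = quad M ξ - quad M' ξ := by
  simp [quad, mul_sub, Finset.sum_sub_distrib]

/-- The Reynolds stress contributes non-negatively in every direction and may be dropped. -/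
theorem HasFiniteEnergy.integral_stressQuad_le (h : HasFiniteEnergy a γ T u R) (ha : 0 < a)
    (hγ : 1 < γ) (ξ : Fin d → ℝ) {Φ : C_c(ℝ × Torus d, ℝ)} (hΦ : ∀ z, 0 ≤ Φ z) :
    ∫ y, Φ y * stressQuad a γ ξ (u y) ∂(spaceTime d T)
      ≤ quad (fun i j => h.pairing ha hγ i j Φ) ξ := by
  have h1 : quad (fun i j => h.pairing ha hγ i j Φ) ξ
      = (∫ y, Φ y * stressQuad a γ ξ (u y) ∂(spaceTime d T))
        + quad (fun i j => stressFunctional T R i j Φ) ξ := by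
    rw [← quad_densityPairing (fun i j => h.integrable_stress ha hγ i j Φ), ← quad_add]
    rfl
  rw [h1, le_add_iff_nonneg_right]
  unfold stressFunctional
  rw [quad_sum_integral (fun i j => h.stress.integrable i j Φ)]
  refine integral_nonneg_of_ae ?_
  filter_upwards [h.stress.isPSD] with t ht
  obtain ⟨M, -, hM⟩ := exists_bound_of_compactlySupported Φ
  have := (ht.quad_mem_Icc ξ (slice Φ t) (l := 0) (u := M) (fun x => hΦ _)
    (fun x => (abs_le.1 (hM _)).2)).1
  simpa using this

theorem HasEnergyBound.quad_pairing_le (h : HasEnergyBound a γ κ T E u R) (ha : 0 < a)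
    (hγ : 1 < γ) (hκ : 0 < κ) (ξ : Fin d → ℝ) {ψ : C_c(ℝ, ℝ)} (hψ : ∀ t, 0 ≤ ψ t) :
    quad (fun i j => h.pairing ha hγ i j (tensor ψ (oneC (Torus d)))) ξ
      ≤ (∑ i, ∑ j, |ξ i * ξ j|) * ((γ + 1) * E + 3 * (E / κ)) * ∫ t in Ioo 0 T, ψ t := by
  rw [h.quad_pairing, ← integral_const_mul]
  refine integral_mono_ae (integrable_quad (fun i j => h.integrable_stressSlice ha hγ i j _) ξ)
    (ψ.integrable.const_mul _) ?_
  filter_upwards [ae_all_iff.2 fun i => ae_all_iff.2 fun j =>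
    h.ae_abs_stressSlice_le ha hγ hκ i j] with t ht
  simp only [quad, Finset.sum_mul]
  refine Finset.sum_le_sum fun i _ => Finset.sum_le_sum fun j _ => ?_
  refine (le_abs_self _).trans ?_
  rw [abs_mul, mul_assoc, mul_comm _ (ψ t)]
  exact mul_le_mul_of_nonneg_left (ht i j _ (ψ t) (hψ t) fun x => by simp [abs_of_nonneg (hψ t)])
    (abs_nonneg _)

/-- The part of the energy which is not controlled by the trace of the stress tensor. -/
noncomputable def energyRemainder (a γ κ : ℝ) (v : State d) : ℝ :=
  (1 / 2 - κ) * fluxTrace v + (a / (γ - 1) - κ * d * a) * densityPow γ v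

theorem energyRemainder_eq (v : State d) : energyRemainder a γ κ v
    + κ * ∑ i, stressDensity a γ i i v = energyDensity a γ v := by
  rw [sum_stressDensity_diag]
  unfold energyRemainder energyDensity
  ring

/-- Here the restriction on `κ` enters: `κ ≤ 1/2` and `κ ≤ 1/(d(γ-1))` say that both coefficients
are non-negative. -/
theorem isFluidDensity_energyRemainder (hd : 1 ≤ d) (ha : 0 < a) (hγ : 1 < γ) (hκ₁ : κ ≤ 1 / 2)
    (hκ₂ : κ ≤ 1 / (d * (γ - 1))) : IsFluidDensity (energyRemainder (d := d) a γ κ) := by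
  refine (isFluidDensity_fluxTrace.const_mul (by linarith)).add
    ((isFluidDensity_densityPow hγ).const_mul ?_)
  have hd' : (0 : ℝ) < d := by exact_mod_cast hd
  have hγ' : 0 < γ - 1 := by linarith
  rw [le_div_iff₀ (by positivity)] at hκ₂
  rw [sub_nonneg, le_div_iff₀ hγ']
  nlinarith

theorem energyRemainder_le (ha : 0 < a) (hγ : 1 < γ) (hκ : 0 < κ) (v : State d) :
    energyRemainder a γ κ v ≤ energyDensity a γ v := by
  rw [← energyRemainder_eq (κ := κ), le_add_iff_nonneg_right, sum_stressDensity_diag]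
  have h1 := isFluidDensity_fluxTrace.nonneg v
  have h2 := (isFluidDensity_densityPow hγ).nonneg v
  positivity

theorem IsPSDMeasure.integral_slice_tensor {X : Type*} [TopologicalSpace X] [CompactSpace X]
    [PolishSpace X] [MeasurableSpace X] [BorelSpace X] {R : Fin d → Fin d → SignedMeasure X}
    (hR : IsPSDMeasure R) (i : Fin d) (c : ℝ) : ∫ᵛ _x, c ∂•(R i i) = c * R i i univ := by
  have h := hR.quad_mem_Icc (Pi.single i 1) (c • oneC X) (l := c) (u := c) (fun x => by simp)
    (fun x => by simp)
  simp only [quad_single] at h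
  have h' := le_antisymm h.2 h.1
  simpa using h'

/-- Total energy plus `κ` times the Reynolds trace equals the convex remainder plus `κ` times the
trace of the total stress. The second summand is a linear functional that passes to the limit
exactly; only the first needs semicontinuity. -/
theorem HasFiniteEnergy.energy_pairing (h : HasFiniteEnergy a γ T u R) (hd : 1 ≤ d) (ha : 0 < a)
    (hγ : 1 < γ) (hκ : 0 < κ) (hκ₁ : κ ≤ 1 / 2)
    (hκ₂ : κ ≤ 1 / (d * (γ - 1))) {ψ : C_c(ℝ, ℝ)} :
    (∫ y, ψ y.1 * energyRemainder a γ κ (u y) ∂(spaceTime d T))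
      + κ * ∑ i, h.pairing ha hγ i i (tensor ψ (oneC (Torus d)))
      = ∫ t in Ioo 0 T, ψ t * ((∫ x, energyDensity a γ (u (t, x))) + κ * traceMass R t) := by
  have hrem := isFluidDensity_energyRemainder (d := d) hd ha hγ hκ₁ hκ₂
  have hremK : ∀ v : State d, |energyRemainder a γ κ v| ≤ 1 * energyDensity a γ v := fun v => by
    rw [abs_of_nonneg (hrem.nonneg v), one_mul]
    exact energyRemainder_le ha hγ hκ v
  have h1 := integrable_mul_density h.aemeasurable hrem.measurable hremK h.integrable
    (tensor ψ (oneC (Torus d)))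
  simp only [tensor_apply, oneC_apply, mul_one] at h1
  have h2 : ∀ i, Integrable (stressSlice a γ u R i i (tensor ψ (oneC (Torus d))))
      (volume.restrict (Ioo 0 T)) := fun i => h.integrable_stressSlice ha hγ i i _
  simp only [h.pairing_eq]
  rw [integral_spaceTime h1, ← integral_finsetSum _ fun i _ => h2 i, ← integral_const_mul]
  have h3 := h1
  unfold spaceTime at h3
  rw [← integral_add h3.integral_prod_left
    ((integrable_finsetSum _ fun i _ => h2 i).const_mul κ)]
  refine integral_congr_ae ?_
  filter_upwards [h.stress.isPSD, h.ae_integrable_density hrem.measurable hremK,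
    ae_all_iff.2 fun i => h.ae_integrable_density (measurable_stressDensity hγ i i)
      (abs_stressDensity_le ha hγ i i)] with t ht h4 h5
  simp only [stressSlice, tensor_apply, oneC_apply, mul_one, Finset.sum_add_distrib,
    integral_const_mul, ht.integral_slice_tensor, ← Finset.mul_sum]
  rw [← integral_finsetSum _ fun i _ => h5 i]
  have h6 : ∫ x, energyDensity a γ (u (t, x)) = (∫ x, energyRemainder a γ κ (u (t, x)))
      + κ * ∫ x, ∑ i, stressDensity a γ i i (u (t, x)) := by
    rw [← integral_const_mul, ← integral_add h4
      ((integrable_finsetSum _ fun i _ => h5 i).const_mul κ)]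
    simp only [energyRemainder_eq]
  rw [h6, traceMass]
  ring

theorem HasEnergyBound.energy_pairing_le (h : HasEnergyBound a γ κ T E u R) (hd : 1 ≤ d)
    (ha : 0 < a) (hγ : 1 < γ) (hκ : 0 < κ) (hκ₁ : κ ≤ 1 / 2)
    (hκ₂ : κ ≤ 1 / (d * (γ - 1))) {ψ : C_c(ℝ, ℝ)} (hψ : ∀ t, 0 ≤ ψ t) :
    (∫ y, ψ y.1 * energyRemainder a γ κ (u y) ∂(spaceTime d T))
      + κ * ∑ i, h.pairing ha hγ i i (tensor ψ (oneC (Torus d)))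
      ≤ E * ∫ t in Ioo 0 T, ψ t := by
  rw [h.energy_pairing hd ha hγ hκ hκ₁ hκ₂, ← integral_const_mul]
  refine integral_mono_of_nonneg ?_ (ψ.integrable.const_mul _) ?_
  · filter_upwards [ae_traceMass_nonneg h.stress] with t ht
    have h1 : 0 ≤ ∫ x, energyDensity a γ (u (t, x)) :=
      integral_nonneg fun x => (isFluidDensity_energyDensity ha hγ).nonneg _
    exact mul_nonneg (hψ t) (by positivity)
  · filter_upwards [h.slice_le] with t ht
    rw [mul_comm E]
    exact mul_le_mul_of_nonneg_left ht (hψ t)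

end Pairing

end EulerS

namespace EulerS

/-! ### The limit of the averaged stresses -/

section Limit

variable {d : ℕ} {a γ κ T : ℝ}

theorem exists_tendsto_hyperfilter {s : ℕ → ℝ} {C : ℝ} (h : ∀ N, |s N| ≤ C) :
    ∃ L, Tendsto s (hyperfilter ℕ : Filter ℕ) (𝓝 L) := by
  obtain ⟨L, -, hL⟩ := (isCompact_Icc (a := -C) (b := C)).ultrafilter_le_nhds
    ((hyperfilter ℕ).map s) (by
      rw [Ultrafilter.coe_map, le_principal_iff, mem_map]
      exact Eventually.of_forall fun N => abs_le.1 (h N))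
  exact ⟨L, hL⟩

/-- The hypothesis compares the measures `g μ` and `c μ` on `C_c`, hence on all Borel sets, and
therefore their densities. -/
theorem ae_le_of_integral_mul_le {μ : Measure ℝ} [IsFiniteMeasure μ] {g : ℝ → ℝ} {c : ℝ}
    (hg : Integrable g μ) (hg0 : 0 ≤ᵐ[μ] g) (hc : 0 ≤ c)
    (h : ∀ ψ : C_c(ℝ, ℝ), (∀ t, 0 ≤ ψ t) → ∫ t, ψ t * g t ∂μ ≤ c * ∫ t, ψ t ∂μ) :
    ∀ᵐ t ∂μ, g t ≤ c := by
  have hm : AEMeasurable (fun t => ENNReal.ofReal (g t)) μ := hg.1.aemeasurable.ennreal_ofReal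
  have hfin : IsFiniteMeasure (μ.withDensity fun t => ENNReal.ofReal (g t)) := by
    refine isFiniteMeasure_withDensity ?_
    rw [← ofReal_integral_eq_lintegral_ofReal hg hg0]
    exact ENNReal.ofReal_ne_top
  have hfin' : IsFiniteMeasure (ENNReal.ofReal c • μ) :=
    Measure.smul_finite μ ENNReal.ofReal_ne_top
  have hle : μ.withDensity (fun t => ENNReal.ofReal (g t)) ≤ ENNReal.ofReal c • μ := by
    refine measure_le_of_integral_le fun ψ hψ => ?_
    rw [integral_smul_measure, ENNReal.toReal_ofReal hc,
      integral_withDensity_eq_integral_toReal_smul₀ hm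
        (Eventually.of_forall fun t => ENNReal.ofReal_lt_top)]
    refine le_trans (le_of_eq (integral_congr_ae ?_)) (h ψ hψ)
    filter_upwards [hg0] with t ht
    rw [ENNReal.toReal_ofReal ht, smul_eq_mul, mul_comm]
  have h1 : (fun t => ENNReal.ofReal (g t)) ≤ᵐ[μ] fun _ => ENNReal.ofReal c := by
    refine ae_le_of_forall_setLIntegral_le_of_sigmaFinite₀ hm fun s hs _ => ?_
    rw [← withDensity_apply _ hs, lintegral_const, Measure.restrict_apply_univ]
    exact hle s
  filter_upwards [h1] with t ht
  exact (ENNReal.ofReal_le_ofReal_iff hc).1 ht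

theorem weightedMean_quad (N : ℕ) (M : ℕ → Fin d → Fin d → ℝ) (ξ : Fin d → ℝ) :
    weightedMean 1 N (fun n => quad (M n) ξ) = quad (fun i j => weightedMean 1 N (M · i j)) ξ := by
  unfold quad
  rw [weightedMean_sum]
  refine Finset.sum_congr rfl fun i _ => ?_
  rw [weightedMean_sum]
  exact Finset.sum_congr rfl fun j _ => weightedMean_const_mul _ _ _

theorem weightedMean_apply {V : Type*} [AddCommGroup V] [Module ℝ V] (N : ℕ) (f : ℕ → V →ₗ[ℝ] ℝ)
    (v : V) : weightedMean 1 N f v = weightedMean 1 N (fun n => f n v) := by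
  simp [weightedMean_eq_sum, LinearMap.sum_apply]

/-- The averaged stresses of a sequence with bounded energy converge, along the hyperfilter, to
the stress of the limit of the averages together with a Reynolds stress. -/
theorem exists_limit_stress (hd : 1 ≤ d) (hT : 0 < T) (ha : 0 < a) (hγ : 1 < γ) (hκ : 0 < κ)
    (hκ₁ : κ ≤ 1 / 2) (hκ₂ : κ ≤ 1 / (d * (γ - 1)))
    {U : ℕ → ℝ × Torus d → State d} {Rn : ℕ → StressField d} {E : ℕ → ℝ} {E₀ : ℝ}
    (h : ∀ n, HasEnergyBound a γ κ T (E n) (U n) (Rn n)) (hE : Tendsto E atTop (𝓝 E₀))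
    (hE₀ : 0 ≤ E₀) {u : ℝ × Torus d → State d} (hu : AEMeasurable u (spaceTime d T))
    (hsub : ∀ ns : ℕ → ℕ, StrictMono ns → ∃ ms : ℕ → ℕ, StrictMono ms ∧ ∀ᵐ y ∂(spaceTime d T),
      Tendsto (fun k => weightedMean 1 (ns (ms k)) (fun n => U n y)) atTop (𝓝 (u y))) :
    ∃ R : StressField d, HasEnergyBound a γ κ T E₀ u R ∧
      ∀ i j (Φ : C_c(ℝ × Torus d, ℝ)),
        Tendsto (fun N => weightedMean 1 N (fun n => (h n).pairing ha hγ i j Φ))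
          (hyperfilter ℕ : Filter ℕ)
          (𝓝 (densityPairing a γ T u i j Φ + stressFunctional T R i j Φ)) := by
  have he := isFluidDensity_energyDensity (d := d) ha hγ
  have hle : (hyperfilter ℕ : Filter ℕ) ≤ atTop := Nat.hyperfilter_le_atTop
  have hU : ∀ n, AEMeasurable (U n) (spaceTime d T) := fun n => (h n).aemeasurable
  have hUD := fun n => (h n).mem
  obtain ⟨C, hC⟩ := hE.bddAbove_range
  have hC' : ∀ n, E n ≤ max C 0 := fun n => (hC ⟨n, rfl⟩).trans (le_max_left _ _)
  set K := max C 0 with hK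
  have hK0 : 0 ≤ K := le_max_right _ _
  have hUK : ∀ n, HasEnergyBound a γ κ T K (U n) (Rn n) := fun n => (h n).mono (hC' n)
  have hEint : ∀ n, ∫ y, energyDensity a γ (U n y) ∂(spaceTime d T) ≤ T * K := fun n =>
    (hUK n).integral_energy_le hT hκ
  have hTK : 0 ≤ T * K := by positivity
  have hmem : ∀ᵐ y ∂(spaceTime d T), u y ∈ stateSpace d := by
    obtain ⟨ms, -, hae⟩ := hsub id strictMono_id
    exact ae_mem_stateSpace_of_tendsto ha hγ hU hUD (fun n => (h n).integrable) hTK hEint hae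
  -- the integral of a density controlled by the energy is lower semicontinuous
  have hfatou : ∀ {f : State d → ℝ}, IsFluidDensity f → ∀ {B : ℝ}, 0 ≤ B →
      (∀ v, |f v| ≤ B * energyDensity a γ v) → ∀ {φ : ℝ × Torus d → ℝ} {M : ℝ}, 0 ≤ M →
      Measurable φ → (∀ y, 0 ≤ φ y) → (∀ y, φ y ≤ M) →
      ∃ L, Tendsto (fun N => weightedMean 1 N (fun n => ∫ y, φ y * f (U n y) ∂(spaceTime d T)))
          (hyperfilter ℕ : Filter ℕ) (𝓝 L) ∧ Integrable (fun y => φ y * f (u y)) (spaceTime d T) ∧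
        ∫ y, φ y * f (u y) ∂(spaceTime d T) ≤ L := by
    intro f hf B hB hfB φ M hM0 hφ hφ0 hφM
    have hint : ∀ n, Integrable (fun y => φ y * f (U n y)) (spaceTime d T) := fun n => by
      have h1 : Integrable (fun y => f (U n y)) (spaceTime d T) :=
        ((h n).integrable.const_mul B).mono'
          (hf.measurable.comp_aemeasurable (hU n)).aestronglyMeasurable
          (Eventually.of_forall fun y => hfB _)
      exact h1.bdd_mul (c := M) hφ.aestronglyMeasurable (Eventually.of_forall fun y => by
        rw [Real.norm_of_nonneg (hφ0 y)]; exact hφM y)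
    have hnn : ∀ n, 0 ≤ ∫ y, φ y * f (U n y) ∂(spaceTime d T) := fun n =>
      integral_nonneg fun y => mul_nonneg (hφ0 y) (hf.nonneg _)
    have hub : ∀ n, ∫ y, φ y * f (U n y) ∂(spaceTime d T) ≤ M * B * (T * K) := fun n => by
      refine (integral_mono (hint n) ((h n).integrable.const_mul (M * B)) fun y => ?_).trans ?_
      · change _ ≤ M * B * energyDensity a γ (U n y)
        rw [mul_assoc]
        exact mul_le_mul (hφM y) ((le_abs_self _).trans (hfB _)) (hf.nonneg _) hM0
      · rw [integral_const_mul]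
        exact mul_le_mul_of_nonneg_left (hEint n) (by positivity)
    obtain ⟨L, hL⟩ := exists_tendsto_hyperfilter (C := M * B * (T * K))
      (s := fun N => weightedMean 1 N (fun n => ∫ y, φ y * f (U n y) ∂(spaceTime d T)))
      fun N => norm_weightedMean_le_of_le (G := ℝ) isAveraging_one (by positivity) fun n => by
        rw [Real.norm_of_nonneg (hnn n)]; exact hub n
    have hL0 : 0 ≤ L := ge_of_tendsto' hL fun N => weightedMean_nonneg isAveraging_one hnn
    have hlin := hf.lintegral_le_of_tendsto hU hUD hφ.aemeasurable hφ0 hint hsub hle hL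
    have hiu : Integrable (fun y => φ y * f (u y)) (spaceTime d T) := by
      refine ⟨(hφ.aemeasurable.mul
        (hf.measurable.comp_aemeasurable hu)).aestronglyMeasurable, ?_⟩
      rw [hasFiniteIntegral_iff_ofReal
        (Eventually.of_forall fun y => mul_nonneg (hφ0 y) (hf.nonneg _))]
      exact hlin.trans_lt ENNReal.ofReal_lt_top
    refine ⟨L, hL, hiu, ?_⟩
    rw [← ofReal_integral_eq_lintegral_ofReal hiu
      (Eventually.of_forall fun y => mul_nonneg (hφ0 y) (hf.nonneg _))] at hlin
    exact (ENNReal.ofReal_le_ofReal_iff hL0).1 hlin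
  have hintu : Integrable (fun y => energyDensity a γ (u y)) (spaceTime d T) := by
    obtain ⟨L, -, hi, -⟩ := hfatou he zero_le_one (fun v => by
      rw [one_mul, abs_of_nonneg (he.nonneg v)]) (φ := fun _ => 1) zero_le_one measurable_const
      (fun _ => zero_le_one) (fun _ => le_rfl)
    simpa using hi
  have hintS : ∀ i j (Φ : C_c(ℝ × Torus d, ℝ)),
      Integrable (fun y => Φ y * stressDensity a γ i j (u y)) (spaceTime d T) := fun i j Φ =>
    integrable_mul_density hu (measurable_stressDensity hγ i j) (abs_stressDensity_le ha hγ i j)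
      hintu Φ
  -- `Λ` is the limit of the averaged total stresses; `D` below is the stress density of the
  -- averaged state. The new Reynolds stress will be `Λ - D`, which collects both the averaged
  -- Reynolds stresses and the defect due to oscillation and concentration.
  have hex : ∀ i j, ∃ Λ : C_c(ℝ × Torus d, ℝ) →ₗ[ℝ] ℝ, ∀ Φ, Tendsto
      (fun N => weightedMean 1 N (fun n => (h n).pairing ha hγ i j Φ))
      (hyperfilter ℕ : Filter ℕ) (𝓝 (Λ Φ)) := by
    intro i j
    obtain ⟨Λ, hΛ⟩ := exists_ultralimit
      (fun N => weightedMean 1 N (fun n => (h n).pairing ha hγ i j)) fun Φ => by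
        obtain ⟨B, hB⟩ := HasEnergyBound.exists_pairing_bound (T := T) ha hγ hκ K Φ
        refine ⟨B, fun N => ?_⟩
        rw [weightedMean_apply, ← Real.norm_eq_abs]
        exact norm_weightedMean_le_of_le isAveraging_one
          ((abs_nonneg _).trans (hB (hUK 0) i j)) fun n => hB (hUK n) i j
    exact ⟨Λ, fun Φ => (hΛ Φ).congr fun N => weightedMean_apply _ _ _⟩
  choose Λ hΛ using hex
  let D : Fin d → Fin d → C_c(ℝ × Torus d, ℝ) →ₗ[ℝ] ℝ := fun i j =>
    { toFun := densityPairing a γ T u i j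
      map_add' := densityPairing_add (hintS i j)
      map_smul' := fun c Φ => densityPairing_smul i j c Φ }
  have hD : ∀ i j Φ, D i j Φ = densityPairing a γ T u i j Φ := fun i j Φ => rfl
  have hquadΛ : ∀ ξ Φ, Tendsto (fun N => weightedMean 1 N (fun n =>
      quad (fun i j => (h n).pairing ha hγ i j Φ) ξ)) (hyperfilter ℕ : Filter ℕ)
      (𝓝 (quad (fun i j => Λ i j Φ) ξ)) := by
    intro ξ Φ
    simp only [weightedMean_quad]
    exact tendsto_finsetSum _ fun i _ => tendsto_finsetSum _ fun j _ => (hΛ i j Φ).const_mul _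
  have hquadN : ∀ ξ Φ, quad (fun i j => (Λ i j - D i j) Φ) ξ = quad (fun i j => Λ i j Φ) ξ
      - ∫ y, Φ y * stressQuad a γ ξ (u y) ∂(spaceTime d T) := by
    intro ξ Φ
    rw [← quad_densityPairing fun i j => hintS i j Φ, ← quad_sub]
    rfl
  have hNsym : ∀ i j Φ, (Λ i j - D i j) Φ = (Λ j i - D j i) Φ := by
    intro i j Φ
    have h1 : Λ i j Φ = Λ j i Φ := tendsto_nhds_unique (hΛ i j Φ) ((hΛ j i Φ).congr fun N => by
      simp only [(h _).pairing_symm ha hγ i j Φ])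
    rw [LinearMap.sub_apply, LinearMap.sub_apply, h1, hD, hD, densityPairing_symm]
  -- Convexity gives that the form of `D` is at most the limit of the averaged forms of the
  -- densities, and those are at most the forms of the total stresses.
  have hNpos : ∀ ξ (Φ : C_c(ℝ × Torus d, ℝ)), (∀ z, 0 ≤ Φ z) →
      0 ≤ quad (fun i j => (Λ i j - D i j) Φ) ξ := by
    intro ξ Φ hΦ
    rw [hquadN, sub_nonneg]
    obtain ⟨B, hB0, hB⟩ := exists_stressQuad_le (d := d) ha hγ ξ
    obtain ⟨M, hM0, hM⟩ := exists_bound_of_compactlySupported Φ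
    obtain ⟨L, hL, -, hle'⟩ := hfatou (isFluidDensity_stressQuad ha hγ ξ) hB0 hB hM0
      Φ.continuous.measurable hΦ fun y => (abs_le.1 (hM y)).2
    refine hle'.trans (le_of_tendsto_of_tendsto' hL (hquadΛ ξ Φ) fun N => ?_)
    exact weightedMean_mono isAveraging_one fun n => (h n).integral_stressQuad_le ha hγ ξ hΦ
  have hNbdd : ∀ ξ, ∃ c, 0 ≤ c ∧ ∀ ψ : C_c(ℝ, ℝ), (∀ t, 0 ≤ ψ t) →
      quad (fun i j => (Λ i j - D i j) (tensor ψ (oneC (Torus d)))) ξ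
        ≤ c * ∫ t in Ioo 0 T, ψ t := by
    intro ξ
    refine ⟨(∑ i, ∑ j, |ξ i * ξ j|) * ((γ + 1) * K + 3 * (K / κ)), ?_, fun ψ hψ => ?_⟩
    · have : 0 ≤ ∑ i, ∑ j, |ξ i * ξ j| :=
        Finset.sum_nonneg fun i _ => Finset.sum_nonneg fun j _ => abs_nonneg _
      have h1 : 0 < γ + 1 := by linarith
      positivity
    · rw [hquadN]
      have h1 : 0 ≤ ∫ y, tensor ψ (oneC (Torus d)) y * stressQuad a γ ξ (u y) ∂(spaceTime d T) :=
        integral_nonneg fun y => mul_nonneg (by simpa using hψ y.1)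
          ((isFluidDensity_stressQuad ha hγ ξ).nonneg _)
      have h2 := (hUK 0).quad_pairing_le ha hγ hκ ξ hψ
      have h3 := le_of_tendsto' (hquadΛ ξ (tensor ψ (oneC (Torus d)))) fun N =>
        weightedMean_le_of_le isAveraging_one ?_ fun n => (hUK n).quad_pairing_le ha hγ hκ ξ hψ
      · linarith
      · have h4 : 0 ≤ ∫ t in Ioo 0 T, ψ t := integral_nonneg hψ
        have h5 : 0 ≤ ∑ i, ∑ j, |ξ i * ξ j| :=
          Finset.sum_nonneg fun i _ => Finset.sum_nonneg fun j _ => abs_nonneg _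
        have h6 : 0 < γ + 1 := by linarith
        positivity
  obtain ⟨R, hR, hNR⟩ := exists_reynoldsStress (T := T) (fun i j => Λ i j - D i j) hNsym hNpos hNbdd
  have hlim : ∀ i j (Φ : C_c(ℝ × Torus d, ℝ)),
      Λ i j Φ = densityPairing a γ T u i j Φ + stressFunctional T R i j Φ := by
    intro i j Φ
    rw [← hNR i j Φ, LinearMap.sub_apply, hD]
    ring
  refine ⟨R, ?_, fun i j Φ => by rw [← hlim]; exact hΛ i j Φ⟩
  have h0 : HasFiniteEnergy a γ T u R := ⟨hu, hR, hmem, hintu⟩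
  refine ⟨h0, ?_⟩
  have hrem := isFluidDensity_energyRemainder (d := d) hd ha hγ hκ₁ hκ₂
  have hremK : ∀ v : State d, |energyRemainder a γ κ v| ≤ 1 * energyDensity a γ v := fun v => by
    rw [abs_of_nonneg (hrem.nonneg v), one_mul]
    exact energyRemainder_le ha hγ hκ v
  have hi1 : Integrable (fun t => ∫ x, energyDensity a γ (u (t, x)))
      (volume.restrict (Ioo 0 T)) := by
    have h1 := hintu
    unfold spaceTime at h1
    exact h1.integral_prod_left
  refine ae_le_of_integral_mul_le (hi1.add (hR.integrable_traceMass.const_mul κ)) ?_ hE₀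
    fun ψ hψ => ?_
  · filter_upwards [ae_traceMass_nonneg hR] with t ht
    have h1 : 0 ≤ ∫ x, energyDensity a γ (u (t, x)) := integral_nonneg fun x => he.nonneg _
    have h2 : 0 ≤ κ * traceMass R t := by positivity
    exact add_nonneg h1 h2
  -- The trace of the limit stress is the trace of `Λ`, so it converges with equality; the remainder
  -- is bounded by `hfatou`. On the right stand Cesàro means of `E n`, which tend to `E₀`.
  refine le_trans (le_of_eq (h0.energy_pairing hd ha hγ hκ hκ₁ hκ₂).symm) ?_
  obtain ⟨M, hM0, hM⟩ := exists_bound_of_compactlySupported ψ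
  obtain ⟨L, hL, -, hle'⟩ := hfatou hrem zero_le_one hremK hM0
    (ψ.continuous.measurable.comp measurable_fst) (fun y => hψ y.1)
    fun y => (abs_le.1 (hM y.1)).2
  have h1 : ∀ i, h0.pairing ha hγ i i (tensor ψ (oneC (Torus d)))
      = Λ i i (tensor ψ (oneC (Torus d))) := fun i => (hlim i i _).symm
  simp only [h1]
  have h2 := hL.add ((tendsto_finsetSum Finset.univ fun i _ =>
    hΛ i i (tensor ψ (oneC (Torus d)))).const_mul κ)
  have h3 : Tendsto (fun N => weightedMean 1 N fun n => E n * ∫ t in Ioo 0 T, ψ t)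
      (hyperfilter ℕ : Filter ℕ) (𝓝 (E₀ * ∫ t in Ioo 0 T, ψ t)) :=
    (tendsto_weightedMean_one (hE.mul_const _)).mono_left hle
  refine (add_le_add_left hle' _).trans (le_of_tendsto_of_tendsto' h2 h3 fun N => ?_)
  rw [← weightedMean_sum, ← weightedMean_const_mul, ← weightedMean_add]
  exact weightedMean_mono isAveraging_one fun n =>
    (h n).energy_pairing_le hd ha hγ hκ hκ₁ hκ₂ hψ

end Limit

end EulerS

namespace EulerS

/-! ### Test functions -/

section TestFunctions

variable {d : ℕ} {T : ℝ}

/-- The projection of `ℝ × ℝ^d` onto `ℝ × 𝕋^d`. -/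
def spaceTimeProj (d : ℕ) (z : ℝ × (Fin d → ℝ)) : ℝ × Torus d :=
  (z.1, fun i => (z.2 i : UnitAddCircle))

theorem isOpenQuotientMap_spaceTimeProj : IsOpenQuotientMap (spaceTimeProj d) :=
  IsOpenQuotientMap.prodMap (IsOpenQuotientMap.id (X := ℝ))
    (IsOpenQuotientMap.piMap fun _ : Fin d =>
      (QuotientAddGroup.isOpenQuotientMap_mk : IsOpenQuotientMap ((↑) : ℝ → UnitAddCircle)))

/-- Smoothness of test functions is formulated on the lift, so continuity of their derivatives is
checked there and descends through the quotient map. -/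
theorem continuous_of_comp_proj {f : ℝ × Torus d → ℝ} (hf : Continuous (f ∘ spaceTimeProj d)) :
    Continuous f :=
  isOpenQuotientMap_spaceTimeProj.isQuotientMap.continuous_iff.2 hf

variable {φ : ℝ × Torus d → ℝ}

theorem IsTestFunction.contDiff (hφ : IsTestFunction T φ) :
    ContDiff ℝ ∞ (φ ∘ spaceTimeProj d) := hφ.1

theorem IsTestFunction.continuous (hφ : IsTestFunction T φ) : Continuous φ :=
  continuous_of_comp_proj hφ.contDiff.continuous

theorem IsTestFunction.continuous_fderiv (hφ : IsTestFunction T φ) (v : ℝ × (Fin d → ℝ)) :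
    Continuous fun z => fderiv ℝ (φ ∘ spaceTimeProj d) z v :=
  (hφ.contDiff.continuous_fderiv (by simp)).clm_apply continuous_const

theorem IsTestFunction.hasFDerivAt (hφ : IsTestFunction T φ) (z : ℝ × (Fin d → ℝ)) :
    HasFDerivAt (φ ∘ spaceTimeProj d) (fderiv ℝ (φ ∘ spaceTimeProj d) z) z :=
  (hφ.contDiff.differentiable (by simp) z).hasFDerivAt

theorem IsTestFunction.continuous_dt (hφ : IsTestFunction T φ) : Continuous (dt φ) := by
  refine continuous_of_comp_proj ((hφ.continuous_fderiv (1, 0)).congr fun z => ?_)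
  have h1 : HasDerivAt (fun t : ℝ => (t, z.2)) ((1 : ℝ), (0 : Fin d → ℝ)) z.1 :=
    (hasDerivAt_id z.1).prodMk (hasDerivAt_const _ _)
  have h2 := (hφ.hasFDerivAt z).comp_hasDerivAt (f := fun t : ℝ => (t, z.2)) z.1 h1
  exact h2.deriv.symm

theorem IsTestFunction.continuous_dx (hφ : IsTestFunction T φ) (j : Fin d) :
    Continuous (dx j φ) := by
  refine continuous_of_comp_proj ((hφ.continuous_fderiv (0, Pi.single j 1)).congr fun z => ?_)
  have h1 : HasDerivAt (fun h : ℝ => (z.1, z.2 + h • Pi.single j 1))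
      ((0 : ℝ), (Pi.single j 1 : Fin d → ℝ)) 0 := by
    refine (hasDerivAt_const _ _).prodMk ?_
    simpa using ((hasDerivAt_id (0 : ℝ)).smul_const (Pi.single j 1 : Fin d → ℝ)).const_add z.2
  have hz : z = (z.1, z.2 + (0 : ℝ) • Pi.single j 1) := by simp
  have h0 := hφ.hasFDerivAt z
  have h2 := HasFDerivAt.comp_hasDerivAt (l := φ ∘ spaceTimeProj d)
    (l' := fderiv ℝ (φ ∘ spaceTimeProj d) z)
    (f := fun h : ℝ => (z.1, z.2 + h • Pi.single j 1)) 0 (by rw [← hz]; exact h0) h1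
  have h3 : (φ ∘ spaceTimeProj d) ∘ (fun h : ℝ => (z.1, z.2 + h • Pi.single j 1))
      = fun h : ℝ => φ ((spaceTimeProj d z).1,
        (spaceTimeProj d z).2 + Pi.single j (h : UnitAddCircle)) := by
    ext h
    simp only [Function.comp_apply, spaceTimeProj]
    congr 2
    ext i
    by_cases hi : i = j
    · subst hi
      simp
    · simp [hi]
  rw [h3] at h2
  exact h2.deriv.symm

theorem exists_bound_on_slab (T : ℝ) {f : ℝ × Torus d → ℝ} (hf : Continuous f) :
    ∃ K, 0 ≤ K ∧ ∀ t ∈ Icc 0 T, ∀ x, |f (t, x)| ≤ K := by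
  obtain ⟨K, hK⟩ := ((isCompact_Icc (a := (0 : ℝ)) (b := T)).prod
    (isCompact_univ (X := Torus d))).exists_bound_of_continuousOn hf.continuousOn
  exact ⟨max K 0, le_max_right _ _, fun t ht x =>
    (hK (t, x) ⟨ht, mem_univ x⟩).trans (le_max_left _ _)⟩

/-- Test functions vanish near `T` but are unrestricted for negative times, so their derivatives
need not have compact support. Only their values for `t ∈ [0,T]` enter the equations. -/
theorem exists_compactlySupported_eq (T : ℝ) {f : ℝ × Torus d → ℝ} (hf : Continuous f) :
    ∃ Φ : C_c(ℝ × Torus d, ℝ), ∀ t ∈ Icc 0 T, ∀ x, Φ (t, x) = f (t, x) := by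
  obtain ⟨θ, hθ1, -, -⟩ := exists_compactlySupported_between
    (isCompact_Icc (a := (0 : ℝ)) (b := T)) isOpen_univ (subset_univ _)
  refine ⟨⟨⟨fun y => tensor θ (oneC (Torus d)) y * f y,
    (tensor θ (oneC (Torus d))).continuous.mul hf⟩,
    (tensor θ (oneC (Torus d))).hasCompactSupport.mul_right⟩, fun t ht x => ?_⟩
  have := hθ1 t ht
  simp only [CompactlySupportedContinuousMap.coe_mk, ContinuousMap.coe_mk, tensor_apply,
    oneC_apply, this, one_mul]

theorem ae_mem_slab : ∀ᵐ y ∂(spaceTime d T), y.1 ∈ Ioo 0 T := by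
  have h : spaceTime d T = ((volume : Measure ℝ).prod volume).restrict (Ioo 0 T ×ˢ univ) := by
    rw [← Measure.prod_restrict, Measure.restrict_univ]
    rfl
  rw [h]
  filter_upwards [ae_restrict_mem (measurableSet_Ioo.prod MeasurableSet.univ)] with y hy
  exact hy.1

theorem integrable_mul_of_continuous {f g : ℝ × Torus d → ℝ} (hf : Integrable f (spaceTime d T))
    (hg : Continuous g) : Integrable (fun y => f y * g y) (spaceTime d T) := by
  obtain ⟨K, -, hK⟩ := exists_bound_on_slab T hg
  refine hf.mul_bdd (c := K) hg.measurable.aestronglyMeasurable ?_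
  filter_upwards [ae_mem_slab] with y hy
  exact hK y.1 (Ioo_subset_Icc_self hy) y.2

theorem tendsto_integral_weightedMean_mul {f : ℕ → ℝ × Torus d → ℝ} {g h : ℝ × Torus d → ℝ}
    (hf : ∀ n, Integrable (f n) (spaceTime d T)) (hh : Integrable h (spaceTime d T))
    (hlim : Tendsto (fun N => ∫ y, |weightedMean 1 N (fun n => f n y) - h y| ∂(spaceTime d T))
      atTop (𝓝 0)) (hg : Continuous g) :
    Tendsto (fun N => weightedMean 1 N (fun n => ∫ y, f n y * g y ∂(spaceTime d T))) atTop
      (𝓝 (∫ y, h y * g y ∂(spaceTime d T))) := by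
  obtain ⟨K, hK0, hK⟩ := exists_bound_on_slab T hg
  rw [tendsto_iff_norm_sub_tendsto_zero]
  refine squeeze_zero (fun _ => norm_nonneg _) (fun N => ?_) (by simpa using hlim.const_mul K)
  have hi : Integrable (fun y => weightedMean 1 N (fun n => f n y)) (spaceTime d T) :=
    integrable_weightedMean N hf
  have h1 : weightedMean 1 N (fun n => ∫ y, f n y * g y ∂(spaceTime d T))
      = ∫ y, weightedMean 1 N (fun n => f n y) * g y ∂(spaceTime d T) := by
    rw [← integral_weightedMean N fun n => integrable_mul_of_continuous (hf n) hg]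
    congr 1 with y
    simp only [mul_comm _ (g y), weightedMean_const_mul]
  rw [h1, ← integral_sub (integrable_mul_of_continuous hi hg) (integrable_mul_of_continuous hh hg),
    ← integral_const_mul]
  refine norm_integral_le_of_norm_le ((hi.sub hh).abs.const_mul K) ?_
  filter_upwards [ae_mem_slab] with y hy
  rw [← sub_mul, norm_mul, mul_comm]
  exact mul_le_mul_of_nonneg_right (hK y.1 (Ioo_subset_Icc_self hy) y.2) (norm_nonneg _)

end TestFunctions

end EulerS

namespace EulerS

/-! ### Convergence of the averages of density and momentum -/

section Averages

variable {d : ℕ} {γ T : ℝ} {w : ℝ → ℝ}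

/-- The expectation of the density. -/
noncomputable def meanDensity (V : Kernel (ℝ × Torus d) (State d)) (y : ℝ × Torus d) : ℝ :=
  ∫ u, u.fst ∂V y

/-- The expectation of the momentum. -/
noncomputable def meanMomentum (V : Kernel (ℝ × Torus d) (State d)) (y : ℝ × Torus d) : Vec d :=
  WithLp.toLp 2 fun i => ∫ u, u.snd i ∂V y

theorem norm_vec_le_sum (v : Vec d) : ‖v‖ ≤ ∑ i, |v i| := by
  have hv : v = ∑ i, v i • EuclideanSpace.single i (1 : ℝ) := by
    ext j
    simp [Pi.single_apply]
  calc ‖v‖ = ‖∑ i, v i • EuclideanSpace.single i (1 : ℝ)‖ := congrArg _ hv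
    _ ≤ ∑ i, ‖v i • EuclideanSpace.single i (1 : ℝ)‖ := norm_sum_le _ _
    _ = ∑ i, |v i| := by simp [norm_smul]

theorem aestronglyMeasurable_vec {α : Type*} [MeasurableSpace α] {μ : Measure α} {f : α → Vec d}
    (hf : ∀ i, AEStronglyMeasurable (fun y => f y i) μ) : AEStronglyMeasurable f μ := by
  have h : f = fun y => ∑ i, f y i • EuclideanSpace.single i (1 : ℝ) := by
    ext y j
    simp [Pi.single_apply]
  rw [h]
  exact Finset.aestronglyMeasurable_fun_sum _ fun i _ => (hf i).smul_const _

theorem memLp_vec {α : Type*} [MeasurableSpace α] {μ : Measure α} {f : α → Vec d} {p : ℝ≥0∞}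
    (hf : ∀ i, MemLp (fun y => f y i) p μ) : MemLp f p μ := by
  refine (memLp_finsetSum Finset.univ fun i _ => (hf i).norm).mono'
    (aestronglyMeasurable_vec fun i => (hf i).1) (Eventually.of_forall fun y => ?_)
  exact norm_vec_le_sum (f y)

theorem eLpNorm_vec_le {α : Type*} [MeasurableSpace α] {μ : Measure α} {f : α → Vec d} {p : ℝ≥0∞}
    (hp : 1 ≤ p) (hf : ∀ i, AEStronglyMeasurable (fun y => f y i) μ) :
    eLpNorm f p μ ≤ ∑ i, eLpNorm (fun y => f y i) p μ := by
  have h1 : eLpNorm f p μ ≤ eLpNorm (∑ i, fun y => |f y i|) p μ := by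
    refine eLpNorm_mono_real fun y => ?_
    simpa using norm_vec_le_sum (f y)
  refine h1.trans ((eLpNorm_sum_le (fun i _ => (hf i).norm) hp).trans (le_of_eq ?_))
  exact Finset.sum_congr rfl fun i _ => eLpNorm_norm _

theorem weightedMean_vec_apply (N : ℕ) (x : ℕ → Vec d) (i : Fin d) :
    weightedMean w N x i = weightedMean w N (fun n => x n i) := by
  simp [weightedMean_eq_sum]

theorem weightedMean_fst (N : ℕ) (x : ℕ → State d) :
    (weightedMean w N x).fst = weightedMean w N (fun n => (x n).fst) := by
  simp only [weightedMean_eq_sum]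
  exact map_sum (WithLp.fstₗ 2 ℝ ℝ (Vec d)) _ _

theorem weightedMean_snd (N : ℕ) (x : ℕ → State d) :
    (weightedMean w N x).snd = weightedMean w N (fun n => (x n).snd) := by
  simp only [weightedMean_eq_sum]
  exact map_sum (WithLp.sndₗ 2 ℝ ℝ (Vec d)) _ _

variable {ρn : ℕ → ℝ × Torus d → ℝ} {mn : ℕ → ℝ × Torus d → Vec d}
  {V : Kernel (ℝ × Torus d) (State d)} [IsMarkovKernel V] {C : ℝ≥0}

/-- The coordinates of the state and its norm have lower order than the growth function, exactly in
the stated ranges of exponents. The weight is arbitrary, so this serves both the Cesàro and the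
weighted averages. -/
theorem averagesConverge (hγ : 1 < γ) (hw : IsAveraging w)
    (hU : ∀ n, AEMeasurable (toState (ρn n) (mn n)) (spaceTime d T))
    (hC : ∀ n, ∫⁻ y, ENNReal.ofReal (eulerGrowth γ (toState (ρn n) (mn n) y)) ∂(spaceTime d T) ≤ C)
    (hV : MeansTendsto (spaceTime d T) w (fun n => toState (ρn n) (mn n)) V) :
    AveragesConverge γ T w ρn mn (meanDensity V) (meanMomentum V) V := by
  have hΨ := isGrowth_eulerGrowth (d := d) hγ
  refine ⟨fun q hq hqγ => ?_, fun q hq hqγ => ?_, hV.hasSLimit hw hU, fun s hs hsγ => ?_⟩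
  · exact hV.tendsto_eLpNorm hw hU hΨ hC (F := fun u => u.fst) (WithLp.continuous_fst ..) hq
      (isSmallGrowth_density (by linarith) hqγ)
  · have h := fun i => hV.tendsto_eLpNorm hw hU hΨ hC (F := fun u => u.snd i)
      (continuous_snd_apply i) hq (isSmallGrowth_momentum (by linarith) hqγ i)
    have hmem : MemLp (meanMomentum V) (ENNReal.ofReal q) (spaceTime d T) :=
      memLp_vec fun i => (h i).1
    refine ⟨hmem, ?_⟩
    have hlim : Tendsto (fun N => ∑ i, eLpNorm (fun y => weightedMean w N (fun n =>
        (toState (ρn n) (mn n) y).snd i) - ∫ u, u.snd i ∂V y) (ENNReal.ofReal q) (spaceTime d T))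
        atTop (𝓝 0) := by
      simpa using tendsto_finsetSum Finset.univ fun i _ => (h i).2
    refine tendsto_of_tendsto_of_tendsto_of_le_of_le tendsto_const_nhds hlim (fun _ => bot_le)
      fun N => ?_
    have happ : ∀ i, (fun y => (weightedMean w N (fun n => mn n y) - meanMomentum V y) i)
        = fun y => weightedMean w N (fun n => (toState (ρn n) (mn n) y).snd i)
          - ∫ u, u.snd i ∂V y := by
      intro i
      ext y
      simp only [PiLp.sub_apply, weightedMean_vec_apply]
      rfl
    have hm : ∀ n i, AEStronglyMeasurable (fun y => (toState (ρn n) (mn n) y).snd i)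
        (spaceTime d T) := fun n i =>
      ((continuous_snd_apply i).measurable.comp_aemeasurable (hU n)).aestronglyMeasurable
    refine (eLpNorm_vec_le (by rwa [ENNReal.one_le_ofReal]) fun i => ?_).trans (le_of_eq ?_)
    · rw [happ]
      exact (aestronglyMeasurable_weightedMean N fun n => hm n i).sub (h i).1.1
    · simp only [happ]
  · exact hV.tendsto_wassersteinDist hw hU hΨ hC hs (isSmallGrowth_norm hγ (by linarith) hsγ)

/-- Strong convergence of both averages, used with exponent one, provides the almost everywhere
convergence needed for Fatou's lemma in the limit of the stresses. -/
theorem AveragesConverge.exists_subseq {ρ : ℝ × Torus d → ℝ} {m : ℝ × Torus d → Vec d}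
    (hγ : 1 < γ) (h : AveragesConverge γ T w ρn mn ρ m V)
    (hρ : ∀ n, AEStronglyMeasurable (ρn n) (spaceTime d T))
    (hm : ∀ n, AEStronglyMeasurable (mn n) (spaceTime d T)) {ns : ℕ → ℕ} (hns : StrictMono ns) :
    ∃ ms : ℕ → ℕ, StrictMono ms ∧ ∀ᵐ y ∂(spaceTime d T),
      Tendsto (fun k => weightedMean w (ns (ms k)) (fun n => toState (ρn n) (mn n) y)) atTop
        (𝓝 (toState ρ m y)) := by
  have h1 := h.density 1 le_rfl hγ
  have h2 := h.momentum 1 le_rfl (one_lt_momentumExponent hγ)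
  have hne : ENNReal.ofReal 1 ≠ 0 := by simp
  obtain ⟨ms₁, hms₁, hae₁⟩ := TendstoInMeasure.exists_seq_tendsto_ae
    (tendstoInMeasure_of_tendsto_eLpNorm hne
      (fun k => aestronglyMeasurable_weightedMean (ns k) hρ) h1.1.1
      (h1.2.comp hns.tendsto_atTop))
  obtain ⟨ms₂, hms₂, hae₂⟩ := TendstoInMeasure.exists_seq_tendsto_ae
    (tendstoInMeasure_of_tendsto_eLpNorm hne
      (fun k => aestronglyMeasurable_weightedMean (ns (ms₁ k)) hm) h2.1.1
      (h2.2.comp (hns.comp hms₁).tendsto_atTop))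
  refine ⟨ms₁ ∘ ms₂, hms₁.comp hms₂, ?_⟩
  filter_upwards [hae₁, hae₂] with y hy₁ hy₂
  have h3 := (hy₁.comp hms₂.tendsto_atTop).prodMk_nhds hy₂
  have h4 := ((WithLp.prod_continuous_toLp 2 ℝ (Vec d)).tendsto _).comp h3
  refine h4.congr fun k => ?_
  have h5 : ∀ z : State d, WithLp.toLp 2 (z.fst, z.snd) = z := fun z => rfl
  rw [← h5 (weightedMean w _ _), weightedMean_fst, weightedMean_snd]
  rfl

theorem integrable_of_abs_le_growth {Y : Type*} [MeasurableSpace Y] {Q : Measure Y}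
    [IsFiniteMeasure Q] {U : Y → State d} (hU : AEMeasurable U Q)
    (hC : ∫⁻ y, ENNReal.ofReal (eulerGrowth γ (U y)) ∂Q ≤ C) (hγ : 1 < γ) {F : State d → ℝ}
    (hF : Measurable F) (hFΨ : ∀ u, |F u| ≤ 1 + eulerGrowth γ u) :
    Integrable (fun y => F (U y)) Q := by
  have h1 : Integrable (fun y => eulerGrowth γ (U y)) Q := by
    refine ⟨((isGrowth_eulerGrowth hγ).continuous.measurable.comp_aemeasurable
      hU).aestronglyMeasurable, ?_⟩
    rw [hasFiniteIntegral_iff_ofReal (Eventually.of_forall fun y => eulerGrowth_nonneg _)]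
    exact hC.trans_lt ENNReal.coe_lt_top
  exact ((integrable_const 1).add h1).mono' (hF.comp_aemeasurable hU).aestronglyMeasurable
    (Eventually.of_forall fun y => hFΨ _)

theorem abs_fst_le_growth (hγ : 1 < γ) (u : State d) : |u.fst| ≤ 1 + eulerGrowth γ u := by
  have h1 := le_one_add_rpow (abs_nonneg u.fst) hγ.le
  have : 0 ≤ ‖u.snd‖ ^ momentumExponent γ := by positivity
  unfold eulerGrowth
  linarith

theorem abs_snd_le_growth (hγ : 1 < γ) (i : Fin d) (u : State d) :
    |u.snd i| ≤ 1 + eulerGrowth γ u := by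
  have h1 := le_one_add_rpow (norm_nonneg u.snd) (one_lt_momentumExponent hγ).le
  have h2 : |u.snd i| ≤ ‖u.snd‖ := PiLp.norm_apply_le u.snd i
  have : 0 ≤ |u.fst| ^ γ := by positivity
  unfold eulerGrowth
  linarith

theorem tendsto_integral_abs_of_eLpNorm {α : Type*} [MeasurableSpace α] {μ : Measure α}
    {f : ℕ → α → ℝ} (hf : ∀ N, Integrable (f N) μ)
    (h : Tendsto (fun N => eLpNorm (f N) (ENNReal.ofReal 1) μ) atTop (𝓝 0)) :
    Tendsto (fun N => ∫ y, |f N y| ∂μ) atTop (𝓝 0) := by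
  have h1 := (ENNReal.tendsto_toReal ENNReal.zero_ne_top).comp h
  refine h1.congr fun N => ?_
  simp only [Function.comp_apply, ENNReal.ofReal_one, eLpNorm_one_eq_lintegral_enorm]
  exact (integral_norm_eq_lintegral_enorm (hf N).1).symm

/-- Averages of integrals of components of the state against continuous functions converge. -/
theorem tendsto_weightedMean_integral (hγ : 1 < γ) {U : ℕ → ℝ × Torus d → State d}
    (hU : ∀ n, AEMeasurable (U n) (spaceTime d T))
    (hC : ∀ n, ∫⁻ y, ENNReal.ofReal (eulerGrowth γ (U n y)) ∂(spaceTime d T) ≤ C)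
    (hV : MeansTendsto (spaceTime d T) 1 U V) {F : State d → ℝ} (hF : Continuous F)
    (hFs : IsSmallGrowth (eulerGrowth γ) F 1) (hFΨ : ∀ u, |F u| ≤ 1 + eulerGrowth γ u)
    {g : ℝ × Torus d → ℝ} (hg : Continuous g) :
    Integrable (fun y => ∫ u, F u ∂V y) (spaceTime d T) ∧
    Tendsto (fun N => weightedMean 1 N (fun n => ∫ y, F (U n y) * g y ∂(spaceTime d T))) atTop
      (𝓝 (∫ y, (∫ u, F u ∂V y) * g y ∂(spaceTime d T))) := by
  have h := hV.tendsto_eLpNorm isAveraging_one hU (isGrowth_eulerGrowth hγ) hC hF le_rfl hFs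
  have hi : ∀ n, Integrable (fun y => F (U n y)) (spaceTime d T) := fun n =>
    integrable_of_abs_le_growth (hU n) (hC n) hγ hF.measurable hFΨ
  have hV1 : Integrable (fun y => ∫ u, F u ∂V y) (spaceTime d T) := by
    have := h.1
    rwa [ENNReal.ofReal_one, memLp_one_iff_integrable] at this
  refine ⟨hV1, tendsto_integral_weightedMean_mul hi hV1 ?_ hg⟩
  exact tendsto_integral_abs_of_eLpNorm
    (f := fun N y => weightedMean 1 N (fun n => F (U n y)) - ∫ u, F u ∂V y)
    (fun N => (integrable_weightedMean N hi).sub hV1) h.2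

end Averages

end EulerS

namespace EulerS

/-! ### Weak formulations and initial data -/

section Equations

variable {d : ℕ} {a γ κ T E : ℝ} {u : ℝ × Torus d → State d} {R : StressField d}

theorem HasEnergyBound.ae_lintegral_energy_le (h : HasEnergyBound a γ κ T E u R) (ha : 0 < a)
    (hγ : 1 < γ) (hκ : 0 < κ) : ∀ᵐ t ∂(volume.restrict (Ioo 0 T)),
      (∫⁻ x, energy a γ (u (t, x)).fst (u (t, x)).snd) + ENNReal.ofReal (κ * traceMass R t)
        ≤ ENNReal.ofReal E := by
  have he := isFluidDensity_energyDensity (d := d) ha hγ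
  have hmem := h.mem
  unfold spaceTime at hmem
  filter_upwards [h.slice_le, h.ae_integrable_slice, Measure.ae_ae_of_ae_prod hmem,
    ae_traceMass_nonneg h.stress] with t h1 h2 h3 h4
  have h5 : ∫⁻ x, energy a γ (u (t, x)).fst (u (t, x)).snd
      = ENNReal.ofReal (∫ x, energyDensity a γ (u (t, x))) := by
    rw [ofReal_integral_eq_lintegral_ofReal h2 (Eventually.of_forall fun x => he.nonneg _)]
    exact lintegral_congr_ae (h3.mono fun x hx => energy_eq_ofReal hx)
  rw [h5, ← ENNReal.ofReal_add (integral_nonneg fun x => he.nonneg _) (by positivity)]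
  exact ENNReal.ofReal_le_ofReal h1

/-- Only the upper limit of the energy bounds is controlled. Raising each bound to at least `l`
keeps it valid and makes the sequence converge, so that its Cesàro means converge too. -/
theorem tendsto_max_of_limsup_le {x : ℕ → ℝ≥0} {l : ℝ≥0∞} (hl : l < ⊤)
    (h : limsup (fun n => (x n : ℝ≥0∞)) atTop ≤ l) :
    Tendsto (fun n => max (x n : ℝ) l.toReal) atTop (𝓝 l.toReal) := by
  refine tendsto_order.2 ⟨fun b hb => Eventually.of_forall fun n => hb.trans_le (le_max_right _ _),
    fun b hb => ?_⟩
  have h1 : l < ENNReal.ofReal b := (ENNReal.lt_ofReal_iff_toReal_lt hl.ne).2 hb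
  filter_upwards [eventually_lt_of_limsup_lt (h.trans_lt h1)] with n hn
  refine max_lt ?_ hb
  simpa using (ENNReal.lt_ofReal_iff_toReal_lt ENNReal.coe_ne_top).1 hn

theorem integrable_mul_initial {f : Torus d → ℝ} (hf : Integrable f) {φ : ℝ × Torus d → ℝ}
    (hφ : Continuous φ) : Integrable fun x => f x * φ (0, x) := by
  obtain ⟨K, -, hK⟩ := exists_bound_on_slab 0 hφ
  exact hf.mul_bdd (c := K) (hφ.comp (Continuous.prodMk_right 0)).aestronglyMeasurable
    (Eventually.of_forall fun x => hK 0 ⟨le_rfl, le_rfl⟩ x)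

theorem TendstoWeaklyL1.tendsto {f : ℕ → Torus d → ℝ} {g : Torus d → ℝ}
    (h : TendstoWeaklyL1 f g) {φ : ℝ × Torus d → ℝ} (hφ : Continuous φ) :
    Tendsto (fun n => ∫ x, f n x * φ (0, x)) atTop (𝓝 (∫ x, g x * φ (0, x))) := by
  obtain ⟨K, -, hK⟩ := exists_bound_on_slab 0 hφ
  exact h (fun x => φ (0, x)) (hφ.comp (Continuous.prodMk_right 0)).measurable
    ⟨K, fun x => hK 0 ⟨le_rfl, le_rfl⟩ x⟩

theorem continuityResidual_eq {ρ₀ : Torus d → ℝ} {ρ : ℝ × Torus d → ℝ}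
    {m : ℝ × Torus d → Vec d} {φ : ℝ × Torus d → ℝ} (hφ : IsTestFunction T φ)
    (hρ : Integrable ρ (spaceTime d T)) (hm : ∀ i, Integrable (fun y => m y i) (spaceTime d T)) :
    continuityResidual T ρ₀ ρ m φ = (∫ y, ρ y * dt φ y ∂(spaceTime d T))
      + (∑ i, ∫ y, m y i * dx i φ y ∂(spaceTime d T)) + ∫ x, ρ₀ x * φ (0, x) := by
  have h1 := integrable_mul_of_continuous hρ hφ.continuous_dt
  have h2 := fun i => integrable_mul_of_continuous (hm i) (hφ.continuous_dx i)
  rw [continuityResidual, integral_add h1 (integrable_finsetSum _ fun i _ => h2 i),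
    integral_finsetSum _ fun i _ => h2 i]

/-- The pressure is absorbed as the diagonal part of the stress density, which makes the residual a
sum of terms linear in the momentum, the total stress and the initial momentum. In this form it
commutes with averaging. -/
theorem momentumResidual_eq {m₀ : Torus d → Vec d} {ρ : ℝ × Torus d → ℝ}
    {m : ℝ × Torus d → Vec d} (hm₀ : ∀ i, Integrable fun x => m₀ x i) (ha : 0 < a) (hγ : 1 < γ)
    (h : HasFiniteEnergy a γ T (toState ρ m) R)
    (hm : ∀ i, Integrable (fun y => m y i) (spaceTime d T)) {φ : Fin d → ℝ × Torus d → ℝ}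
    (hφ : ∀ i, IsTestFunction T (φ i)) {Φ : Fin d → Fin d → C_c(ℝ × Torus d, ℝ)}
    (hΦ : ∀ i j, ∀ t ∈ Icc 0 T, ∀ x, Φ i j (t, x) = dx j (φ i) (t, x)) :
    momentumResidual a γ T m₀ ρ m R φ = (∑ i, ∫ y, m y i * dt (φ i) y ∂(spaceTime d T))
      + (∑ i, ∑ j, h.pairing ha hγ i j (Φ i j)) + ∑ i, ∫ x, m₀ x i * φ i (0, x) := by
  have h1 := fun i => integrable_mul_of_continuous (hm i) (hφ i).continuous_dt
  have h2 := fun i j => h.integrable_stress ha hγ i j (Φ i j)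
  have h3 := fun i j => h.stress.integrable i j (Φ i j)
  have hA : ∫ y, (∑ i, m y i * dt (φ i) y
      + ∑ i, ∑ j, convective (ρ y) (m y) i j * dx j (φ i) y
      + pressure a γ (ρ y) * ∑ i, dx i (φ i) y) ∂(spaceTime d T)
      = (∑ i, ∫ y, m y i * dt (φ i) y ∂(spaceTime d T))
        + ∑ i, ∑ j, densityPairing a γ T (toState ρ m) i j (Φ i j) := by
    unfold densityPairing
    simp only [← integral_finsetSum _ fun j _ => h2 _ j]
    rw [← integral_finsetSum _ fun i _ => integrable_finsetSum _ fun j _ => h2 i j,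
      ← integral_finsetSum _ fun i _ => h1 i, ← integral_add (integrable_finsetSum _ fun i _ => h1 i)
      (integrable_finsetSum _ fun i _ => integrable_finsetSum _ fun j _ => h2 i j)]
    refine integral_congr_ae ?_
    filter_upwards [ae_mem_slab, h.mem] with y hy hD
    have hΦy : ∀ i j, Φ i j y = dx j (φ i) y := fun i j =>
      hΦ i j y.1 (Ioo_subset_Icc_self hy) y.2
    have hp : pressure a γ (ρ y) = a * densityPow γ (toState ρ m y) := by
      rw [densityPow_eq hγ hD]
      rfl
    rw [add_assoc, hp, Finset.mul_sum, ← Finset.sum_add_distrib]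
    congr 1
    refine Finset.sum_congr rfl fun i _ => ?_
    simp only [stressDensity, hΦy, mul_add, Finset.sum_add_distrib, mul_ite, mul_zero,
      Finset.sum_ite_eq, Finset.mem_univ, if_true]
    rw [mul_comm (a * _)]
    congr 1
    exact Finset.sum_congr rfl fun j _ => mul_comm _ _
  have hB : ∫ t in Ioo 0 T, ∑ i, ∑ j, ∫ᵛ x, dx j (φ i) (t, x) ∂•(R t i j)
      = ∑ i, ∑ j, stressFunctional T R i j (Φ i j) := by
    unfold stressFunctional
    simp only [← integral_finsetSum _ fun j _ => h3 _ j]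
    rw [← integral_finsetSum _ fun i _ => integrable_finsetSum _ fun j _ => h3 i j]
    refine integral_congr_ae ?_
    filter_upwards [ae_restrict_mem measurableSet_Ioo] with t ht
    simp only [hΦ _ _ t (Ioo_subset_Icc_self ht)]
  have hC : ∫ x, ∑ i, m₀ x i * φ i (0, x) = ∑ i, ∫ x, m₀ x i * φ i (0, x) :=
    integral_finsetSum _ fun i _ => integrable_mul_initial (hm₀ i) (hφ i).continuous
  have hpair : ∀ i j, h.pairing ha hγ i j (Φ i j)
      = densityPairing a γ T (toState ρ m) i j (Φ i j) + stressFunctional T R i j (Φ i j) :=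
    fun i j => rfl
  rw [momentumResidual, hA, hB, hC]
  simp only [hpair, Finset.sum_add_distrib]
  ring

theorem integrable_vec_apply {α : Type*} [MeasurableSpace α] {μ : Measure α} {f : α → Vec d}
    (hf : Integrable f μ) (i : Fin d) : Integrable (fun x => f x i) μ :=
  (EuclideanSpace.proj (𝕜 := ℝ) i).integrable_comp hf

end Equations

end EulerS

namespace EulerS

/-! ### Limits of consistent approximations -/

section Consistent

variable {d : ℕ} {a γ κ T : ℝ} {ρ₀ : Torus d → ℝ} {m₀ : Torus d → Vec d}
  {ρn : ℕ → ℝ × Torus d → ℝ} {mn : ℕ → ℝ × Torus d → Vec d}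

theorem IsConsistentApproximation.aemeasurable
    (happrox : IsConsistentApproximation a γ κ T ρ₀ m₀ ρn mn) (n : ℕ) :
    AEMeasurable (toState (ρn n) (mn n)) (spaceTime d T) :=
  aemeasurable_toState (happrox.measurable_density n) (happrox.measurable_momentum n)

theorem IsConsistentApproximation.exists_growth_le (ha : 0 < a) (hγ : 1 < γ)
    (happrox : IsConsistentApproximation a γ κ T ρ₀ m₀ ρn mn) :
    ∃ C : ℝ≥0, ∀ n, ∫⁻ y, ENNReal.ofReal (eulerGrowth γ (toState (ρn n) (mn n) y))
      ∂(spaceTime d T) ≤ C := by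
  obtain ⟨R, r₀, μ₀, En, -, -, -, -, -, hener, -, -, hlimsup⟩ := happrox.equations
  obtain ⟨K, hK⟩ := (tendsto_max_of_limsup_le happrox.finite_initial_energy
    hlimsup).bddAbove_range
  have hEK : ∀ n, En n ≤ K.toNNReal := fun n =>
    NNReal.le_toNNReal_of_coe_le ((le_max_left _ _).trans (hK ⟨n, rfl⟩))
  refine ⟨(growthConst a γ).toNNReal * (K.toNNReal * T.toNNReal), fun n => ?_⟩
  calc _ ≤ ∫⁻ y, ENNReal.ofReal (growthConst a γ) * energy a γ (toState (ρn n) (mn n) y).fst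
          (toState (ρn n) (mn n) y).snd ∂(spaceTime d T) :=
        lintegral_mono fun y => eulerGrowth_le_energy ha hγ _
    _ = ENNReal.ofReal (growthConst a γ) * ∫⁻ y, energy a γ (toState (ρn n) (mn n) y).fst
          (toState (ρn n) (mn n) y).snd ∂(spaceTime d T) :=
        lintegral_const_mul' _ _ ENNReal.ofReal_ne_top
    _ ≤ ENNReal.ofReal (growthConst a γ) * (K.toNNReal * ENNReal.ofReal T) := by
        refine mul_le_mul_right (lintegral_energy_le ha hγ (happrox.aemeasurable n) ?_) _
        filter_upwards [hener n] with t ht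
        exact (le_self_add.trans ht).trans (ENNReal.coe_le_coe.2 (hEK n))
    _ = _ := by
        push_cast
        rfl

/-- The expectations of density and momentum form a dissipative solution. -/
theorem IsConsistentApproximation.isDissipativeSolution (hd : 1 ≤ d) (hT : 0 < T) (ha : 0 < a)
    (hγ : 1 < γ) (hκ : 0 < κ) (hκ₁ : κ ≤ 1 / 2) (hκ₂ : κ ≤ 1 / (d * (γ - 1)))
    (happrox : IsConsistentApproximation a γ κ T ρ₀ m₀ ρn mn)
    {V : Kernel (ℝ × Torus d) (State d)} [IsMarkovKernel V]
    (hV : MeansTendsto (spaceTime d T) 1 (fun n => toState (ρn n) (mn n)) V) :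
    IsDissipativeSolution a γ κ T ρ₀ m₀ (meanDensity V) (meanMomentum V) := by
  have hU := happrox.aemeasurable
  obtain ⟨C, hC⟩ := happrox.exists_growth_le ha hγ
  have havg := averagesConverge hγ isAveraging_one hU hC hV
  have hρm := ((havg.density 1 le_rfl hγ).1.1).aemeasurable
  have hmm := ((havg.momentum 1 le_rfl (one_lt_momentumExponent hγ)).1.1).aemeasurable
  refine ⟨hρm, hmm, happrox.finite_initial_energy, ?_⟩
  obtain ⟨Rn, r₀, μ₀, En, hR, hr₀, hμ₀, hcont, hmom, hener, hwr, hwμ, hlimsup⟩ :=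
    happrox.equations
  have hE := tendsto_max_of_limsup_le happrox.finite_initial_energy hlimsup
  have hbound : ∀ n, HasEnergyBound a γ κ T (max (En n : ℝ) (totalEnergy a γ ρ₀ m₀).toReal)
      (toState (ρn n) (mn n)) (Rn n) := fun n =>
    (hasEnergyBound ha hγ (hU n) (hR n) (hener n)).mono (le_max_left _ _)
  -- The energy bound obtained for the limit is the initial energy itself, because the modified
  -- bounds `max (En n) _` converge to it.
  obtain ⟨R, hRE, hlimR⟩ := exists_limit_stress hd hT ha hγ hκ hκ₁ hκ₂ hbound hE
    ENNReal.toReal_nonneg (aemeasurable_toState hρm hmm) fun ns hns => havg.exists_subseq hγ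
      (fun n => (happrox.measurable_density n).aestronglyMeasurable)
      (fun n => (happrox.measurable_momentum n).aestronglyMeasurable) hns
  have hfst := fun {g : ℝ × Torus d → ℝ} (hg : Continuous g) =>
    tendsto_weightedMean_integral hγ hU hC hV (F := fun u => u.fst) (WithLp.continuous_fst ..)
      (isSmallGrowth_density zero_le_one hγ) (abs_fst_le_growth hγ) hg
  have hsnd := fun (i : Fin d) {g : ℝ × Torus d → ℝ} (hg : Continuous g) =>
    tendsto_weightedMean_integral hγ hU hC hV (F := fun u => u.snd i) (continuous_snd_apply i)
      (isSmallGrowth_momentum zero_le_one (one_lt_momentumExponent hγ) i)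
      (abs_snd_le_growth hγ i) hg
  have hρi : Integrable (meanDensity V) (spaceTime d T) := (hfst continuous_const (g := 0)).1
  have hmi : ∀ i, Integrable (fun y => meanMomentum V y i) (spaceTime d T) := fun i =>
    (hsnd i continuous_const (g := 0)).1
  have hρni : ∀ n, Integrable (ρn n) (spaceTime d T) := fun n =>
    integrable_of_abs_le_growth (hU n) (hC n) hγ measurable_fst_state (abs_fst_le_growth hγ)
  have hmni : ∀ n i, Integrable (fun y => mn n y i) (spaceTime d T) := fun n i =>
    integrable_of_abs_le_growth (hU n) (hC n) hγ (continuous_snd_apply i).measurable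
      (abs_snd_le_growth hγ i)
  refine ⟨R, hRE.stress, fun φ hφ => ?_, fun φ hφ => ?_, ?_⟩
  -- The averaged residuals tend to zero, and each of their terms tends to the corresponding term
  -- for the barycentres; uniqueness of the limit gives the equation.
  · have h1 := tendsto_weightedMean_one (hcont φ hφ)
    have h2 := ((hfst hφ.continuous_dt).2.add (tendsto_finsetSum Finset.univ fun i _ =>
      (hsnd i (hφ.continuous_dx i)).2)).add (tendsto_weightedMean_one (hwr.tendsto hφ.continuous))
    rw [continuityResidual_eq hφ hρi hmi]
    refine tendsto_nhds_unique h2 (h1.congr fun N => ?_)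
    simp only [fun n => continuityResidual_eq (ρ₀ := r₀ n) hφ (hρni n) (hmni n)]
    rw [weightedMean_add, weightedMean_add, weightedMean_sum]
    rfl
  -- The averaged stresses converge only along the ultrafilter. It is finer than `atTop`, so the
  -- other limits hold along it as well, and limits along it are unique.
  · choose Φ hΦ using fun i j => exists_compactlySupported_eq T ((hφ i).continuous_dx j)
    have h1 := tendsto_weightedMean_one (hmom φ hφ)
    have h2 := ((tendsto_finsetSum Finset.univ fun i _ =>
      (hsnd i (hφ i).continuous_dt).2.mono_left Nat.hyperfilter_le_atTop).add
        (tendsto_finsetSum Finset.univ fun i _ => tendsto_finsetSum Finset.univ fun j _ =>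
          hlimR i j (Φ i j))).add (tendsto_finsetSum Finset.univ fun i _ =>
        (tendsto_weightedMean_one ((hwμ i).tendsto (hφ i).continuous)).mono_left
          Nat.hyperfilter_le_atTop)
    rw [momentumResidual_eq (fun i => integrable_vec_apply happrox.integrable_initial_momentum i)
      ha hγ hRE.toHasFiniteEnergy hmi hφ hΦ]
    refine tendsto_nhds_unique h2
      ((h1.mono_left Nat.hyperfilter_le_atTop).congr fun N => ?_)
    simp only [fun n => momentumResidual_eq (fun i => integrable_vec_apply (hμ₀ n) i)
      ha hγ (hbound n).toHasFiniteEnergy (hmni n) hφ hΦ]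
    rw [weightedMean_add, weightedMean_add, weightedMean_sum, weightedMean_sum, weightedMean_sum]
    simp only [weightedMean_sum]
    rfl
  · filter_upwards [hRE.ae_lintegral_energy_le ha hγ hκ] with t ht
    rw [ENNReal.ofReal_toReal happrox.finite_initial_energy.ne] at ht
    exact ht

end Consistent

end EulerS

/-! ### The main theorem -/

theorem corollary5p1 {d : ℕ} (hd : 1 ≤ d) (T a γ κ : ℝ) (hT : 0 < T) (ha : 0 < a) (hγ : 1 < γ)
    (hκ : 0 < κ) (hκ₁ : κ ≤ 1 / 2) (hκ₂ : κ ≤ 1 / (d * (γ - 1)))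
    (ρ₀ : EulerS.Torus d → ℝ) (m₀ : EulerS.Torus d → EulerS.Vec d)
    (ρn : ℕ → ℝ × EulerS.Torus d → ℝ) (mn : ℕ → ℝ × EulerS.Torus d → EulerS.Vec d)
    (happrox : EulerS.IsConsistentApproximation a γ κ T ρ₀ m₀ ρn mn)
    (hS : EulerS.WeaklySConvergent (EulerS.spaceTime d T)
      (fun n => EulerS.toState (ρn n) (mn n))) :
    ∃ (ρ : ℝ × EulerS.Torus d → ℝ) (m : ℝ × EulerS.Torus d → EulerS.Vec d)
      (V : Kernel (ℝ × EulerS.Torus d) (EulerS.State d)),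
      EulerS.IsDissipativeSolution a γ κ T ρ₀ m₀ ρ m ∧
      IsMarkovKernel V ∧
      EulerS.SConvergesTo (EulerS.spaceTime d T) (fun n => EulerS.toState (ρn n) (mn n)) V ∧
      (∀ V' : Kernel (ℝ × EulerS.Torus d) (EulerS.State d), IsMarkovKernel V' →
        EulerS.SConvergesTo (EulerS.spaceTime d T) (fun n => EulerS.toState (ρn n) (mn n)) V' →
        ∀ᵐ y ∂(EulerS.spaceTime d T), V' y = V y) ∧
      EulerS.AveragesConverge γ T 1 ρn mn ρ m V ∧
      (EulerS.StronglySConvergent (EulerS.spaceTime d T)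
          (fun n => EulerS.toState (ρn n) (mn n)) →
        ∀ w ∈ EulerS.Weights, EulerS.AveragesConverge γ T w ρn mn ρ m V) := by
  have hU := happrox.aemeasurable
  obtain ⟨C, hC⟩ := happrox.exists_growth_le ha hγ
  obtain ⟨V, hVm, hV⟩ := EulerS.exists_kernel_of_means hU (EulerS.isGrowth_eulerGrowth hγ) hC
    (hS.exists_limit hU)
  have hlim := hV.hasSLimit EulerS.isAveraging_one hU
  refine ⟨EulerS.meanDensity V, EulerS.meanMomentum V, V,
    happrox.isDissipativeSolution hd hT ha hγ hκ hκ₁ hκ₂ hV, hVm, ⟨hS, hlim⟩,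
    fun V' _ hV' => hlim.ae_eq hV'.2,
    EulerS.averagesConverge hγ EulerS.isAveraging_one hU hC hV, fun hstrong w hw => ?_⟩
  -- For a general weight only the convergence of the means of `C_c` observables to the same kernel
  -- has to be supplied; strong (S)-convergence identifies the weighted limit with the Cesàro one.
  exact EulerS.averagesConverge hγ (EulerS.isAveraging_of_mem hw) hU hC fun b =>
    hstrong.tendsto hU b (EulerS.integrable_expectation b) (hV b) hw
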